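/- There are a single randomized word-RAM program $P$, an integer $K \ge 1$ and a real constant $C > 0$ such that the following holds for every $n \ge 1$, every list of (not necessarily distinct) positive integers $s_1,\dots,s_n$, every target integer $t \ge 0$, and every word length $w \ge K\,(\lfloor\log_2(n+t)\rfloor + 1)$ for which each $s_i$ fits into one word ($s_i < 2^w$). (1) On input $(s_1,\dots,s_n;t)$, for every outcome of its coin tosses, $P$ halts with an answer "yes" or "no" after at most $C\,(n + t\log^2 t)$ steps (where $t\log^2 t$ is read as $0$ for $t=0$). In particular its worst-case running time is $\tilde O(n+t)$. (2) If there is an index set $I \subseteq \{1,\dots,n\}$ with $\sum_{i\in I} s_i = t$, then $P$ answers "no" with probability at most $C/(n+t)$. (3) If there is no such $I$, then $P$ always answers "no". That is, SubsetSum is solved in time $O(n + t\log^2 t) = \tilde O(n+t)$ by a randomized algorithm with one-sided error probability $O((n+t)^{-1})$. Here a randomized word RAM has a memory of $w$-bit words addressed by words and a fixed number of registers; loading a constant, copying a register, a load, a store, addition, subtraction, multiplication, division with remainder, a bitwise operation, a shift, a comparison of two words, and the toss of a fair coin (independent of the others) take one step each. -/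

import Mathlib

/-- The decision problem: some set of indices `I` has `∑ i ∈ I, s i = t`. -/
def SubsetSum {n : ℕ} (s : Fin n → ℕ) (t : ℕ) : Prop :=
  ∃ I : Finset (Fin n), ∑ i ∈ I, s i = t

namespace WordRAM

/-- Binary word operations. -/
inductive BinOp
  | add | sub | mul | div | mod | and | or | xor | shl | shr

/-- The value of a binary operation on `w`-bit words, that is, on natural numbers below `2 ^ w`.
Results wrap around modulo `2 ^ w`. -/
def BinOp.eval (w : ℕ) : BinOp → ℕ → ℕ → ℕ
  | .add, a, b => (a + b) % 2 ^ w
  | .sub, a, b => (a + (2 ^ w - b)) % 2 ^ w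
  | .mul, a, b => (a * b) % 2 ^ w
  | .div, a, b => a / b
  | .mod, a, b => a % b
  | .and, a, b => a &&& b
  | .or, a, b => a ||| b
  | .xor, a, b => a ^^^ b
  | .shl, a, b => (a <<< b) % 2 ^ w
  | .shr, a, b => a >>> b

/-- Tests on the contents of two registers. -/
inductive Test
  | lt (a b : ℕ)
  | eq (a b : ℕ)

/-- Programs of a randomized word RAM. The numbers `d`, `a`, `b` are names of registers.
Since a program is a finite object, it names only finitely many registers; all other storage is the
word-addressed memory, which is reached through `load` and `store`. Control flow is structured
(branching and loops), which a RAM with jumps simulates with constant overhead. -/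
inductive Program
  /-- do nothing -/
  | skip
  /-- `reg d := c`, for a literal `c` of the program -/
  | const (d c : ℕ)
  /-- `reg d := reg a` -/
  | copy (d a : ℕ)
  /-- `reg d := reg a o reg b` -/
  | op (o : BinOp) (d a b : ℕ)
  /-- `reg d := mem (reg a)` -/
  | load (d a : ℕ)
  /-- `mem (reg a) := reg b` -/
  | store (a b : ℕ)
  /-- `reg d :=` a fresh random bit -/
  | flip (d : ℕ)
  /-- first `p`, then `q` -/
  | seq (p q : Program)
  /-- if `c` then `p` else `q` -/
  | cond (c : Test) (p q : Program)
  /-- while `c` do `p` -/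
  | loop (c : Test) (p : Program)

/-- A machine state: registers, memory, and the coin tosses that have not been used yet. -/
structure State where
  reg : ℕ → ℕ
  mem : ℕ → ℕ
  coins : ℕ → Bool

/-- Write the word `v` into register `d`. -/
def State.setReg (σ : State) (d v : ℕ) : State :=
  { σ with reg := Function.update σ.reg d v }

/-- Write the word `v` into the memory cell with address `i`. -/
def State.setMem (σ : State) (i v : ℕ) : State :=
  { σ with mem := Function.update σ.mem i v }

/-- Write the next coin toss into register `d` as `0` or `1`, and use it up. -/
def State.toss (σ : State) (d : ℕ) : State :=
  { reg := Function.update σ.reg d (σ.coins 0).toNat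
    mem := σ.mem
    coins := fun k => σ.coins (k + 1) }

/-- The outcome of a test in a state. -/
def Test.Holds (σ : State) : Test → Prop
  | .lt a b => σ.reg a < σ.reg b
  | .eq a b => σ.reg a = σ.reg b

/-- `Exec w p σ σ' T`: with word length `w`, the program `p` started in the state `σ` halts in the
state `σ'` after `T` steps. Every elementary instruction and every evaluation of a test is one
step. -/
inductive Exec (w : ℕ) : Program → State → State → ℕ → Prop
  | skip (σ : State) : Exec w .skip σ σ 1
  | const (σ : State) (d c : ℕ) : Exec w (.const d c) σ (σ.setReg d (c % 2 ^ w)) 1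
  | copy (σ : State) (d a : ℕ) : Exec w (.copy d a) σ (σ.setReg d (σ.reg a)) 1
  | op (σ : State) (o : BinOp) (d a b : ℕ) :
      Exec w (.op o d a b) σ (σ.setReg d (o.eval w (σ.reg a) (σ.reg b))) 1
  | load (σ : State) (d a : ℕ) : Exec w (.load d a) σ (σ.setReg d (σ.mem (σ.reg a))) 1
  | store (σ : State) (a b : ℕ) : Exec w (.store a b) σ (σ.setMem (σ.reg a) (σ.reg b)) 1
  | flip (σ : State) (d : ℕ) : Exec w (.flip d) σ (σ.toss d) 1
  | seq {p q : Program} {σ σ₁ σ₂ : State} {T₁ T₂ : ℕ} :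
      Exec w p σ σ₁ T₁ → Exec w q σ₁ σ₂ T₂ → Exec w (.seq p q) σ σ₂ (T₁ + T₂)
  | cond_true {c : Test} {p q : Program} {σ σ' : State} {T : ℕ} :
      c.Holds σ → Exec w p σ σ' T → Exec w (.cond c p q) σ σ' (1 + T)
  | cond_false {c : Test} {p q : Program} {σ σ' : State} {T : ℕ} :
      ¬ c.Holds σ → Exec w q σ σ' T → Exec w (.cond c p q) σ σ' (1 + T)
  | loop_done {c : Test} {p : Program} {σ : State} :
      ¬ c.Holds σ → Exec w (.loop c p) σ σ 1
  | loop_step {c : Test} {p : Program} {σ σ₁ σ₂ : State} {T₁ T₂ : ℕ} :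
      c.Holds σ → Exec w p σ σ₁ T₁ → Exec w (.loop c p) σ₁ σ₂ T₂ →
        Exec w (.loop c p) σ σ₂ (1 + T₁ + T₂)

/-- Execution is deterministic once the coin tosses are fixed, so that "the final state" and
"the number of steps" of a run are well defined. -/
theorem Exec.deterministic {w : ℕ} {p : Program} {σ σ₁ σ₂ : State} {T₁ T₂ : ℕ}
    (h₁ : Exec w p σ σ₁ T₁) (h₂ : Exec w p σ σ₂ T₂) : σ₁ = σ₂ ∧ T₁ = T₂ := by
  induction h₁ generalizing σ₂ T₂ with
  | skip => cases h₂; exact ⟨rfl, rfl⟩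
  | const => cases h₂; exact ⟨rfl, rfl⟩
  | copy => cases h₂; exact ⟨rfl, rfl⟩
  | op => cases h₂; exact ⟨rfl, rfl⟩
  | load => cases h₂; exact ⟨rfl, rfl⟩
  | store => cases h₂; exact ⟨rfl, rfl⟩
  | flip => cases h₂; exact ⟨rfl, rfl⟩
  | seq _ _ ih₁ ih₂ =>
    cases h₂ with
    | seq a b =>
      obtain ⟨rfl, rfl⟩ := ih₁ a
      obtain ⟨rfl, rfl⟩ := ih₂ b
      exact ⟨rfl, rfl⟩
  | cond_true hc _ ih =>
    cases h₂ with
    | cond_true _ a => obtain ⟨rfl, rfl⟩ := ih a; exact ⟨rfl, rfl⟩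
    | cond_false hc' _ => exact absurd hc hc'
  | cond_false hc _ ih =>
    cases h₂ with
    | cond_true hc' _ => exact absurd hc' hc
    | cond_false _ a => obtain ⟨rfl, rfl⟩ := ih a; exact ⟨rfl, rfl⟩
  | loop_done hc =>
    cases h₂ with
    | loop_done => exact ⟨rfl, rfl⟩
    | loop_step hc' _ _ => exact absurd hc' hc
  | loop_step hc _ _ ih₁ ih₂ =>
    cases h₂ with
    | loop_done hc' => exact absurd hc hc'
    | loop_step _ a b =>
      obtain ⟨rfl, rfl⟩ := ih₁ a
      obtain ⟨rfl, rfl⟩ := ih₂ b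
      exact ⟨rfl, rfl⟩

/-- The initial state on the instance `(s, t)`: register `0` holds `n`, register `1` holds `t`, the
memory cells `0, …, n - 1` hold the numbers `s i`, and all else is `0`. -/
def input {n : ℕ} (s : Fin n → ℕ) (t : ℕ) (ω : ℕ → Bool) : State where
  reg := fun k => if k = 0 then n else if k = 1 then t else 0
  mem := fun k => if h : k < n then s ⟨k, h⟩ else 0
  coins := ω

/-- With word length `w` and coin tosses `ω`, the program `p` halts on the instance `(s, t)` after
`T` steps, and register `0` then holds the answer `b` (`1` for yes, `0` for no). -/
def Answers (w : ℕ) (p : Program) {n : ℕ} (s : Fin n → ℕ) (t : ℕ) (ω : ℕ → Bool)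
    (b : Bool) (T : ℕ) : Prop :=
  ∃ σ, Exec w p (input s t ω) σ T ∧ σ.reg 0 = b.toNat

/-- The law of an infinite sequence of independent fair coin tosses. -/
noncomputable def fairCoins : MeasureTheory.Measure (ℕ → Bool) :=
  MeasureTheory.Measure.infinitePi fun _ => (PMF.uniformOfFintype Bool).toMeasure

end WordRAM

/-! Values above `t` are useless. Three copies of `v` have the same subset sums as one copy of `v`
and one of `2 * v`; going upwards through the values, one may therefore keep at most two copies of
each (`mem_sums_pairing_iff`). The remaining items are sorted, and item `i`, counted from `0`, is at
least `(i + 1) / 2` (`pairing_its`). Two things follow: `∑ t / its i` is dominated by a harmonic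
sum, hence `O(t log t)`, and a set of items with sum `t` has at most `2√t` members.

If `t² ≤ n`, dynamic programming over at most `2t` items costs `O(t²) = O(n)` and never errs.
Otherwise each item gets a random weight `r i` of `⌊log₂ t⌋` bits, and the coefficient of `X ^ t` in
`f = ∏ (1 + r i * X ^ its i)` is computed modulo a prime `p` with `t < p ≤ 2t`. As a polynomial in
the weights it has one squarefree monomial for each set of items with sum `t`. Without such a set it
is zero, so the error is one-sided (`Success.mem_sums`). With one it is a nonzero polynomial of
degree at most `2√t`, and by Schwartz–Zippel (`card_failures_le`) it vanishes at the random weights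
with probability `O(t^(-1/2))`. Four trials on disjoint coins all fail with probability `O(t^(-2))`,
which is `O(1/(n+t))` since `n < t²` (`fairCoins_four_trials_le`).

For the coefficients `c` of `f`, let `g = X f' / f`. It is a sum of geometric series, so its
coefficients are explicit, and `X f' = g f` reads `x * c x = ∑ a < x, c a * g (x - a)`
(`natCast_mul_coeff_sumSeries`), where `x ≤ t < p` is invertible. The `c a` become known one after
the other, so this is an online convolution: at time `x`, the block of `2 ^ lb x` known values that
ends at `x` is multiplied by the beginning of `g`, and every term enters its sum exactly once and in
time (`sum_blocks`). The blocks have total length `O(t log t)`, and fast Fourier transforms bring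
the cost to `O(t log² t)`.

The transforms are complex, in fixed point arithmetic with unit `2 ^ (64 * ν)`, where `t < 2 ^ ν ≤
2t`. The accumulated error stays below half the scale of the result, so rounding recovers the
integer coefficients exactly (`wp_conv`). The roots of unity come from half-angle formulas and
integer square roots (`wp_roots`).

Programs are written in a small language whose state carries the exact step count. Its weakest
precondition calculus is sound for the compiled code (`Stm.exec_code`), so that correctness, coin
usage and running time are all postconditions. -/

namespace WordRAM

/-! ### A small language, its compiler, and a weakest precondition calculus with step counts -/

/-- Expressions over registers and memory. `raw` is a machine operation with wrap-around, the other
operations are exact operations on natural numbers that are only meaningful without overflow. -/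
inductive Ex
  | v (r : ℕ)
  | c (n : ℕ)
  | ld (a : Ex)
  | add (a b : Ex)
  | sub (a b : Ex)
  | mul (a b : Ex)
  | div (a b : Ex)
  | mod (a b : Ex)
  | raw (o : BinOp) (a b : Ex)

infixl:65 " +ₑ " => Ex.add
infixl:65 " -ₑ " => Ex.sub
infixl:70 " *ₑ " => Ex.mul
infixl:70 " /ₑ " => Ex.div
infixl:70 " %ₑ " => Ex.mod

/-- Statements of a small imperative language that is compiled to word RAM programs. -/
inductive Stm
  | asg (x : ℕ) (e : Ex)
  | sto (a e : Ex)
  | flip (x : ℕ)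
  | seq (p q : Stm)
  | ite (a b : Ex) (p q : Stm)
  | whl (a b : ℕ) (p : Stm)

infixr:60 " ;; " => Stm.seq

/-- Abstract states: machine states with a step counter. -/
structure St where
  reg : ℕ → ℕ
  mem : ℕ → ℕ
  coins : ℕ → Bool
  tm : ℕ

/-- Write a register, at a cost. -/
def St.set (s : St) (x v k : ℕ) : St :=
  ⟨fun r => if r = x then v else s.reg r, s.mem, s.coins, s.tm + k⟩

/-- Write a memory cell, at a cost. -/
def St.put (s : St) (a v k : ℕ) : St :=
  ⟨s.reg, fun i => if i = a then v else s.mem i, s.coins, s.tm + k⟩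

/-- Let time pass. -/
def St.tick (s : St) (k : ℕ) : St := ⟨s.reg, s.mem, s.coins, s.tm + k⟩

/-- Toss a coin into a register. -/
def St.toss (s : St) (x : ℕ) : St :=
  ⟨fun r => if r = x then (s.coins 0).toNat else s.reg r, s.mem, fun k => s.coins (k + 1), s.tm + 1⟩

namespace St
@[simp] theorem set_mem (s : St) (x v k : ℕ) : (s.set x v k).mem = s.mem := rfl
@[simp] theorem set_coins (s : St) (x v k : ℕ) : (s.set x v k).coins = s.coins := rfl
@[simp] theorem set_tm (s : St) (x v k : ℕ) : (s.set x v k).tm = s.tm + k := rfl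
@[simp] theorem set_reg (s : St) (x v k r : ℕ) :
    (s.set x v k).reg r = if r = x then v else s.reg r := rfl
@[simp] theorem put_reg (s : St) (x v k : ℕ) : (s.put x v k).reg = s.reg := rfl
@[simp] theorem put_coins (s : St) (x v k : ℕ) : (s.put x v k).coins = s.coins := rfl
@[simp] theorem put_tm (s : St) (x v k : ℕ) : (s.put x v k).tm = s.tm + k := rfl
@[simp] theorem put_mem (s : St) (x v k i : ℕ) :
    (s.put x v k).mem i = if i = x then v else s.mem i := rfl
@[simp] theorem tick_reg (s : St) (k : ℕ) : (s.tick k).reg = s.reg := rfl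
@[simp] theorem tick_mem (s : St) (k : ℕ) : (s.tick k).mem = s.mem := rfl
@[simp] theorem tick_coins (s : St) (k : ℕ) : (s.tick k).coins = s.coins := rfl
@[simp] theorem tick_tm (s : St) (k : ℕ) : (s.tick k).tm = s.tm + k := rfl
@[simp] theorem toss_reg (s : St) (x r : ℕ) :
    (s.toss x).reg r = if r = x then (s.coins 0).toNat else s.reg r := rfl
@[simp] theorem toss_mem (s : St) (x : ℕ) : (s.toss x).mem = s.mem := rfl
@[simp] theorem toss_coins (s : St) (x : ℕ) : (s.toss x).coins = fun k => s.coins (k + 1) := rfl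
@[simp] theorem toss_tm (s : St) (x : ℕ) : (s.toss x).tm = s.tm + 1 := rfl
end St

namespace Ex

/-- The value of an expression. -/
@[simp] def val (w : ℕ) (s : St) : Ex → ℕ
  | v r => s.reg r
  | c n => n
  | ld a => s.mem (a.val w s)
  | add a b => a.val w s + b.val w s
  | sub a b => a.val w s - b.val w s
  | mul a b => a.val w s * b.val w s
  | div a b => a.val w s / b.val w s
  | mod a b => a.val w s % b.val w s
  | raw o a b => o.eval w (a.val w s) (b.val w s)

/-- No overflow occurs in the evaluation of an expression. -/
@[simp] def Ok (w : ℕ) (s : St) : Ex → Prop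
  | v _ => True
  | c n => n < 2 ^ w
  | ld a => a.Ok w s
  | add a b => a.Ok w s ∧ b.Ok w s ∧ a.val w s + b.val w s < 2 ^ w
  | sub a b => a.Ok w s ∧ b.Ok w s ∧ b.val w s ≤ a.val w s ∧ a.val w s < 2 ^ w
  | mul a b => a.Ok w s ∧ b.Ok w s ∧ a.val w s * b.val w s < 2 ^ w
  | div a b => a.Ok w s ∧ b.Ok w s
  | mod a b => a.Ok w s ∧ b.Ok w s
  | raw _ a b => a.Ok w s ∧ b.Ok w s

/-- The number of steps of the evaluation. -/
@[simp] def cost : Ex → ℕ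
  | v _ => 1
  | c _ => 1
  | ld a => a.cost + 1
  | add a b => a.cost + b.cost + 1
  | sub a b => a.cost + b.cost + 1
  | mul a b => a.cost + b.cost + 1
  | div a b => a.cost + b.cost + 1
  | mod a b => a.cost + b.cost + 1
  | raw _ a b => a.cost + b.cost + 1

/-- Only the registers below `100` are used as variables. -/
def wf : Ex → Bool
  | v r => r < 100
  | c _ => true
  | ld a => a.wf
  | add a b => a.wf && b.wf
  | sub a b => a.wf && b.wf
  | mul a b => a.wf && b.wf
  | div a b => a.wf && b.wf
  | mod a b => a.wf && b.wf
  | raw _ a b => a.wf && b.wf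

/-- Code that evaluates an expression into register `d`, with scratch registers above `d`. -/
def code : Ex → ℕ → Program
  | v r, d => .copy d r
  | c n, d => .const d n
  | ld a, d => .seq (a.code d) (.load d d)
  | add a b, d => .seq (.seq (a.code d) (b.code (d + 1))) (.op .add d d (d + 1))
  | sub a b, d => .seq (.seq (a.code d) (b.code (d + 1))) (.op .sub d d (d + 1))
  | mul a b, d => .seq (.seq (a.code d) (b.code (d + 1))) (.op .mul d d (d + 1))
  | div a b, d => .seq (.seq (a.code d) (b.code (d + 1))) (.op .div d d (d + 1))
  | mod a b, d => .seq (.seq (a.code d) (b.code (d + 1))) (.op .mod d d (d + 1))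
  | raw o a b, d => .seq (.seq (a.code d) (b.code (d + 1))) (.op o d d (d + 1))

end Ex

/-- A machine state realizes an abstract state, up to scratch registers. -/
def Sim (σ : State) (s : St) : Prop :=
  (∀ r < 100, σ.reg r = s.reg r) ∧ σ.mem = s.mem ∧ σ.coins = s.coins

/-- The result of evaluating the value `v` into register `d`. -/
def Evald (σ σ' : State) (s : St) (d v : ℕ) : Prop :=
  Sim σ' s ∧ σ'.reg d = v ∧ ∀ r < d, σ'.reg r = σ.reg r

theorem Sim.setReg {σ : State} {s : St} (h : Sim σ s) {d : ℕ} (hd : 100 ≤ d) (x : ℕ) :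
    Sim (σ.setReg d x) s := by
  refine ⟨fun r hr => ?_, h.2.1, h.2.2⟩
  simp [State.setReg, Function.update, show r ≠ d by omega, h.1 r hr]

theorem evald_setReg {σ : State} {s : St} (h : Sim σ s) {d : ℕ} (hd : 100 ≤ d) (x : ℕ) :
    Evald σ (σ.setReg d x) s d x := by
  refine ⟨h.setReg hd x, by simp [State.setReg], fun r hr => ?_⟩
  simp [State.setReg, Function.update, show r ≠ d by omega]

/-- The left operand survives in register `d` because the code of the right operand leaves
everything below `d + 1` unchanged; this is why `Evald` speaks about all lower registers. -/
theorem exec_binary {w : ℕ} {pa pb : Program} {σ : State} {s : St} {d va vb ca cb : ℕ}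
    (hd : 100 ≤ d) (hσ : Sim σ s) (o : BinOp)
    (ha : ∃ σ', Exec w pa σ σ' ca ∧ Evald σ σ' s d va)
    (hb : ∀ σ, Sim σ s → ∃ σ', Exec w pb σ σ' cb ∧ Evald σ σ' s (d + 1) vb) :
    ∃ σ', Exec w (.seq (.seq pa pb) (.op o d d (d + 1))) σ σ' (ca + cb + 1) ∧
      Evald σ σ' s d (o.eval w va vb) := by
  obtain ⟨σ₁, e₁, h₁⟩ := ha
  obtain ⟨σ₂, e₂, h₂⟩ := hb σ₁ h₁.1
  refine ⟨_, (e₁.seq e₂).seq (.op _ _ _ _ _), ?_⟩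
  have h3 := evald_setReg h₂.1 hd (o.eval w (σ₂.reg d) (σ₂.reg (d + 1)))
  have e1 : σ₂.reg d = va := by rw [h₂.2.2 d (by omega), h₁.2.1]
  rw [e1, h₂.2.1] at h3 ⊢
  exact ⟨h3.1, h3.2.1, fun r hr => by rw [h3.2.2 r hr, h₂.2.2 r (by omega), h₁.2.2 r hr]⟩

/-- Absence of overflow makes the wrapped machine operations agree with the exact ones; `raw` needs
no such condition, because its value is the machine operation itself. -/
theorem Ex.exec_code {w : ℕ} {s : St} (e : Ex) : ∀ {σ : State} {d : ℕ}, 100 ≤ d → e.wf = true →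
    e.Ok w s → Sim σ s → ∃ σ', Exec w (e.code d) σ σ' e.cost ∧ Evald σ σ' s d (e.val w s) := by
  induction e with
  | v r =>
    intro σ d hd hwf _ hσ
    simp only [Ex.wf, decide_eq_true_eq] at hwf
    have h := evald_setReg hσ hd (σ.reg r)
    rw [hσ.1 r hwf] at h
    exact ⟨_, .copy _ _ _, by rw [hσ.1 r hwf]; exact h⟩
  | c n =>
    intro σ d hd _ hok hσ
    have h := evald_setReg hσ hd n
    refine ⟨_, .const _ _ _, ?_⟩
    rw [Nat.mod_eq_of_lt hok]
    exact h
  | ld a iha =>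
    intro σ d hd hwf hok hσ
    obtain ⟨σ₁, e₁, h₁⟩ := iha hd hwf hok hσ
    refine ⟨_, e₁.seq (.load _ _ _), ?_⟩
    have h := evald_setReg h₁.1 hd (σ₁.mem (σ₁.reg d))
    rw [h₁.1.2.1, h₁.2.1] at h ⊢
    exact ⟨h.1, h.2.1, fun r hr => by rw [h.2.2 r hr, h₁.2.2 r hr]⟩
  | add a b iha ihb =>
    intro σ d hd hwf hok hσ
    simp only [Ex.wf, Bool.and_eq_true] at hwf
    have h := exec_binary hd hσ .add (iha hd hwf.1 hok.1 hσ)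
      (fun σ hσ => ihb (by omega) hwf.2 hok.2.1 hσ)
    rwa [BinOp.eval, Nat.mod_eq_of_lt hok.2.2] at h
  | sub a b iha ihb =>
    intro σ d hd hwf hok hσ
    simp only [Ex.wf, Bool.and_eq_true] at hwf
    have h := exec_binary hd hσ .sub (iha hd hwf.1 hok.1 hσ)
      (fun σ hσ => ihb (by omega) hwf.2 hok.2.1 hσ)
    -- The machine computes `a + (2 ^ w - b)` modulo `2 ^ w`; since `b ≤ a < 2 ^ w`, this is `a - b`
    -- after removing one `2 ^ w`.
    have h1 := hok.2.2
    rwa [BinOp.eval, show a.val w s + (2 ^ w - b.val w s) = (a.val w s - b.val w s) + 2 ^ w by omega,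
      Nat.add_mod_right, Nat.mod_eq_of_lt (by omega)] at h
  | mul a b iha ihb =>
    intro σ d hd hwf hok hσ
    simp only [Ex.wf, Bool.and_eq_true] at hwf
    have h := exec_binary hd hσ .mul (iha hd hwf.1 hok.1 hσ)
      (fun σ hσ => ihb (by omega) hwf.2 hok.2.1 hσ)
    rwa [BinOp.eval, Nat.mod_eq_of_lt hok.2.2] at h
  | div a b iha ihb =>
    intro σ d hd hwf hok hσ
    simp only [Ex.wf, Bool.and_eq_true] at hwf
    exact exec_binary hd hσ .div (iha hd hwf.1 hok.1 hσ)
      (fun σ hσ => ihb (by omega) hwf.2 hok.2 hσ)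
  | mod a b iha ihb =>
    intro σ d hd hwf hok hσ
    simp only [Ex.wf, Bool.and_eq_true] at hwf
    exact exec_binary hd hσ .mod (iha hd hwf.1 hok.1 hσ)
      (fun σ hσ => ihb (by omega) hwf.2 hok.2 hσ)
  | raw o a b iha ihb =>
    intro σ d hd hwf hok hσ
    simp only [Ex.wf, Bool.and_eq_true] at hwf
    exact exec_binary hd hσ o (iha hd hwf.1 hok.1 hσ)
      (fun σ hσ => ihb (by omega) hwf.2 hok.2 hσ)

namespace Stm

/-- Well-formed statements use only the registers below `100`. -/
def wf : Stm → Bool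
  | asg x e => x < 100 && e.wf
  | sto a e => a.wf && e.wf
  | flip x => x < 100
  | seq p q => p.wf && q.wf
  | ite a b p q => a.wf && b.wf && p.wf && q.wf
  | whl a b p => a < 100 && b < 100 && p.wf

/-- The compiler. -/
def code : Stm → Program
  | asg x e => .seq (e.code 100) (.copy x 100)
  | sto a e => .seq (.seq (a.code 100) (e.code 101)) (.store 100 101)
  | flip x => .flip x
  | seq p q => .seq p.code q.code
  | ite a b p q => .seq (.seq (a.code 100) (b.code 101)) (.cond (.lt 100 101) p.code q.code)
  | whl a b p => .loop (.lt a b) p.code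

/-- A weakest precondition; loops need an invariant and the number of their iterations. -/
def wp (w : ℕ) : Stm → (St → Prop) → St → Prop
  | asg x e, Q, s => e.Ok w s ∧ Q (s.set x (e.val w s) (e.cost + 1))
  | sto a e, Q, s => a.Ok w s ∧ e.Ok w s ∧ Q (s.put (a.val w s) (e.val w s) (a.cost + e.cost + 1))
  | flip x, Q, s => Q (s.toss x)
  | seq p q, Q, s => p.wp w (q.wp w Q) s
  | ite a b p q, Q, s => a.Ok w s ∧ b.Ok w s ∧
      (a.val w s < b.val w s → p.wp w Q (s.tick (a.cost + b.cost + 1))) ∧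
      (b.val w s ≤ a.val w s → q.wp w Q (s.tick (a.cost + b.cost + 1)))
  | whl a b p, Q, s => ∃ (I : ℕ → St → Prop) (m : ℕ), I 0 s ∧
      (∀ i < m, ∀ s, I i s → s.reg a < s.reg b ∧ p.wp w (I (i + 1)) (s.tick 1)) ∧
      ∀ s, I m s → s.reg b ≤ s.reg a ∧ Q (s.tick 1)

/-- Soundness of `wp`. The abstract clock advances by exactly the number of machine steps, so a
bound on `tm` in the postcondition is a bound on the running time. -/
theorem exec_code {w : ℕ} (p : Stm) : ∀ {Q : St → Prop} {s : St} {σ : State}, p.wf = true →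
    Sim σ s → p.wp w Q s →
    ∃ σ' s' T, Exec w p.code σ σ' T ∧ Sim σ' s' ∧ s'.tm = s.tm + T ∧ Q s' := by
  induction p with
  | asg x e =>
    intro Q s σ hwf hσ h
    simp only [wf, Bool.and_eq_true, decide_eq_true_eq] at hwf
    obtain ⟨σ₁, e₁, h₁⟩ := e.exec_code le_rfl hwf.2 h.1 hσ
    refine ⟨_, _, _, e₁.seq (.copy _ _ _), ?_, rfl, h.2⟩
    refine ⟨fun r hr => ?_, h₁.1.2.1, h₁.1.2.2⟩
    simp only [State.setReg, Function.update, St.set_reg, eq_rec_constant, dite_eq_ite, h₁.2.1]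
    split_ifs
    · rfl
    · exact h₁.1.1 r hr
  | sto a e =>
    intro Q s σ hwf hσ h
    simp only [wf, Bool.and_eq_true] at hwf
    obtain ⟨σ₁, e₁, h₁⟩ := a.exec_code le_rfl hwf.1 h.1 hσ
    obtain ⟨σ₂, e₂, h₂⟩ := e.exec_code (d := 101) (by omega) hwf.2 h.2.1 h₁.1
    refine ⟨_, _, _, (e₁.seq e₂).seq (.store _ _ _), ?_, rfl, h.2.2⟩
    refine ⟨h₂.1.1, ?_, h₂.1.2.2⟩
    funext i
    simp only [State.setMem, Function.update, St.put_mem, eq_rec_constant, dite_eq_ite, h₂.2.1,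
      h₂.2.2 100 (by omega), h₁.2.1, h₂.1.2.1]
  | flip x =>
    intro Q s σ hwf hσ h
    refine ⟨_, _, _, .flip _ _, ?_, rfl, h⟩
    refine ⟨fun r hr => ?_, hσ.2.1, ?_⟩
    · simp only [State.toss, Function.update, eq_rec_constant, dite_eq_ite, St.toss_reg, hσ.2.2,
        hσ.1 r hr]
    · simp only [State.toss, St.toss_coins, hσ.2.2]
  | seq p q ihp ihq =>
    intro Q s σ hwf hσ h
    simp only [wf, Bool.and_eq_true] at hwf
    obtain ⟨σ₁, s₁, T₁, e₁, h₁, t₁, q₁⟩ := ihp hwf.1 hσ h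
    obtain ⟨σ₂, s₂, T₂, e₂, h₂, t₂, q₂⟩ := ihq hwf.2 h₁ q₁
    exact ⟨σ₂, s₂, _, e₁.seq e₂, h₂, by omega, q₂⟩
  | ite a b p q ihp ihq =>
    intro Q s σ hwf hσ h
    simp only [wf, Bool.and_eq_true] at hwf
    obtain ⟨σ₁, e₁, h₁⟩ := a.exec_code le_rfl hwf.1.1.1 h.1 hσ
    obtain ⟨σ₂, e₂, h₂⟩ := b.exec_code (d := 101) (by omega) hwf.1.1.2 h.2.1 h₁.1
    have hs : Sim σ₂ (s.tick (a.cost + b.cost + 1)) := h₂.1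
    have h100 : σ₂.reg 100 = a.val w s := by rw [h₂.2.2 100 (by omega), h₁.2.1]
    by_cases hc : a.val w s < b.val w s
    · obtain ⟨σ₃, s₃, T₃, e₃, h₃, t₃, q₃⟩ := ihp hwf.1.2 hs (h.2.2.1 hc)
      refine ⟨σ₃, s₃, _, (e₁.seq e₂).seq (.cond_true ?_ e₃), h₃, ?_, q₃⟩
      · simpa only [Test.Holds, h100, h₂.2.1] using hc
      · rw [t₃, St.tick_tm]; omega
    · obtain ⟨σ₃, s₃, T₃, e₃, h₃, t₃, q₃⟩ := ihq hwf.2 hs (h.2.2.2 (not_lt.1 hc))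
      refine ⟨σ₃, s₃, _, (e₁.seq e₂).seq (.cond_false ?_ e₃), h₃, ?_, q₃⟩
      · simpa only [Test.Holds, h100, h₂.2.1] using hc
      · rw [t₃, St.tick_tm]; omega
  | whl a b p ih =>
    intro Q s σ hwf hσ h
    simp only [wf, Bool.and_eq_true, decide_eq_true_eq] at hwf
    obtain ⟨I, m, h0, hstep, hend⟩ := h
    -- Total correctness of the loop: the invariant is indexed by the iterations done, and the
    -- induction is on the number `k` of those still to come.
    suffices H : ∀ k i s σ, i + k = m → Sim σ s → I i s →
        ∃ σ' s' T, Exec w (whl a b p).code σ σ' T ∧ Sim σ' s' ∧ s'.tm = s.tm + T ∧ Q s' from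
      H m 0 s σ (zero_add m) hσ h0
    intro k
    induction k with
    | zero =>
      intro i s σ hi hσ hI
      obtain rfl : i = m := by omega
      obtain ⟨h1, h2⟩ := hend s hI
      refine ⟨σ, s.tick 1, 1, .loop_done ?_, hσ, rfl, h2⟩
      simpa only [Test.Holds, hσ.1 a hwf.1.1, hσ.1 b hwf.1.2, not_lt] using h1
    | succ k ihk =>
      intro i s σ hi hσ hI
      obtain ⟨h1, h2⟩ := hstep i (by omega) s hI
      obtain ⟨σ₁, s₁, T₁, e₁, h₁, t₁, q₁⟩ := ih hwf.2 (σ := σ) (s := s.tick 1) hσ h2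
      obtain ⟨σ₂, s₂, T₂, e₂, h₂, t₂, q₂⟩ := ihk (i + 1) s₁ σ₁ (by omega) h₁ q₁
      refine ⟨σ₂, s₂, _, .loop_step ?_ e₁ e₂, h₂, ?_, q₂⟩
      · simpa only [Test.Holds, hσ.1 a hwf.1.1, hσ.1 b hwf.1.2] using h1
      · rw [t₂, t₁, St.tick_tm]; omega

theorem wp_mono {w : ℕ} (p : Stm) : ∀ {Q R : St → Prop} {s : St}, (∀ s, Q s → R s) →
    p.wp w Q s → p.wp w R s := by
  induction p with
  | asg x e => exact fun h hq => ⟨hq.1, h _ hq.2⟩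
  | sto a e => exact fun h hq => ⟨hq.1, hq.2.1, h _ hq.2.2⟩
  | flip x => exact fun h hq => h _ hq
  | seq p q ihp ihq => exact fun h hq => ihp (fun _ => ihq h) hq
  | ite a b p q ihp ihq =>
    exact fun h hq => ⟨hq.1, hq.2.1, fun hc => ihp h (hq.2.2.1 hc), fun hc => ihq h (hq.2.2.2 hc)⟩
  | whl a b p ih =>
    rintro Q R s h ⟨I, m, h0, h1, h2⟩
    exact ⟨I, m, h0, h1, fun s hs => ⟨(h2 s hs).1, h _ (h2 s hs).2⟩⟩

theorem wp_seq {w : ℕ} {p q : Stm} {Q : St → Prop} {s : St} (R : St → Prop) (h : p.wp w R s)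
    (hq : ∀ s, R s → q.wp w Q s) : (p ;; q).wp w Q s :=
  wp_mono p hq h

theorem wp_whl {w a b : ℕ} {p : Stm} {Q : St → Prop} {s : St} (I : ℕ → St → Prop) (m : ℕ)
    (h0 : I 0 s)
    (hstep : ∀ i < m, ∀ s, I i s → s.reg a < s.reg b ∧ p.wp w (I (i + 1)) (s.tick 1))
    (hend : ∀ s, I m s → s.reg b ≤ s.reg a ∧ Q (s.tick 1)) : (whl a b p).wp w Q s :=
  ⟨I, m, h0, hstep, hend⟩

/-- Count register `i` up to the value of register `b`. -/
def upto (i b : ℕ) (p : Stm) : Stm := whl i b (p ;; asg i (.v i +ₑ .c 1))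

/-- The body has to preserve the counter and the bound. The `4` is the cost of the increment: two
operands, the addition, and the copy into the counter. -/
theorem wp_upto {w i b lo hi : ℕ} {p : Stm} {Q : St → Prop} {s : St} (I : ℕ → St → Prop)
    (hi2 : hi < 2 ^ w) (hlo : lo ≤ hi) (hi0 : s.reg i = lo) (hb0 : s.reg b = hi) (h0 : I lo s)
    (hstep : ∀ j s, lo ≤ j → j < hi → s.reg i = j → s.reg b = hi → I j s →
      p.wp w (fun s => s.reg i = j ∧ s.reg b = hi ∧ I (j + 1) (s.set i (j + 1) 4)) (s.tick 1))
    (hib : i ≠ b)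
    (hend : ∀ s, s.reg i = hi → s.reg b = hi → I hi s → Q (s.tick 1)) : (upto i b p).wp w Q s := by
  refine wp_whl (fun k s => s.reg i = lo + k ∧ s.reg b = hi ∧ I (lo + k) s) (hi - lo)
    ⟨hi0, hb0, h0⟩ ?_ ?_
  · rintro k hk s ⟨h1, h2, h3⟩
    refine ⟨by omega, ?_⟩
    refine wp_seq _ (hstep (lo + k) s (by omega) (by omega) h1 h2 h3) ?_
    rintro s ⟨h1, h2, h3⟩
    simp only [wp, Ex.Ok, Ex.val, Ex.cost, St.set_reg, h1, h2, if_true, true_and, if_neg hib.symm]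
    exact ⟨⟨by omega, by omega⟩, by omega, h3⟩
  · rintro s ⟨h1, h2, h3⟩
    rw [show lo + (hi - lo) = hi by omega] at h1 h3
    exact ⟨by omega, hend s h1 h2 h3⟩

end Stm
end WordRAM

/-! ### The Fourier transform in bit-reversed order -/

namespace WordRAM

/-- The angles of the twiddle factors, in bit-reversed order. -/
noncomputable def ang (b : ℕ) : ℝ :=
  if b = 0 then 0 else (ang (b / 2) + Real.pi * (b % 2 : ℕ)) / 2
decreasing_by omega

theorem ang_zero : ang 0 = 0 := by rw [ang]; simp

theorem ang_eq (b : ℕ) : ang b = (ang (b / 2) + Real.pi * (b % 2 : ℕ)) / 2 := by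
  rcases Nat.eq_zero_or_pos b with rfl | h
  · simp [ang_zero]
  · rw [ang, if_neg h.ne']

/-- Bit `j` of the index contributes `π / 2 ^ (j + 1)` to the angle, that is, `ang` reads the binary
digits in reverse: halving the index halves what the remaining bits contribute. -/
theorem ang_add {j : ℕ} : ∀ {b : ℕ}, b < 2 ^ j → ang (2 ^ j + b) = ang b + Real.pi / 2 ^ (j + 1) := by
  induction j with
  | zero =>
    intro b hb
    obtain rfl : b = 0 := by simpa using hb
    rw [ang_eq]
    simp [ang_zero]
  | succ j ih =>
    intro b hb
    have h1 : (2 ^ (j + 1) + b) / 2 = 2 ^ j + b / 2 := by rw [pow_succ]; omega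
    have h2 : (2 ^ (j + 1) + b) % 2 = b % 2 := by rw [pow_succ]; omega
    rw [ang_eq, h1, h2, ih (by rw [pow_succ] at hb; omega), ang_eq b]
    ring

/-- The twiddle factors, in bit-reversed order. -/
noncomputable def tw (b : ℕ) : ℂ := Complex.exp (ang b * Complex.I)

theorem norm_tw (b : ℕ) : ‖tw b‖ = 1 := Complex.norm_exp_ofReal_mul_I _

theorem conj_tw_mul (b : ℕ) : (starRingEnd ℂ) (tw b) * tw b = 1 := by
  rw [Complex.conj_mul', norm_tw]; simp

/-- The points of evaluation, in bit-reversed order. -/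
noncomputable def pt (b : ℕ) : ℂ := if b % 2 = 0 then tw (b / 2) else -tw (b / 2)

theorem tw_sq (b : ℕ) : tw b ^ 2 = pt b := by
  rw [tw, ← Complex.exp_nat_mul, ang_eq, pt, tw]
  rcases Nat.mod_two_eq_zero_or_one b with h | h
  · rw [h, if_pos rfl]; congr 1; push_cast; ring
  · rw [h, if_neg one_ne_zero,
      show ((2 : ℕ) : ℂ) * (((ang (b / 2) + Real.pi * (1 : ℕ)) / 2 : ℝ) * Complex.I) =
        ang (b / 2) * Complex.I + Real.pi * Complex.I by push_cast; ring,
      Complex.exp_add, Complex.exp_pi_mul_I]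
    ring

/-- The points with indices `2 * b` and `2 * b + 1` are the two square roots of `pt b`. Hence `X ^
(2 * m) - pt b` factors into the moduli of the two child blocks. -/
theorem pt_sq (b : ℕ) : pt b ^ 2 = pt (b / 2) := by
  rw [← tw_sq (b / 2), pt]
  split_ifs <;> ring

theorem norm_pt (b : ℕ) : ‖pt b‖ = 1 := by
  rw [pt]; split_ifs <;> simp [norm_tw]

/-- The entry `j` of the transform of `a` at block size `m`: block `b` holds the remainder of the
polynomial with coefficients `a` modulo `X ^ m - pt b`. -/
noncomputable def ft (a : ℕ → ℂ) (N m j : ℕ) : ℂ :=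
  ∑ k ∈ Finset.range (N / m), a (j % m + k * m) * pt (j / m) ^ k

theorem sum_range_two_mul {M : Type*} [AddCommMonoid M] (f : ℕ → M) (n : ℕ) :
    ∑ k ∈ Finset.range (2 * n), f k =
      ∑ k ∈ Finset.range n, f (2 * k) + ∑ k ∈ Finset.range n, f (2 * k + 1) := by
  induction n with
  | zero => simp
  | succ n ih =>
    rw [show 2 * (n + 1) = 2 * n + 1 + 1 by ring, Finset.sum_range_succ, Finset.sum_range_succ, ih,
      Finset.sum_range_succ, Finset.sum_range_succ]
    abel

/-- Reducing a remainder modulo `X ^ (2 * m) - pt b` further modulo `X ^ m - pt c`, for a child `c`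
of `b`, means replacing `X ^ m` by `pt c`. In the sums this is the splitting into even and odd `k`.
-/
theorem ft_split (a : ℕ → ℂ) {m K b c i : ℕ} (hm : 0 < m) (hi : i < m) (hc : c / 2 = b) :
    ft a (2 * m * K) m (m * c + i) =
      ft a (2 * m * K) (2 * m) (2 * m * b + i) +
        pt c * ft a (2 * m * K) (2 * m) (2 * m * b + m + i) := by
  have e1 : (m * c + i) / m = c := by
    rw [Nat.mul_add_div hm, Nat.div_eq_of_lt hi, add_zero]
  have e2 : (m * c + i) % m = i := by rw [Nat.mul_add_mod, Nat.mod_eq_of_lt hi]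
  have e3 : (2 * m * b + i) / (2 * m) = b := by
    rw [Nat.mul_add_div (by omega), Nat.div_eq_of_lt (by omega), add_zero]
  have e4 : (2 * m * b + i) % (2 * m) = i := by rw [Nat.mul_add_mod, Nat.mod_eq_of_lt (by omega)]
  have e5 : (2 * m * b + m + i) / (2 * m) = b := by
    rw [add_assoc, Nat.mul_add_div (by omega), Nat.div_eq_of_lt (by omega), add_zero]
  have e6 : (2 * m * b + m + i) % (2 * m) = m + i := by
    rw [add_assoc, Nat.mul_add_mod, Nat.mod_eq_of_lt (by omega)]
  have e7 : 2 * m * K / m = 2 * K := by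
    rw [show 2 * m * K = m * (2 * K) by ring, Nat.mul_div_cancel_left _ hm]
  have e8 : 2 * m * K / (2 * m) = K := Nat.mul_div_cancel_left _ (by omega)
  have hp : pt b = pt c ^ 2 := by rw [pt_sq, hc]
  simp only [ft, e1, e2, e3, e4, e5, e6, e7, e8, sum_range_two_mul, Finset.mul_sum, hp]
  congr 1
  · refine Finset.sum_congr rfl fun k _ => ?_
    rw [show i + 2 * k * m = i + k * (2 * m) by ring, ← pow_mul]
  · refine Finset.sum_congr rfl fun k _ => ?_
    rw [show i + (2 * k + 1) * m = m + i + k * (2 * m) by ring, ← pow_mul]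
    ring

/-- With `ft_high` this is the butterfly: the two children have `pt c = tw b` and `pt c = -tw b`, so
a single twiddle factor per block serves both. -/
theorem ft_low (a : ℕ → ℂ) {m K b i : ℕ} (hm : 0 < m) (hi : i < m) :
    ft a (2 * m * K) m (2 * m * b + i) =
      ft a (2 * m * K) (2 * m) (2 * m * b + i) +
        tw b * ft a (2 * m * K) (2 * m) (2 * m * b + m + i) := by
  have h := ft_split a (K := K) (b := b) (c := 2 * b) hm hi (by omega)
  rw [pt, if_pos (by omega), show 2 * b / 2 = b by omega,
    show m * (2 * b) + i = 2 * m * b + i by ring] at h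
  exact h

theorem ft_high (a : ℕ → ℂ) {m K b i : ℕ} (hm : 0 < m) (hi : i < m) :
    ft a (2 * m * K) m (2 * m * b + m + i) =
      ft a (2 * m * K) (2 * m) (2 * m * b + i) -
        tw b * ft a (2 * m * K) (2 * m) (2 * m * b + m + i) := by
  have h := ft_split a (K := K) (b := b) (c := 2 * b + 1) hm hi (by omega)
  rw [pt, if_neg (by omega), show (2 * b + 1) / 2 = b by omega,
    show m * (2 * b + 1) + i = 2 * m * b + m + i by ring] at h
  rw [h]; ring

theorem ft_top (a : ℕ → ℂ) {N j : ℕ} (h : j < N) : ft a N N j = a j := by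
  simp [ft, Nat.div_self (by omega : 0 < N), Nat.mod_eq_of_lt h, Nat.div_eq_of_lt h]

theorem ft_one (a : ℕ → ℂ) (N j : ℕ) :
    ft a N 1 j = ∑ k ∈ Finset.range N, a k * pt j ^ k := by
  simp [ft, Nat.mod_one]

/-- An entry uses each coefficient at most once, with a factor of norm one. The bound does not
depend on the stage, so it serves for the error analysis of every stage. -/
theorem norm_ft_le (a : ℕ → ℂ) {N m j : ℕ} (hm : 0 < m) :
    ‖ft a N m j‖ ≤ ∑ k ∈ Finset.range N, ‖a k‖ := by
  calc ‖ft a N m j‖ ≤ ∑ k ∈ Finset.range (N / m), ‖a (j % m + k * m)‖ := by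
        refine (norm_sum_le _ _).trans (Finset.sum_le_sum fun k _ => ?_)
        rw [norm_mul, norm_pow, norm_pt, one_pow, mul_one]
    _ = ∑ i ∈ (Finset.range (N / m)).image (fun k => j % m + k * m), ‖a i‖ := by
        rw [Finset.sum_image]
        intro x _ y _ h
        exact Nat.eq_of_mul_eq_mul_right hm (Nat.add_left_cancel h)
    _ ≤ _ := by
        refine Finset.sum_le_sum_of_subset_of_nonneg ?_ fun _ _ _ => norm_nonneg _
        intro i hi
        simp only [Finset.mem_image, Finset.mem_range] at hi ⊢
        obtain ⟨k, hk, rfl⟩ := hi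
        have h1 : (k + 1) * m ≤ N := (Nat.mul_le_mul_right m hk).trans (Nat.div_mul_le_self N m)
        have h2 := Nat.mod_lt j hm
        rw [add_mul, one_mul] at h1
        omega

/-! ### Products of polynomials under the transform -/

/-- The coefficients of the product of two polynomials. -/
def cauchy {R : Type*} [Semiring R] (a b : ℕ → R) (n : ℕ) : R :=
  ∑ i ∈ Finset.range (n + 1), a i * b (n - i)

/-- Both factors are genuine polynomials, and `h + h' ≤ N` leaves room for the whole product, so
nothing wraps around. Evaluation at the points `pt j` gives `ft_cauchy`; evaluation of the
coefficient norms at `1` gives `sum_norm_cauchy_le`. -/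
theorem sum_cauchy {R : Type*} [CommSemiring R] {a b : ℕ → R} {h h' N : ℕ}
    (ha : ∀ i, h ≤ i → a i = 0) (hb : ∀ i, h' ≤ i → b i = 0) (hN : h + h' ≤ N) (x : R) :
    ∑ k ∈ Finset.range N, cauchy a b k * x ^ k =
      (∑ k ∈ Finset.range N, a k * x ^ k) * ∑ k ∈ Finset.range N, b k * x ^ k := by
  have key : ∀ (f : ℕ → R) (g : ℕ), (∀ i, g ≤ i → f i = 0) → g ≤ N →
      (∑ k ∈ Finset.range N, f k * x ^ k) =
        (∑ k ∈ Finset.range g, Polynomial.C (f k) * Polynomial.X ^ k : Polynomial R).eval x := by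
    intro f g hf hg
    rw [Polynomial.eval_finsetSum]
    simp only [Polynomial.eval_mul, Polynomial.eval_C, Polynomial.eval_pow, Polynomial.eval_X]
    symm
    refine Finset.sum_subset (Finset.range_subset_range.2 hg) fun i _ hi => ?_
    rw [hf i (by simpa using hi), zero_mul]
  have hc : ∀ (f : ℕ → R) (g : ℕ), (∀ i, g ≤ i → f i = 0) → ∀ n,
      (∑ k ∈ Finset.range g, Polynomial.C (f k) * Polynomial.X ^ k : Polynomial R).coeff n
        = f n := by
    intro f g hf n
    simp only [Polynomial.finsetSum_coeff, Polynomial.coeff_C_mul_X_pow]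
    simp only [Finset.sum_ite_eq, Finset.mem_range]
    split_ifs with hn
    · rfl
    · rw [hf n (by omega)]
  rw [key a h ha (by omega), key b h' hb (by omega), ← Polynomial.eval_mul]
  rcases Nat.eq_zero_or_pos N with rfl | hN0
  · obtain rfl : h = 0 := by omega
    simp
  rw [Polynomial.eval_eq_sum_range' (n := N)]
  · refine Finset.sum_congr rfl fun k _ => ?_
    rw [Polynomial.coeff_mul, Finset.Nat.sum_antidiagonal_eq_sum_range_succ_mk]
    simp only [hc a h ha, hc b h' hb, cauchy, Nat.succ_eq_add_one]
  · by_cases hz : (∑ k ∈ Finset.range h, Polynomial.C (a k) * Polynomial.X ^ k : Polynomial R) *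
        (∑ k ∈ Finset.range h', Polynomial.C (b k) * Polynomial.X ^ k : Polynomial R) = 0
    · rw [hz]; simpa using hN0
    · rw [Polynomial.natDegree_lt_iff_degree_lt hz]
      rw [Polynomial.degree_lt_iff_coeff_zero]
      intro m hm
      rw [Polynomial.coeff_mul]
      refine Finset.sum_eq_zero fun p hp => ?_
      have hp := Finset.HasAntidiagonal.mem_antidiagonal.1 hp
      rw [hc a h ha, hc b h' hb]
      rcases le_or_gt h p.1 with h1 | h1
      · rw [ha _ h1, zero_mul]
      · rw [hb _ (by omega), mul_zero]

theorem ft_cauchy {a b : ℕ → ℂ} {h h' N : ℕ} (ha : ∀ i, h ≤ i → a i = 0)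
    (hb : ∀ i, h' ≤ i → b i = 0) (hN : h + h' ≤ N) (j : ℕ) :
    ft (cauchy a b) N 1 j = ft a N 1 j * ft b N 1 j := by
  simp only [ft_one, sum_cauchy ha hb hN]

theorem sum_norm_cauchy_le {a b : ℕ → ℂ} {h h' N : ℕ} (ha : ∀ i, h ≤ i → a i = 0)
    (hb : ∀ i, h' ≤ i → b i = 0) (hN : h + h' ≤ N) :
    ∑ k ∈ Finset.range N, ‖cauchy a b k‖ ≤
      (∑ k ∈ Finset.range N, ‖a k‖) * ∑ k ∈ Finset.range N, ‖b k‖ := by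
  have := sum_cauchy (a := fun i => ‖a i‖) (b := fun i => ‖b i‖) (h := h) (h' := h') (N := N)
    (fun i hi => by simp [ha i hi]) (fun i hi => by simp [hb i hi]) hN 1
  simp only [one_pow, mul_one] at this
  rw [← this]
  refine Finset.sum_le_sum fun k _ => ?_
  refine (norm_sum_le _ _).trans (le_of_eq ?_)
  simp [cauchy]

/-! ### Signed and Gaussian integers in machine words, and fixed point rounding -/

/-- The machine representation of an integer. -/
def rep (w : ℕ) (z : ℤ) : ℕ := (z % 2 ^ w).toNat

theorem cast_rep (w : ℕ) (z : ℤ) : (rep w z : ℤ) = z % 2 ^ w :=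
  Int.toNat_of_nonneg (Int.emod_nonneg _ (by positivity))

theorem rep_lt (w : ℕ) (z : ℤ) : rep w z < 2 ^ w := by
  have := Int.emod_lt_of_pos z (show (0 : ℤ) < 2 ^ w by positivity)
  rw [← cast_rep] at this
  exact_mod_cast this

theorem rep_natCast {w n : ℕ} (h : n < 2 ^ w) : rep w n = n := by
  have : ((rep w n : ℕ) : ℤ) = n := by
    rw [cast_rep, Int.emod_eq_of_lt (by positivity) (by exact_mod_cast h)]
  exact_mod_cast this

theorem eq_rep {w n : ℕ} {z : ℤ} (h : n < 2 ^ w) (hz : (n : ℤ) % 2 ^ w = z % 2 ^ w) :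
    n = rep w z := by
  have : (n : ℤ) = rep w z := by
    rw [cast_rep, ← hz, Int.emod_eq_of_lt (by positivity) (by exact_mod_cast h)]
  exact_mod_cast this

theorem eval_add_rep (w : ℕ) (x y : ℤ) : BinOp.add.eval w (rep w x) (rep w y) = rep w (x + y) := by
  refine eq_rep (Nat.mod_lt _ (by positivity)) ?_
  rw [BinOp.eval]
  push_cast [cast_rep]
  simp [Int.add_emod]

theorem eval_mul_rep (w : ℕ) (x y : ℤ) : BinOp.mul.eval w (rep w x) (rep w y) = rep w (x * y) := by
  refine eq_rep (Nat.mod_lt _ (by positivity)) ?_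
  rw [BinOp.eval]
  push_cast [cast_rep]
  simp [Int.mul_emod]

theorem eval_sub_rep (w : ℕ) (x y : ℤ) : BinOp.sub.eval w (rep w x) (rep w y) = rep w (x - y) := by
  refine eq_rep (Nat.mod_lt _ (by positivity)) ?_
  have h := (rep_lt w y).le
  rw [BinOp.eval]
  push_cast [cast_rep, Nat.cast_sub h]
  rw [Int.emod_emod_of_dvd _ (dvd_refl _),
    show x % 2 ^ w + (2 ^ w - y % 2 ^ w) = x % 2 ^ w - y % 2 ^ w + 2 ^ w by ring, Int.add_emod_right,
    ← Int.sub_emod]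

/-- Division with rounding of a represented integer by `S`. -/
theorem rep_round {w S : ℕ} {x : ℤ} (hS : 0 < S) (hw : 2 * S ^ 3 < 2 ^ w) (hx : |x| < (S : ℤ) ^ 3) :
    BinOp.sub.eval w (BinOp.add.eval w (rep w x) (S ^ 3) / S) (S ^ 2) = rep w (x / S) := by
  have h1 : S ^ 3 = rep w ((S ^ 3 : ℕ) : ℤ) := (rep_natCast (by omega)).symm
  have h2 : S ^ 2 = rep w ((S ^ 2 : ℕ) : ℤ) := by
    refine (rep_natCast ?_).symm
    have : S ^ 2 ≤ S ^ 3 := Nat.pow_le_pow_right hS (by norm_num)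
    omega
  have hb := abs_lt.1 hx
  have e1 : BinOp.add.eval w (rep w x) (S ^ 3) = (x + S ^ 3).toNat := by
    conv_lhs => rw [h1]
    rw [eval_add_rep]
    have hw' : (2 * S ^ 3 : ℤ) < 2 ^ w := by exact_mod_cast hw
    rw [rep, Int.emod_eq_of_lt (by push_cast; linarith) (by push_cast; linarith)]
    push_cast; rfl
  have e2 : (x + S ^ 3).toNat / S = rep w (x / S + S ^ 2) := by
    refine eq_rep ?_ ?_
    · refine lt_of_le_of_lt (Nat.div_le_self _ _) ?_
      have : ((x + S ^ 3).toNat : ℤ) < 2 * S ^ 3 := by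
        rw [Int.toNat_of_nonneg (by linarith)]; linarith
      have : (x + S ^ 3).toNat < 2 * S ^ 3 := by exact_mod_cast this
      omega
    · congr 1
      push_cast
      rw [Int.toNat_of_nonneg (by linarith), show x + (S : ℤ) ^ 3 = x + S ^ 2 * S by ring,
        Int.add_mul_ediv_right _ _ (by positivity)]
  rw [e1, e2]
  conv_lhs => rw [h2]
  rw [eval_sub_rep]
  congr 1
  push_cast; ring

/-- The Gaussian integer with given coordinates. -/
def gi (x y : ℤ) : ℂ := ⟨x, y⟩

theorem gi_mul (a b c d : ℤ) : gi a b * gi c d = gi (a * c - b * d) (a * d + b * c) := by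
  apply Complex.ext <;> simp [gi]

theorem gi_add (a b c d : ℤ) : gi a b + gi c d = gi (a + c) (b + d) := by
  apply Complex.ext <;> simp [gi]

theorem gi_sub (a b c d : ℤ) : gi a b - gi c d = gi (a - c) (b - d) := by
  apply Complex.ext <;> simp [gi]

theorem conj_gi (a b : ℤ) : (starRingEnd ℂ) (gi a b) = gi a (-b) := by
  apply Complex.ext <;> simp [gi]

theorem abs_le_norm_gi (x y : ℤ) : (|x| : ℝ) ≤ ‖gi x y‖ ∧ (|y| : ℝ) ≤ ‖gi x y‖ := by
  exact ⟨by simpa [gi] using Complex.abs_re_le_norm (gi x y),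
    by simpa [gi] using Complex.abs_im_le_norm (gi x y)⟩

theorem norm_round_sub_le (x y : ℤ) {S : ℕ} (hS : 0 < S) :
    ‖gi (x / S) (y / S) - gi x y / S‖ ≤ 2 := by
  have key : ∀ z : ℤ, |((z / S : ℤ) : ℝ) - z / S| ≤ 1 := by
    intro z
    have hS' : (0 : ℝ) < S := by exact_mod_cast hS
    have h1 : ((z / S : ℤ) : ℝ) * S + (z % S : ℤ) = z := by exact_mod_cast Int.ediv_mul_add_emod z S
    have h2 : (0 : ℝ) ≤ (z % S : ℤ) := by exact_mod_cast Int.emod_nonneg z (by omega)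
    have h3 : ((z % S : ℤ) : ℝ) < S := by exact_mod_cast Int.emod_lt_of_pos z (by omega)
    rw [show ((z / S : ℤ) : ℝ) - z / S = -((z % S : ℤ) : ℝ) / S by field_simp; linarith, abs_div,
      abs_neg, abs_of_nonneg h2, abs_of_pos hS', div_le_one hS']
    exact h3.le
  refine (Complex.norm_le_abs_re_add_abs_im _).trans ?_
  have e1 : (gi (x / S) (y / S) - gi x y / S).re = ((x / S : ℤ) : ℝ) - x / S := by simp [gi]
  have e2 : (gi (x / S) (y / S) - gi x y / S).im = ((y / S : ℤ) : ℝ) - y / S := by simp [gi]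
  rw [e1, e2]
  linarith [key x, key y]

/-- The error of a product in fixed point arithmetic. -/
theorem norm_mul_round_le {a b c d : ℤ} {u v : ℂ} {S : ℕ} {α β : ℝ} (hS : 0 < S)
    (hu : ‖gi a b - S * u‖ ≤ α) (hv : ‖gi c d - S * v‖ ≤ β) :
    ‖gi ((a * c - b * d) / S) ((a * d + b * c) / S) - S * (u * v)‖ ≤
      α * (‖v‖ + β / S) + ‖u‖ * β + 2 := by
  have hS' : (0 : ℝ) < S := by exact_mod_cast hS
  have hSc : (S : ℂ) ≠ 0 := by exact_mod_cast hS.ne'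
  have hα : 0 ≤ α := (norm_nonneg _).trans hu
  have h1 := norm_round_sub_le (a * c - b * d) (a * d + b * c) hS
  have h2 : ‖gi c d / S‖ ≤ ‖v‖ + β / S := by
    have : gi c d / S = v + (gi c d - S * v) / S := by field_simp; ring
    rw [this]
    refine (norm_add_le _ _).trans ?_
    rw [norm_div, Complex.norm_natCast]
    gcongr
  -- The error is the rounding error (at most one per coordinate), plus the error of the first
  -- factor times the computed second factor, plus the exact first factor times the error of the
  -- second.
  have e : gi ((a * c - b * d) / S) ((a * d + b * c) / S) - S * (u * v) =
      (gi ((a * c - b * d) / S) ((a * d + b * c) / S) - gi (a * c - b * d) (a * d + b * c) / S) +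
        ((gi a b - S * u) * (gi c d / S) + u * (gi c d - S * v)) := by
    rw [← gi_mul]; field_simp; ring
  rw [e]
  refine (norm_add_le _ _).trans ?_
  refine le_trans (add_le_add h1 (norm_add_le _ _)) ?_
  rw [norm_mul, norm_mul]
  have h3 : ‖gi a b - S * u‖ * ‖gi c d / S‖ ≤ α * (‖v‖ + β / S) := by gcongr
  have h4 : ‖u‖ * ‖gi c d - S * v‖ ≤ ‖u‖ * β := by gcongr
  linarith

end WordRAM

/-! ### Frame conditions, fixed point cells, and the code of the butterflies -/

namespace WordRAM

/-- `s'` agrees with `s` on the registers below `R`, on the memory outside `[lo, hi)`, and on the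
coins. -/
structure Fr (R lo hi : ℕ) (s s' : St) : Prop where
  reg : ∀ r < R, s'.reg r = s.reg r
  mem : ∀ a, a < lo ∨ hi ≤ a → s'.mem a = s.mem a
  coins : s'.coins = s.coins

namespace Fr
variable {R lo hi R' lo' hi' : ℕ} {s s' s'' : St}

theorem refl (s : St) : Fr R lo hi s s := ⟨fun _ _ => rfl, fun _ _ => rfl, rfl⟩

theorem trans (h : Fr R lo hi s s') (h' : Fr R lo hi s' s'') : Fr R lo hi s s'' :=
  ⟨fun r hr => by rw [h'.reg r hr, h.reg r hr], fun a ha => by rw [h'.mem a ha, h.mem a ha],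
    by rw [h'.coins, h.coins]⟩

theorem mono (h : Fr R lo hi s s') (hR : R' ≤ R) (hl : lo' ≤ lo) (hh : hi ≤ hi') :
    Fr R' lo' hi' s s' :=
  ⟨fun r hr => h.reg r (by omega), fun a ha => h.mem a (by omega), h.coins⟩

theorem set (h : Fr R lo hi s s') {x v k : ℕ} (hx : R ≤ x) : Fr R lo hi s (s'.set x v k) :=
  ⟨fun r hr => by rw [St.set_reg, if_neg (by omega), h.reg r hr], h.mem, h.coins⟩

theorem put (h : Fr R lo hi s s') {a v k : ℕ} (hl : lo ≤ a) (hh : a < hi) :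
    Fr R lo hi s (s'.put a v k) :=
  ⟨h.reg, fun i hi => by rw [St.put_mem, if_neg (by omega), h.mem i hi], h.coins⟩

theorem tick (h : Fr R lo hi s s') {k : ℕ} : Fr R lo hi s (s'.tick k) := ⟨h.reg, h.mem, h.coins⟩

end Fr

/-- The cells `a`, `a + 1` hold an approximation of `S * z`, with error at most `E`. -/
def Cell (w S : ℕ) (mem : ℕ → ℕ) (a : ℕ) (z : ℂ) (E : ℝ) : Prop :=
  ∃ x y : ℤ, mem a = rep w x ∧ mem (a + 1) = rep w y ∧ ‖gi x y - S * z‖ ≤ E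

theorem Cell.congr {w S : ℕ} {mem mem' : ℕ → ℕ} {a : ℕ} {z : ℂ} {E : ℝ} (h : Cell w S mem a z E)
    (h0 : mem' a = mem a) (h1 : mem' (a + 1) = mem (a + 1)) : Cell w S mem' a z E := by
  obtain ⟨x, y, hx, hy, hE⟩ := h
  exact ⟨x, y, by rw [h0, hx], by rw [h1, hy], hE⟩

/-- Division with rounding by the unit of fixed point arithmetic, for signed numbers. -/
def rd (e : Ex) : Ex := .raw .sub (.raw .add e (.v 18) /ₑ .v 16) (.v 17)

/-- Load the twiddle factor and the two entries of the butterfly `44`. -/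
def bflyLoad : Stm :=
  .asg 45 (.v 40 +ₑ .c 2 *ₑ (.v 44 +ₑ .v 43 *ₑ (.v 44 /ₑ .v 43))) ;;
  .asg 46 (.v 45 +ₑ .c 2 *ₑ .v 43) ;;
  .asg 55 (.v 8 +ₑ .c 2 *ₑ (.v 44 /ₑ .v 43)) ;;
  .asg 47 (.ld (.v 55)) ;;
  .asg 48 (.ld (.v 55 +ₑ .c 1)) ;;
  .asg 49 (.ld (.v 45)) ;;
  .asg 50 (.ld (.v 45 +ₑ .c 1)) ;;
  .asg 51 (.ld (.v 46)) ;;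
  .asg 52 (.ld (.v 46 +ₑ .c 1))

/-- A butterfly of the forward transform. -/
def bfly : Stm :=
  bflyLoad ;;
  .asg 53 (rd (.raw .sub (.raw .mul (.v 47) (.v 51)) (.raw .mul (.v 48) (.v 52)))) ;;
  .asg 54 (rd (.raw .add (.raw .mul (.v 47) (.v 52)) (.raw .mul (.v 48) (.v 51)))) ;;
  .sto (.v 45) (.raw .add (.v 49) (.v 53)) ;;
  .sto (.v 45 +ₑ .c 1) (.raw .add (.v 50) (.v 54)) ;;
  .sto (.v 46) (.raw .sub (.v 49) (.v 53)) ;;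
  .sto (.v 46 +ₑ .c 1) (.raw .sub (.v 50) (.v 54))

/-- A butterfly of the inverse transform. -/
def ibfly : Stm :=
  bflyLoad ;;
  .sto (.v 45) (.raw .add (.v 49) (.v 51)) ;;
  .sto (.v 45 +ₑ .c 1) (.raw .add (.v 50) (.v 52)) ;;
  .asg 49 (.raw .sub (.v 49) (.v 51)) ;;
  .asg 50 (.raw .sub (.v 50) (.v 52)) ;;
  .sto (.v 46) (rd (.raw .add (.raw .mul (.v 47) (.v 49)) (.raw .mul (.v 48) (.v 50)))) ;;
  .sto (.v 46 +ₑ .c 1) (rd (.raw .sub (.raw .mul (.v 47) (.v 50)) (.raw .mul (.v 48) (.v 49))))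

/-- The index of the lower entry of butterfly `q` at half block size `m`. -/
def lo (m q : ℕ) : ℕ := q + m * (q / m)

/-- The standing assumptions of the transforms: `M` bounds all addresses, `S` is the unit of the
fixed point arithmetic, and a table of twiddle factors with error `τ` is available. -/
structure FFTEnv (w S M half base N : ℕ) (τ : ℝ) (s : St) : Prop where
  hS : 0 < S
  hw : 2 * S ^ 3 < 2 ^ w
  hM : M < 2 ^ w
  r16 : s.reg 16 = S
  r17 : s.reg 17 = S ^ 2
  r18 : s.reg 18 = S ^ 3
  r2 : s.reg 2 = 0
  r40 : s.reg 40 = base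
  r41 : s.reg 41 = N
  r42 : s.reg 42 = half
  hN : N = 2 * half
  baseM : base + 2 * N ≤ M
  tabM : s.reg 8 + 2 * half ≤ M
  disj : s.reg 8 + 2 * half ≤ base ∨ base + 2 * N ≤ s.reg 8
  hτ : τ ≤ S
  tab : ∀ b < half, Cell w S s.mem (s.reg 8 + 2 * b) (tw b) τ

/-- The table of twiddle factors is disjoint from the array, so overwriting the array keeps the
environment intact. -/
theorem FFTEnv.congr {w S M half base N : ℕ} {τ : ℝ} {s s' : St}
    (h : FFTEnv w S M half base N τ s) (h' : Fr 43 base (base + 2 * N) s s') :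
    FFTEnv w S M half base N τ s' := by
  have e : ∀ r < 43, s'.reg r = s.reg r := h'.reg
  have d := h.disj
  refine ⟨h.hS, h.hw, h.hM, ?_, ?_, ?_, ?_, ?_, ?_, ?_, h.hN, h.baseM, ?_, ?_, h.hτ, ?_⟩
  any_goals rw [e _ (by norm_num)]
  · exact h.r16
  · exact h.r17
  · exact h.r18
  · exact h.r2
  · exact h.r40
  · exact h.r41
  · exact h.r42
  · exact h.tabM
  · exact h.disj
  · intro b hb
    exact (h.tab b hb).congr (h'.mem _ (by omega)) (h'.mem _ (by omega))

theorem wp_bflyLoad {w S M half base N m q : ℕ} {τ : ℝ} {s : St} {Q : St → Prop}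
    (he : FFTEnv w S M half base N τ s) (hm : 0 < m) (h43 : s.reg 43 = m) (h44 : s.reg 44 = q)
    (hq : q < half) (hlo : lo m q + m < N)
    (hQ : ∀ s', (∀ r < 45, s'.reg r = s.reg r) → s'.mem = s.mem → s'.coins = s.coins →
      s'.tm ≤ s.tm + 60 → s'.reg 45 = base + 2 * lo m q → s'.reg 46 = base + 2 * (lo m q + m) →
      s'.reg 47 = s.mem (s.reg 8 + 2 * (q / m)) → s'.reg 48 = s.mem (s.reg 8 + 2 * (q / m) + 1) →
      s'.reg 49 = s.mem (base + 2 * lo m q) → s'.reg 50 = s.mem (base + 2 * lo m q + 1) →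
      s'.reg 51 = s.mem (base + 2 * (lo m q + m)) →
      s'.reg 52 = s.mem (base + 2 * (lo m q + m) + 1) → Q s') : bflyLoad.wp w Q s := by
  have h1 := he.baseM
  have h2 := he.tabM
  have h3 := he.hM
  have h4 := he.hN
  have h5 : q / m ≤ q := Nat.div_le_self _ _
  have h6 : lo m q = q + m * (q / m) := rfl
  have e : base + 2 * (lo m q + m) = base + 2 * lo m q + 2 * m := by ring
  simp only [e] at hQ
  rw [h6] at hQ hlo
  simp only [bflyLoad, Stm.wp, Ex.Ok, Ex.val, Ex.cost, St.set_reg, St.set_mem, he.r40,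
    h43, h44, true_and, reduceIte, Nat.reduceEqDiff]
  refine ⟨by omega, by omega, by omega, by omega, by omega, by omega, ?_⟩
  refine hQ _ ?_ rfl rfl ?_ ?_ ?_ ?_ ?_ ?_ ?_ ?_ ?_
  · intro r hr
    simp only [St.set_reg]
    iterate 9 rw [if_neg (by omega)]
  · simp only [St.set_tm]; omega
  all_goals simp

end WordRAM

/-! ### Error analysis of a butterfly -/

namespace WordRAM

theorem norm_gi_le {x y : ℤ} {z : ℂ} {S : ℕ} {E : ℝ} (h : ‖gi x y - S * z‖ ≤ E) :
    ‖gi x y‖ ≤ S * ‖z‖ + E := by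
  have : gi x y = S * z + (gi x y - S * z) := by ring
  rw [this]
  refine (norm_add_le _ _).trans ?_
  rw [norm_mul, Complex.norm_natCast]
  linarith

theorem abs_lt_of_norm_gi {x y : ℤ} {S : ℕ} (h : ‖gi x y‖ < (S : ℝ) ^ 3) :
    |x| < (S : ℤ) ^ 3 ∧ |y| < (S : ℤ) ^ 3 := by
  have h1 := (abs_le_norm_gi x y).1.trans_lt h
  have h2 := (abs_le_norm_gi x y).2.trans_lt h
  exact ⟨by exact_mod_cast h1, by exact_mod_cast h2⟩

/-- The four products may overflow: `rep` is compatible with wrap-around, so only the two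
coordinates of the final product have to be below `S ^ 3` before the division. The condition `hb`
ensures this because the complex norm is multiplicative. -/
theorem rep_mul_round {w S : ℕ} {a b c d : ℤ} {u v : ℂ} {α β : ℝ} (hS : 0 < S)
    (hw : 2 * S ^ 3 < 2 ^ w) (hu : ‖gi a b - S * u‖ ≤ α) (hv : ‖gi c d - S * v‖ ≤ β)
    (hb : (S * ‖u‖ + α) * (S * ‖v‖ + β) < S ^ 3) :
    BinOp.sub.eval w (BinOp.add.eval w (BinOp.sub.eval w (BinOp.mul.eval w (rep w a) (rep w c))
      (BinOp.mul.eval w (rep w b) (rep w d))) (S ^ 3) / S) (S ^ 2) = rep w ((a * c - b * d) / S) ∧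
    BinOp.sub.eval w (BinOp.add.eval w (BinOp.add.eval w (BinOp.mul.eval w (rep w a) (rep w d))
      (BinOp.mul.eval w (rep w b) (rep w c))) (S ^ 3) / S) (S ^ 2) = rep w ((a * d + b * c) / S) ∧
    ‖gi ((a * c - b * d) / S) ((a * d + b * c) / S) - S * (u * v)‖ ≤
      α * (‖v‖ + β / S) + ‖u‖ * β + 2 := by
  have h : ‖gi (a * c - b * d) (a * d + b * c)‖ < (S : ℝ) ^ 3 := by
    rw [← gi_mul, norm_mul]
    refine lt_of_le_of_lt ?_ hb
    exact mul_le_mul (norm_gi_le hu) (norm_gi_le hv) (norm_nonneg _)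
      ((norm_nonneg _).trans (norm_gi_le hu))
  obtain ⟨h1, h2⟩ := abs_lt_of_norm_gi h
  simp only [eval_mul_rep, eval_add_rep, eval_sub_rep]
  exact ⟨rep_round hS hw h1, rep_round hS hw h2, norm_mul_round_le hS hu hv⟩

/-- As `rep_mul_round`, with the first factor conjugated. -/
theorem rep_conj_mul_round {w S : ℕ} {a b c d : ℤ} {u v : ℂ} {α β : ℝ} (hS : 0 < S)
    (hw : 2 * S ^ 3 < 2 ^ w) (hu : ‖gi a b - S * u‖ ≤ α) (hv : ‖gi c d - S * v‖ ≤ β)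
    (hb : (S * ‖u‖ + α) * (S * ‖v‖ + β) < S ^ 3) :
    BinOp.sub.eval w (BinOp.add.eval w (BinOp.add.eval w (BinOp.mul.eval w (rep w a) (rep w c))
      (BinOp.mul.eval w (rep w b) (rep w d))) (S ^ 3) / S) (S ^ 2) = rep w ((a * c + b * d) / S) ∧
    BinOp.sub.eval w (BinOp.add.eval w (BinOp.sub.eval w (BinOp.mul.eval w (rep w a) (rep w d))
      (BinOp.mul.eval w (rep w b) (rep w c))) (S ^ 3) / S) (S ^ 2) = rep w ((a * d - b * c) / S) ∧
    ‖gi ((a * c + b * d) / S) ((a * d - b * c) / S) - S * ((starRingEnd ℂ) u * v)‖ ≤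
      α * (‖v‖ + β / S) + ‖u‖ * β + 2 := by
  have hu' : ‖gi a (-b) - S * (starRingEnd ℂ) u‖ ≤ α := by
    rw [← conj_gi, ← Complex.norm_conj, map_sub, map_mul]
    simpa using hu
  have hb' : (S * ‖(starRingEnd ℂ) u‖ + α) * (S * ‖v‖ + β) < S ^ 3 := by
    rwa [Complex.norm_conj]
  have h := rep_mul_round hS hw hu' hv hb'
  obtain ⟨h1, h2, h3⟩ := h
  rw [Complex.norm_conj, show a * c - -b * d = a * c + b * d by ring,
    show a * d + -b * c = a * d - b * c by ring] at h3
  have h : ‖gi (a * c + b * d) (a * d - b * c)‖ < (S : ℝ) ^ 3 := by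
    rw [show gi (a * c + b * d) (a * d - b * c) = gi a (-b) * gi c d by rw [gi_mul]; ring_nf,
      norm_mul]
    refine lt_of_le_of_lt ?_ hb'
    exact mul_le_mul (norm_gi_le hu') (norm_gi_le hv) (norm_nonneg _)
      ((norm_nonneg _).trans (norm_gi_le hu'))
  obtain ⟨h1, h2⟩ := abs_lt_of_norm_gi h
  simp only [eval_mul_rep, eval_add_rep, eval_sub_rep]
  exact ⟨rep_round hS hw h1, rep_round hS hw h2, h3⟩

/-- The effect of a butterfly on the state. -/
structure Bfly (w S base m q : ℕ) (u v : ℂ) (E : ℝ) (s s' : St) : Prop where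
  reg : ∀ r < 45, s'.reg r = s.reg r
  mem : ∀ a, a ≠ base + 2 * lo m q → a ≠ base + 2 * lo m q + 1 → a ≠ base + 2 * (lo m q + m) →
    a ≠ base + 2 * (lo m q + m) + 1 → s'.mem a = s.mem a
  coins : s'.coins = s.coins
  tm : s'.tm ≤ s.tm + 150
  low : Cell w S s'.mem (base + 2 * lo m q) u E
  high : Cell w S s'.mem (base + 2 * (lo m q + m)) v E

/-- The product with the twiddle factor has error at most `2 * E + τ * V + 2`, and adding or
subtracting it costs another `E`. The bound in `hE` is slightly larger so that the inverse butterfly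
obeys the same recursion. -/
theorem wp_bfly {w S M half base N m q : ℕ} {τ E E' V : ℝ} {s : St} {u v : ℂ}
    (he : FFTEnv w S M half base N τ s) (hm : 0 < m) (h43 : s.reg 43 = m) (h44 : s.reg 44 = q)
    (hq : q < half) (hlo : lo m q + m < N)
    (hu : Cell w S s.mem (base + 2 * lo m q) u E) (hv : Cell w S s.mem (base + 2 * (lo m q + m)) v E)
    (hvV : ‖v‖ ≤ V) (hV : 4 * (S * V + E) < S ^ 2) (hE : 4 * E + 2 * τ * V + 2 ≤ E') :
    bfly.wp w (Bfly w S base m q (u + tw (q / m) * v) (u - tw (q / m) * v) E' s) s := by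
  have hM := he.hM
  have hbM := he.baseM
  have hS := he.hS
  have hS' : (1 : ℝ) ≤ S := by exact_mod_cast hS
  have hτ := he.hτ
  obtain ⟨x1, y1, hx1, hy1, e1⟩ := hu
  obtain ⟨x2, y2, hx2, hy2, e2⟩ := hv
  obtain ⟨a, b, ha, hb, e3⟩ := he.tab (q / m) (lt_of_le_of_lt (Nat.div_le_self _ _) hq)
  have hτ0 : 0 ≤ τ := (norm_nonneg _).trans e3
  have hE0 : 0 ≤ E := (norm_nonneg _).trans e1
  have hV0 : 0 ≤ V := (norm_nonneg _).trans hvV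
  have key := rep_mul_round (w := w) hS he.hw e3 e2 (by
    rw [norm_tw]
    calc (S * 1 + τ) * (S * ‖v‖ + E) ≤ (2 * S) * (S * V + E) := by gcongr; linarith
      _ ≤ S * (4 * (S * V + E)) := by nlinarith [mul_nonneg (by linarith : (0:ℝ) ≤ S) hV0]
      _ < S * S ^ 2 := by gcongr
      _ = S ^ 3 := by ring)
  obtain ⟨k1, k2, k3⟩ := key
  have k4 : τ * (‖v‖ + E / S) + ‖tw (q / m)‖ * E + 2 ≤ 2 * E + τ * V + 2 := by
    rw [norm_tw]
    have h1 : τ * (E / S) ≤ E := by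
      rw [mul_div_assoc', div_le_iff₀ (by linarith)]; nlinarith
    have h2 : τ * ‖v‖ ≤ τ * V := by gcongr
    linarith
  have hτV := mul_nonneg hτ0 hV0
  refine Stm.wp_seq _ (wp_bflyLoad (Q := fun s' => (∀ r < 45, s'.reg r = s.reg r) ∧ s'.mem = s.mem ∧
    s'.coins = s.coins ∧ s'.tm ≤ s.tm + 60 ∧ s'.reg 45 = base + 2 * lo m q ∧
    s'.reg 46 = base + 2 * (lo m q + m) ∧ s'.reg 47 = rep w a ∧ s'.reg 48 = rep w b ∧
    s'.reg 49 = rep w x1 ∧ s'.reg 50 = rep w y1 ∧ s'.reg 51 = rep w x2 ∧ s'.reg 52 = rep w y2)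
    he hm h43 h44 hq hlo ?_) ?_
  · intro s' f1 f2 f3 f4 f5 f6 f7 f8 f9 f10 f11 f12
    exact ⟨f1, f2, f3, f4, f5, f6, f7.trans ha, f8.trans hb, f9.trans hx1, f10.trans hy1,
      f11.trans hx2, f12.trans hy2⟩
  · rintro s' ⟨f1, f2, f3, f4, f5, f6, f7, f8, f9, f10, f11, f12⟩
    have g16 : s'.reg 16 = S := by rw [f1 16 (by norm_num), he.r16]
    have g17 : s'.reg 17 = S ^ 2 := by rw [f1 17 (by norm_num), he.r17]
    have g18 : s'.reg 18 = S ^ 3 := by rw [f1 18 (by norm_num), he.r18]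
    simp only [rd, Stm.wp, Ex.Ok, Ex.val, Ex.cost, St.set_reg, St.put_reg,
      f5, f6, f7, f8, f9, f10, f11, f12, g16, g17, g18, true_and, reduceIte, Nat.reduceEqDiff,
      k1, k2, eval_add_rep, eval_sub_rep]
    refine ⟨⟨by omega, by omega⟩, ⟨by omega, by omega⟩, ?_, ?_, ?_, ?_, ?_, ?_⟩
    · intro r hr
      simp only [St.put_reg, St.set_reg]
      rw [if_neg (by omega), if_neg (by omega), f1 r hr]
    · intro i h1 h2 h3 h4
      simp only [St.put_mem, St.set_mem]
      rw [if_neg h4, if_neg h3, if_neg h2, if_neg h1, f2]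
    · simpa using f3
    · simp only [St.put_tm, St.set_tm]; omega
    · refine ⟨x1 + (a * x2 - b * y2) / S, y1 + (a * y2 + b * x2) / S, ?_, ?_, ?_⟩
      · simp only [St.put_mem, St.set_mem]
        rw [if_neg (by omega), if_neg (by omega), if_neg (by omega), if_pos trivial]
      · simp only [St.put_mem, St.set_mem]
        rw [if_neg (by omega), if_neg (by omega), if_pos trivial]
      · rw [← gi_add, show gi x1 y1 + gi ((a * x2 - b * y2) / S) ((a * y2 + b * x2) / S) -
          S * (u + tw (q / m) * v) = (gi x1 y1 - S * u) +
          (gi ((a * x2 - b * y2) / S) ((a * y2 + b * x2) / S) - S * (tw (q / m) * v)) by ring]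
        refine (norm_add_le _ _).trans ?_
        linarith
    · refine ⟨x1 - (a * x2 - b * y2) / S, y1 - (a * y2 + b * x2) / S, ?_, ?_, ?_⟩
      · simp only [St.put_mem, St.set_mem]
        rw [if_neg (by omega), if_pos trivial]
      · simp only [St.put_mem, St.set_mem]
        rw [if_pos trivial]
      · rw [← gi_sub, show gi x1 y1 - gi ((a * x2 - b * y2) / S) ((a * y2 + b * x2) / S) -
          S * (u - tw (q / m) * v) = (gi x1 y1 - S * u) -
          (gi ((a * x2 - b * y2) / S) ((a * y2 + b * x2) / S) - S * (tw (q / m) * v)) by ring]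
        refine (norm_sub_le _ _).trans ?_
        linarith

/-- This undoes a forward butterfly up to a factor of two, because the conjugate of a twiddle factor
is its inverse. The difference `u - v` has error `2 * E` and norm at most `2 * V` before it is
multiplied, which gives the `4 * E + 2 * τ * V + 2`. -/
theorem wp_ibfly {w S M half base N m q : ℕ} {τ E E' V : ℝ} {s : St} {u v : ℂ}
    (he : FFTEnv w S M half base N τ s) (hm : 0 < m) (h43 : s.reg 43 = m) (h44 : s.reg 44 = q)
    (hq : q < half) (hlo : lo m q + m < N)
    (hu : Cell w S s.mem (base + 2 * lo m q) u E) (hv : Cell w S s.mem (base + 2 * (lo m q + m)) v E)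
    (huV : ‖u‖ ≤ V) (hvV : ‖v‖ ≤ V) (hV : 4 * (S * V + E) < S ^ 2)
    (hE : 4 * E + 2 * τ * V + 2 ≤ E') :
    ibfly.wp w (Bfly w S base m q (u + v) ((starRingEnd ℂ) (tw (q / m)) * (u - v)) E' s) s := by
  have hM := he.hM
  have hbM := he.baseM
  have hS := he.hS
  have hS' : (1 : ℝ) ≤ S := by exact_mod_cast hS
  have hτ := he.hτ
  obtain ⟨x1, y1, hx1, hy1, e1⟩ := hu
  obtain ⟨x2, y2, hx2, hy2, e2⟩ := hv
  obtain ⟨a, b, ha, hb, e3⟩ := he.tab (q / m) (lt_of_le_of_lt (Nat.div_le_self _ _) hq)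
  have hτ0 : 0 ≤ τ := (norm_nonneg _).trans e3
  have hE0 : 0 ≤ E := (norm_nonneg _).trans e1
  have hV0 : 0 ≤ V := (norm_nonneg _).trans hvV
  have e4 : ‖gi (x1 - x2) (y1 - y2) - S * (u - v)‖ ≤ 2 * E := by
    rw [← gi_sub, show gi x1 y1 - gi x2 y2 - S * (u - v) =
      (gi x1 y1 - S * u) - (gi x2 y2 - S * v) by ring]
    refine (norm_sub_le _ _).trans ?_
    linarith
  have huv : ‖u - v‖ ≤ 2 * V := (norm_sub_le _ _).trans (by linarith)
  have key := rep_conj_mul_round (w := w) hS he.hw e3 e4 (by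
    rw [norm_tw]
    calc (S * 1 + τ) * (S * ‖u - v‖ + 2 * E) ≤ (2 * S) * (S * (2 * V) + 2 * E) := by
          gcongr; linarith
      _ = S * (4 * (S * V + E)) := by ring
      _ < S * S ^ 2 := by gcongr
      _ = S ^ 3 := by ring)
  obtain ⟨k1, k2, k3⟩ := key
  have k4 : τ * (‖u - v‖ + 2 * E / S) + ‖tw (q / m)‖ * (2 * E) + 2 ≤ 4 * E + 2 * τ * V + 2 := by
    rw [norm_tw]
    have h1 : τ * (2 * E / S) ≤ 2 * E := by
      rw [mul_div_assoc', div_le_iff₀ (by linarith)]; nlinarith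
    have h2 : τ * ‖u - v‖ ≤ τ * (2 * V) := by gcongr
    linarith
  have hτV := mul_nonneg hτ0 hV0
  refine Stm.wp_seq _ (wp_bflyLoad (Q := fun s' => (∀ r < 45, s'.reg r = s.reg r) ∧ s'.mem = s.mem ∧
    s'.coins = s.coins ∧ s'.tm ≤ s.tm + 60 ∧ s'.reg 45 = base + 2 * lo m q ∧
    s'.reg 46 = base + 2 * (lo m q + m) ∧ s'.reg 47 = rep w a ∧ s'.reg 48 = rep w b ∧
    s'.reg 49 = rep w x1 ∧ s'.reg 50 = rep w y1 ∧ s'.reg 51 = rep w x2 ∧ s'.reg 52 = rep w y2)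
    he hm h43 h44 hq hlo ?_) ?_
  · intro s' f1 f2 f3 f4 f5 f6 f7 f8 f9 f10 f11 f12
    exact ⟨f1, f2, f3, f4, f5, f6, f7.trans ha, f8.trans hb, f9.trans hx1, f10.trans hy1,
      f11.trans hx2, f12.trans hy2⟩
  · rintro s' ⟨f1, f2, f3, f4, f5, f6, f7, f8, f9, f10, f11, f12⟩
    have g16 : s'.reg 16 = S := by rw [f1 16 (by norm_num), he.r16]
    have g17 : s'.reg 17 = S ^ 2 := by rw [f1 17 (by norm_num), he.r17]
    have g18 : s'.reg 18 = S ^ 3 := by rw [f1 18 (by norm_num), he.r18]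
    simp only [rd, Stm.wp, Ex.Ok, Ex.val, Ex.cost, St.set_reg, St.put_reg,
      f5, f6, f7, f8, f9, f10, f11, f12, g16, g17, g18, true_and, reduceIte, Nat.reduceEqDiff,
      eval_sub_rep w x1 x2, eval_sub_rep w y1 y2, k1, k2, eval_add_rep w x1 x2,
      eval_add_rep w y1 y2]
    refine ⟨⟨by omega, by omega⟩, ⟨by omega, by omega⟩, ?_, ?_, ?_, ?_, ?_, ?_⟩
    · intro r hr
      simp only [St.put_reg, St.set_reg]
      rw [if_neg (by omega), if_neg (by omega), f1 r hr]
    · intro i h1 h2 h3 h4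
      simp only [St.put_mem, St.set_mem]
      rw [if_neg h4, if_neg h3, if_neg h2, if_neg h1, f2]
    · simpa using f3
    · simp only [St.put_tm, St.set_tm]; omega
    · refine ⟨x1 + x2, y1 + y2, ?_, ?_, ?_⟩
      · simp only [St.put_mem, St.set_mem]
        rw [if_neg (by omega), if_neg (by omega), if_neg (by omega), if_pos trivial]
      · simp only [St.put_mem, St.set_mem]
        rw [if_neg (by omega), if_neg (by omega), if_pos trivial]
      · rw [← gi_add, show gi x1 y1 + gi x2 y2 - S * (u + v) = (gi x1 y1 - S * u) +
          (gi x2 y2 - S * v) by ring]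
        refine (norm_add_le _ _).trans ?_
        linarith
    · refine ⟨(a * (x1 - x2) + b * (y1 - y2)) / S, (a * (y1 - y2) - b * (x1 - x2)) / S, ?_, ?_, ?_⟩
      · simp only [St.put_mem, St.set_mem]
        rw [if_neg (by omega), if_pos trivial]
      · simp only [St.put_mem, St.set_mem]
        rw [if_pos trivial]
      · exact k3.trans (k4.trans hE)

end WordRAM

/-! ### Stages, and the forward and inverse transforms -/

namespace WordRAM

theorem lo_eq (m q : ℕ) : lo m q = 2 * m * (q / m) + q % m := by
  have := Nat.div_add_mod q m
  rw [lo]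
  linarith

/-- Together with `lo_ne` and `exists_lo`: the pairs `lo m q`, `lo m q + m` partition the array, so
the butterflies of a stage do not interfere and can work in place. -/
theorem lo_injective {m q q' : ℕ} (h : lo m q = lo m q') : q = q' := by
  rw [lo, lo] at h
  rcases lt_trichotomy q q' with h1 | h1 | h1
  · have := Nat.mul_le_mul_left m (Nat.div_le_div_right (c := m) h1.le); omega
  · exact h1
  · have := Nat.mul_le_mul_left m (Nat.div_le_div_right (c := m) h1.le); omega

theorem lo_ne {m q q' : ℕ} (hm : 0 < m) : lo m q ≠ lo m q' + m := by
  rw [lo_eq, lo_eq]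
  intro h
  have h1 : (2 * m * (q / m) + q % m) / m = (2 * m * (q' / m) + q' % m + m) / m := by rw [h]
  rw [show 2 * m * (q / m) + q % m = m * (2 * (q / m)) + q % m by ring,
    show 2 * m * (q' / m) + q' % m + m = m * (2 * (q' / m) + 1) + q' % m by ring,
    Nat.mul_add_div hm, Nat.mul_add_div hm, Nat.div_eq_of_lt (Nat.mod_lt _ hm),
    Nat.div_eq_of_lt (Nat.mod_lt _ hm)] at h1
  omega

theorem lo_add_lt {m q K : ℕ} (hm : 0 < m) (hq : q < m * K) : lo m q + m < 2 * (m * K) := by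
  have h1 : q / m < K := Nat.div_lt_of_lt_mul hq
  have h2 := Nat.mod_lt q hm
  have h3 := Nat.mul_le_mul_left (2 * m) (Nat.succ_le_of_lt h1)
  rw [lo_eq]
  rw [Nat.succ_eq_add_one, mul_add] at h3
  nlinarith

theorem exists_lo {m j K : ℕ} (hm : 0 < m) (hj : j < 2 * (m * K)) :
    ∃ q < m * K, j = lo m q ∨ j = lo m q + m := by
  have h0 := Nat.div_add_mod j (2 * m)
  have h1 : j / (2 * m) < K := Nat.div_lt_of_lt_mul (by linarith)
  have h2 : j % (2 * m) < 2 * m := Nat.mod_lt j (by omega)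
  set b := j / (2 * m)
  have h3 := Nat.mul_le_mul_left m (Nat.succ_le_of_lt h1)
  rw [Nat.succ_eq_add_one, mul_add, mul_one] at h3
  rcases lt_or_ge (j % (2 * m)) m with h | h
  · refine ⟨m * b + j % (2 * m), by omega, Or.inl ?_⟩
    rw [lo_eq, Nat.mul_add_div hm, Nat.mul_add_mod, Nat.div_eq_of_lt h, Nat.mod_eq_of_lt h, add_zero]
    exact h0.symm
  · refine ⟨m * b + (j % (2 * m) - m), by omega, Or.inr ?_⟩
    have h' : j % (2 * m) - m < m := by omega
    rw [lo_eq, Nat.mul_add_div hm, Nat.mul_add_mod, Nat.div_eq_of_lt h', Nat.mod_eq_of_lt h',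
      add_zero]
    omega

/-- All butterflies of a stage. -/
def stage (body : Stm) : Stm := .asg 44 (.c 0) ;; .upto 44 42 body

/-- While butterfly `k` is due, the pairs below `k` hold the new values and the others still the old
ones; each butterfly sees only old values because the pairs are disjoint. -/
theorem wp_stage {w S M half base N m K : ℕ} {τ E E' : ℝ} {s : St} {body : Stm} {z z' : ℕ → ℂ}
    (he : FFTEnv w S M half base N τ s) (hm : 0 < m) (hK : half = m * K) (h43 : s.reg 43 = m)
    (hz : ∀ j < N, Cell w S s.mem (base + 2 * j) (z j) E)
    (hbody : ∀ q < half, ∀ s', FFTEnv w S M half base N τ s' → s'.reg 43 = m → s'.reg 44 = q →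
      Cell w S s'.mem (base + 2 * lo m q) (z (lo m q)) E →
      Cell w S s'.mem (base + 2 * (lo m q + m)) (z (lo m q + m)) E →
      body.wp w (Bfly w S base m q (z' (lo m q)) (z' (lo m q + m)) E' s') s') :
    (stage body).wp w (fun s' => Fr 44 base (base + 2 * N) s s' ∧
      s'.tm ≤ s.tm + half * 160 + 10 ∧
      ∀ j < N, Cell w S s'.mem (base + 2 * j) (z' j) E') s := by
  have hM := he.hM
  have hbM := he.baseM
  have hNh := he.hN
  have hhi : ∀ q < half, lo m q + m < N := by
    intro q hq; rw [hNh, hK]; exact lo_add_lt hm (hK ▸ hq)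
  simp only [stage, Stm.wp, Ex.Ok, Ex.val, Ex.cost]
  refine ⟨by positivity, ?_⟩
  refine Stm.wp_upto (lo := 0) (hi := half) (fun k s' => Fr 44 base (base + 2 * N) s s' ∧
      s'.tm ≤ s.tm + k * 160 + 5 ∧ ∀ q < half,
        (q < k → Cell w S s'.mem (base + 2 * lo m q) (z' (lo m q)) E' ∧
          Cell w S s'.mem (base + 2 * (lo m q + m)) (z' (lo m q + m)) E') ∧
        (k ≤ q → Cell w S s'.mem (base + 2 * lo m q) (z (lo m q)) E ∧
          Cell w S s'.mem (base + 2 * (lo m q + m)) (z (lo m q + m)) E))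
    (by omega) (Nat.zero_le _) (by simp) (by simp [he.r42]) ?_ ?_ (by norm_num) ?_
  · refine ⟨(Fr.refl s).set le_rfl, by simp, fun q hq => ⟨fun h => absurd h (by omega), fun _ => ?_⟩⟩
    have := hhi q hq
    exact ⟨hz _ (by omega), hz _ (by omega)⟩
  · rintro j s1 - hj h44 h42 ⟨hf, ht, hc⟩
    have hp := (hc j hj).2 le_rfl
    refine Stm.wp_mono _ ?_ (hbody j hj (s1.tick 1) ?_ ?_ h44 hp.1 hp.2)
    · rintro s2 ⟨b1, b2, b3, b4, b5, b6⟩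
      have hfr : Fr 44 base (base + 2 * N) (s1.tick 1) s2 := by
        have := hhi j hj
        exact ⟨fun r hr => b1 r (by omega), fun a ha => b2 a (by omega) (by omega) (by omega)
          (by omega), b3⟩
      refine ⟨by rw [b1 44 (by norm_num)]; exact h44, by rw [b1 42 (by norm_num)]; exact h42,
        (hf.tick.trans hfr).set le_rfl, ?_, ?_⟩
      · simp only [St.set_tm]; simp only [St.tick_tm] at b4; omega
      · intro q hq
        have hne : q ≠ j → ∀ {u : ℂ} {e : ℝ},
            (Cell w S s1.mem (base + 2 * lo m q) u e →
              Cell w S s2.mem (base + 2 * lo m q) u e) ∧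
            (Cell w S s1.mem (base + 2 * (lo m q + m)) u e →
              Cell w S s2.mem (base + 2 * (lo m q + m)) u e) := by
          intro h u e
          have n1 : lo m q ≠ lo m j := fun h' => h (lo_injective h')
          have n2 := lo_ne (q := q) (q' := j) hm
          have n3 := lo_ne (q := j) (q' := q) hm
          exact ⟨fun hh => hh.congr (b2 _ (by omega) (by omega) (by omega) (by omega))
            (b2 _ (by omega) (by omega) (by omega) (by omega)),
            fun hh => hh.congr (b2 _ (by omega) (by omega) (by omega) (by omega))
            (b2 _ (by omega) (by omega) (by omega) (by omega))⟩
        refine ⟨fun h => ?_, fun h => ?_⟩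
        · rcases eq_or_ne q j with rfl | hqj
          · exact ⟨b5, b6⟩
          · have := (hc q hq).1 (by omega)
            exact ⟨(hne hqj).1 this.1, (hne hqj).2 this.2⟩
        · have := (hc q hq).2 (by omega)
          exact ⟨(hne (by omega)).1 this.1, (hne (by omega)).2 this.2⟩
    · exact he.congr (hf.tick.mono (by norm_num) le_rfl le_rfl)
    · simp only [St.tick_reg]; rw [hf.reg 43 (by norm_num), h43]
  · rintro s1 - - ⟨hf, ht, hc⟩
    refine ⟨hf.tick, by simp only [St.tick_tm]; omega, fun j hj => ?_⟩
    obtain ⟨q, hq, rfl | rfl⟩ := exists_lo hm (K := K) (j := j) (by rw [← hK, ← hNh]; exact hj)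
    · exact ((hc q (hK ▸ hq)).1 (hK ▸ hq)).1
    · exact ((hc q (hK ▸ hq)).1 (hK ▸ hq)).2

/-- The forward transform of the array at `40` of length `41`. -/
def fft : Stm := .asg 43 (.v 42) ;; .whl 2 43 (stage bfly ;; .asg 43 (.v 43 /ₑ .c 2))

/-- The inverse transform. -/
def ifft : Stm := .asg 43 (.c 1) ;; .whl 43 41 (stage ibfly ;; .asg 43 (.v 43 *ₑ .c 2))

/-- With `F = 2 * τ * V + 2` a stage turns an error `E` into at most `4 * E + F`, so `8 ^ i * (E +
F)` bounds the error after `i` stages. -/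
theorem wp_fft {w S M base L : ℕ} {τ E V : ℝ} {s : St} {a : ℕ → ℂ}
    (he : FFTEnv w S M (2 ^ L) base (2 ^ (L + 1)) τ s)
    (hτ0 : 0 ≤ τ) (hE0 : 0 ≤ E)
    (ha : ∀ j < 2 ^ (L + 1), Cell w S s.mem (base + 2 * j) (a j) E)
    (hV : ∑ k ∈ Finset.range (2 ^ (L + 1)), ‖a k‖ ≤ V)
    (hS : 4 * (S * V + 8 ^ (L + 1) * (E + (2 * τ * V + 2))) < S ^ 2) :
    fft.wp w (fun s' => Fr 43 base (base + 2 * 2 ^ (L + 1)) s s' ∧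
      s'.tm ≤ s.tm + (L + 1) * (2 ^ L * 160 + 20) + 10 ∧
      ∀ j < 2 ^ (L + 1), Cell w S s'.mem (base + 2 * j) (ft a (2 ^ (L + 1)) 1 j)
        (8 ^ (L + 1) * (E + (2 * τ * V + 2)))) s := by
  have hV0 : 0 ≤ V := (Finset.sum_nonneg fun _ _ => norm_nonneg _).trans hV
  have hF : 0 ≤ 2 * τ * V + 2 := by positivity
  set F := 2 * τ * V + 2
  simp only [fft, Stm.wp, Ex.Ok, Ex.val, Ex.cost, true_and]
  have hw2 : 2 < 2 ^ w := lt_of_le_of_lt (by have := he.hS; nlinarith [pow_pos he.hS 3]) he.hw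
  -- Register `43` holds half of the current block size. After stage `L + 1` it is `1 / 2 = 0`, and
  -- this ends the loop.
  refine ⟨fun i s' => Fr 43 base (base + 2 * 2 ^ (L + 1)) s s' ∧
      s'.reg 43 = 2 ^ (L + 1) / 2 ^ (i + 1) ∧ s'.tm ≤ s.tm + i * (2 ^ L * 160 + 20) + 5 ∧
      ∀ j < 2 ^ (L + 1), Cell w S s'.mem (base + 2 * j) (ft a (2 ^ (L + 1)) (2 ^ (L + 1) / 2 ^ i) j)
        (8 ^ i * (E + F)), L + 1, ⟨(Fr.refl s).set le_rfl, ?_, by simp, ?_⟩, ?_, ?_⟩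
  · simp [he.r42, pow_succ]
  · intro j hj
    rw [pow_zero, Nat.div_one, ft_top a hj]
    obtain ⟨x, y, h1, h2, h3⟩ := ha j hj
    exact ⟨x, y, h1, h2, by linarith⟩
  · rintro i hi s1 ⟨hf, h43, ht, hc⟩
    have he1 := he.congr hf
    have hm : 2 ^ (L + 1) / 2 ^ (i + 1) = 2 ^ (L - i) := by
      rw [Nat.pow_div (by omega) (by norm_num)]; congr 1; omega
    have hm2 : 2 ^ (L + 1) / 2 ^ i = 2 * 2 ^ (L - i) := by
      rw [Nat.pow_div (by omega) (by norm_num), ← pow_succ']; congr 1; omega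
    have hmpos : 0 < 2 ^ (L - i) := by positivity
    have hK : 2 ^ L = 2 ^ (L - i) * 2 ^ i := by rw [← pow_add]; congr 1; omega
    have hN : 2 ^ (L + 1) = 2 * 2 ^ (L - i) * 2 ^ i := by rw [mul_assoc, ← hK, pow_succ']
    rw [hm] at h43
    rw [hm2] at hc
    refine ⟨by rw [he1.r2, h43]; exact hmpos, ?_⟩
    refine Stm.wp_mono _ ?_ (wp_stage (s := s1.tick 1) (z := ft a (2 ^ (L + 1)) (2 * 2 ^ (L - i)))
      (z' := ft a (2 ^ (L + 1)) (2 ^ (L - i))) (E := 8 ^ i * (E + F)) (E' := 8 ^ (i + 1) * (E + F))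
      (m := 2 ^ (L - i)) (K := 2 ^ i) (he1.congr ((Fr.refl _).tick)) hmpos hK h43 hc ?_)
    · rintro s2 ⟨g1, g2, g3⟩
      refine ⟨hw2, (hf.trans ?_).set le_rfl, ?_, ?_, ?_⟩
      · exact (Fr.refl s1).tick.trans (g1.mono (by norm_num) le_rfl le_rfl)
      · simp only [St.set_reg, if_true]
        rw [g1.reg 43 (by norm_num), St.tick_reg, h43, ← hm, Nat.div_div_eq_div_mul, ← pow_succ]
      · simp only [St.set_tm]; simp only [St.tick_tm] at g2
        have : (i + 1) * (2 ^ L * 160 + 20) = i * (2 ^ L * 160 + 20) + (2 ^ L * 160 + 20) := by ring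
        omega
      · rw [hm]; exact g3
    · intro q hq s2 he2 h43' h44 cu cv
      have hlo : lo (2 ^ (L - i)) q + 2 ^ (L - i) < 2 ^ (L + 1) := by
        rw [pow_succ', hK]; exact lo_add_lt hmpos (hK ▸ hq)
      have hb := wp_bfly (E' := 8 ^ (i + 1) * (E + F)) (V := V) he2 hmpos h43' h44 hq hlo cu cv
        ((norm_ft_le a (by positivity)).trans hV) ?_ ?_
      · have e1 := ft_low a (m := 2 ^ (L - i)) (K := 2 ^ i) (b := q / 2 ^ (L - i)) hmpos
          (Nat.mod_lt q hmpos)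
        have e2 := ft_high a (m := 2 ^ (L - i)) (K := 2 ^ i) (b := q / 2 ^ (L - i)) hmpos
          (Nat.mod_lt q hmpos)
        have e3 : 2 * 2 ^ (L - i) * (q / 2 ^ (L - i)) + 2 ^ (L - i) + q % 2 ^ (L - i) =
          lo (2 ^ (L - i)) q + 2 ^ (L - i) := by rw [lo_eq]; ring
        rw [e3, ← lo_eq, ← hN] at e1 e2
        rw [e1, e2]
        exact hb
      · refine lt_of_le_of_lt ?_ hS
        have : (8 : ℝ) ^ i ≤ 8 ^ (L + 1) := pow_le_pow_right₀ (by norm_num) (by omega)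
        gcongr
      · rw [pow_succ]
        have : (1 : ℝ) ≤ 8 ^ i := one_le_pow₀ (by norm_num)
        nlinarith
  · rintro s1 ⟨hf, h43, ht, hc⟩
    refine ⟨?_, hf.tick, by simp only [St.tick_tm]; omega, ?_⟩
    · rw [h43, hf.reg 2 (by norm_num), he.r2, Nat.div_eq_of_lt (Nat.pow_lt_pow_right (by norm_num)
        (by omega))]
    · rw [Nat.div_self (by positivity)] at hc
      exact hc

/-- The stages are undone without halving, so after `i` of them the entries carry a factor `2 ^ i`.
The final factor `2 ^ (L + 1)` is kept and divided out only when the result is rounded; this is why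
`V` contains it. -/
theorem wp_ifft {w S M base L : ℕ} {τ E V : ℝ} {s : St} {a : ℕ → ℂ}
    (he : FFTEnv w S M (2 ^ L) base (2 ^ (L + 1)) τ s)
    (hτ0 : 0 ≤ τ) (hE0 : 0 ≤ E)
    (ha : ∀ j < 2 ^ (L + 1), Cell w S s.mem (base + 2 * j) (ft a (2 ^ (L + 1)) 1 j) E)
    (hV : 2 ^ (L + 1) * ∑ k ∈ Finset.range (2 ^ (L + 1)), ‖a k‖ ≤ V)
    (hS : 4 * (S * V + 8 ^ (L + 1) * (E + (2 * τ * V + 2))) < S ^ 2) :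
    ifft.wp w (fun s' => Fr 43 base (base + 2 * 2 ^ (L + 1)) s s' ∧
      s'.tm ≤ s.tm + (L + 1) * (2 ^ L * 160 + 20) + 10 ∧
      ∀ j < 2 ^ (L + 1), Cell w S s'.mem (base + 2 * j) (2 ^ (L + 1) * a j)
        (8 ^ (L + 1) * (E + (2 * τ * V + 2)))) s := by
  have hV0 : 0 ≤ V := le_trans (by positivity) hV
  have hF : 0 ≤ 2 * τ * V + 2 := by positivity
  set F := 2 * τ * V + 2
  have hw2 : 2 < 2 ^ w := lt_of_le_of_lt (by have := he.hS; nlinarith [pow_pos he.hS 3]) he.hw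
  simp only [ifft, Stm.wp, Ex.Ok, Ex.val, Ex.cost, true_and]
  have hnorm : ∀ i ≤ L + 1, ∀ j, ‖(2 : ℂ) ^ i * ft a (2 ^ (L + 1)) (2 ^ i) j‖ ≤ V := by
    intro i hi j
    rw [norm_mul, norm_pow, Complex.norm_two]
    refine le_trans ?_ hV
    have : (2 : ℝ) ^ i ≤ 2 ^ (L + 1) := pow_le_pow_right₀ (by norm_num) hi
    have := norm_ft_le a (N := 2 ^ (L + 1)) (m := 2 ^ i) (j := j) (by positivity)
    gcongr
  refine ⟨by omega, fun i s' => Fr 43 base (base + 2 * 2 ^ (L + 1)) s s' ∧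
      s'.reg 43 = 2 ^ i ∧ s'.tm ≤ s.tm + i * (2 ^ L * 160 + 20) + 5 ∧
      ∀ j < 2 ^ (L + 1), Cell w S s'.mem (base + 2 * j) (2 ^ i * ft a (2 ^ (L + 1)) (2 ^ i) j)
        (8 ^ i * (E + F)), L + 1, ⟨(Fr.refl s).set le_rfl, by simp, by simp, ?_⟩, ?_, ?_⟩
  · intro j hj
    obtain ⟨x, y, h1, h2, h3⟩ := ha j hj
    refine ⟨x, y, h1, h2, ?_⟩
    simp only [pow_zero, one_mul]
    linarith
  · rintro i hi s1 ⟨hf, h43, ht, hc⟩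
    have he1 := he.congr hf
    have hmpos : 0 < 2 ^ i := by positivity
    have hK : 2 ^ L = 2 ^ i * 2 ^ (L - i) := by rw [← pow_add]; congr 1; omega
    have hN : 2 ^ (L + 1) = 2 * 2 ^ i * 2 ^ (L - i) := by rw [mul_assoc, ← hK, pow_succ']
    have hlt : 2 ^ i < 2 ^ (L + 1) := Nat.pow_lt_pow_right (by norm_num) hi
    refine ⟨by rw [he1.r41, h43]; exact hlt, ?_⟩
    refine Stm.wp_mono _ ?_ (wp_stage (s := s1.tick 1)
      (z := fun j => 2 ^ i * ft a (2 ^ (L + 1)) (2 ^ i) j)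
      (z' := fun j => 2 ^ (i + 1) * ft a (2 ^ (L + 1)) (2 ^ (i + 1)) j)
      (E := 8 ^ i * (E + F)) (E' := 8 ^ (i + 1) * (E + F))
      (m := 2 ^ i) (K := 2 ^ (L - i)) (he1.congr ((Fr.refl _).tick)) hmpos hK h43 hc ?_)
    · rintro s2 ⟨g1, g2, g3⟩
      have g43 : s2.reg 43 = 2 ^ i := by rw [g1.reg 43 (by norm_num), St.tick_reg, h43]
      refine ⟨⟨hw2, ?_⟩, (hf.trans ?_).set le_rfl, ?_, ?_, ?_⟩
      · rw [g43, ← pow_succ]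
        have h1 := he.hM
        have h2 := he.baseM
        have h3 : 2 ^ (i + 1) ≤ 2 ^ (L + 1) := Nat.pow_le_pow_right (by norm_num) (by omega)
        omega
      · exact (Fr.refl s1).tick.trans (g1.mono (by norm_num) le_rfl le_rfl)
      · simp only [St.set_reg, if_true]
        rw [g43, ← pow_succ]
      · simp only [St.set_tm]; simp only [St.tick_tm] at g2
        have : (i + 1) * (2 ^ L * 160 + 20) = i * (2 ^ L * 160 + 20) + (2 ^ L * 160 + 20) := by ring
        omega
      · exact g3
    · intro q hq s2 he2 h43' h44 cu cv
      have hlo : lo (2 ^ i) q + 2 ^ i < 2 ^ (L + 1) := by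
        rw [pow_succ', hK]; exact lo_add_lt hmpos (hK ▸ hq)
      have hb := wp_ibfly (E' := 8 ^ (i + 1) * (E + F)) (V := V) he2 hmpos h43' h44 hq hlo cu cv
        (hnorm i hi.le _) (hnorm i hi.le _) ?_ ?_
      · have e1 := ft_low a (m := 2 ^ i) (K := 2 ^ (L - i)) (b := q / 2 ^ i) hmpos
          (Nat.mod_lt q hmpos)
        have e2 := ft_high a (m := 2 ^ i) (K := 2 ^ (L - i)) (b := q / 2 ^ i) hmpos
          (Nat.mod_lt q hmpos)
        have e3 : 2 * 2 ^ i * (q / 2 ^ i) + 2 ^ i + q % 2 ^ i =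
          lo (2 ^ i) q + 2 ^ i := by rw [lo_eq]; ring
        rw [e3, ← lo_eq, ← hN, ← pow_succ'] at e1 e2
        have e4 := conj_tw_mul (q / 2 ^ i)
        have e5 : 2 ^ i * ft a (2 ^ (L + 1)) (2 ^ i) (lo (2 ^ i) q) +
            2 ^ i * ft a (2 ^ (L + 1)) (2 ^ i) (lo (2 ^ i) q + 2 ^ i) =
            2 ^ (i + 1) * ft a (2 ^ (L + 1)) (2 ^ (i + 1)) (lo (2 ^ i) q) := by
          rw [e1, e2]; ring
        have e6 : (starRingEnd ℂ) (tw (q / 2 ^ i)) *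
            (2 ^ i * ft a (2 ^ (L + 1)) (2 ^ i) (lo (2 ^ i) q) -
              2 ^ i * ft a (2 ^ (L + 1)) (2 ^ i) (lo (2 ^ i) q + 2 ^ i)) =
            2 ^ (i + 1) * ft a (2 ^ (L + 1)) (2 ^ (i + 1)) (lo (2 ^ i) q + 2 ^ i) := by
          rw [e1, e2]
          linear_combination
            2 ^ (i + 1) * ft a (2 ^ (L + 1)) (2 ^ (i + 1)) (lo (2 ^ i) q + 2 ^ i) * e4
        rw [e5, e6] at hb
        exact hb
      · refine lt_of_le_of_lt ?_ hS
        have : (8 : ℝ) ^ i ≤ 8 ^ (L + 1) := pow_le_pow_right₀ (by norm_num) (by omega)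
        gcongr
      · rw [pow_succ]
        have : (1 : ℝ) ≤ 8 ^ i := one_le_pow₀ (by norm_num)
        nlinarith
  · rintro s1 ⟨hf, h43, ht, hc⟩
    refine ⟨?_, hf.tick, by simp only [St.tick_tm]; omega, ?_⟩
    · rw [h43, hf.reg 41 (by norm_num), he.r41]
    · intro j hj
      have := hc j hj
      rw [ft_top a hj] at this
      exact this

end WordRAM

/-! ### Memory layout of the randomized phase, and loading the operands of a convolution -/

namespace WordRAM

/-- The parameters of the randomized phase. -/
structure Par (w n t ν p : ℕ) : Prop where
  ht : 2 ≤ t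
  hν : 1 ≤ ν
  lo : 2 ^ ν ≤ 2 * t
  hi : t < 2 ^ ν
  prime : p.Prime
  tp : t < p
  pt : p ≤ 2 * t
  hM : n + 176 * (t + 1) < 2 ^ w
  hw : 2 * (2 ^ (64 * ν)) ^ 3 < 2 ^ w

/-- The registers and tables that are fixed during the randomized phase. -/
structure Env (w n t ν p : ℕ) (s : St) : Prop where
  r1 : s.reg 1 = t
  r2 : s.reg 2 = 0
  r4 : s.reg 4 = n + 16 * (t + 1)
  r7 : s.reg 7 = n + 48 * (t + 1)
  r8 : s.reg 8 = n + 64 * (t + 1)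
  r9 : s.reg 9 = n + 80 * (t + 1)
  r10 : s.reg 10 = n + 96 * (t + 1)
  r12 : s.reg 12 = n + 112 * (t + 1)
  r11 : s.reg 11 = n + 128 * (t + 1)
  r13 : s.reg 13 = n + 144 * (t + 1)
  r14 : s.reg 14 = n + 160 * (t + 1)
  r15 : s.reg 15 = ν - 1
  r16 : s.reg 16 = 2 ^ (64 * ν)
  r17 : s.reg 17 = (2 ^ (64 * ν)) ^ 2
  r18 : s.reg 18 = (2 ^ (64 * ν)) ^ 3
  r19 : s.reg 19 = p
  r20 : s.reg 20 = t + 1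
  r21 : s.reg 21 = 2 * t + 2
  inv : ∀ i, 1 ≤ i → i ≤ t → s.mem (n + 48 * (t + 1) + i) < p ∧
    i * s.mem (n + 48 * (t + 1) + i) % p = 1
  tab : ∀ b < 2 ^ ν, Cell w (2 ^ (64 * ν)) s.mem (n + 64 * (t + 1) + 2 * b) (tw b) (2 ^ (37 * ν))

/-- The tables of inverses and of roots lie below `n + 80 * (t + 1)`. Everything that a trial writes
(weights, `g`, the coefficients, the accumulator, two transform arrays) lies between there and `n +
176 * (t + 1)`. -/
theorem Env.of_eq {w n t ν p : ℕ} {s s' : St} (hp : Par w n t ν p) (h : Env w n t ν p s)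
    (e : ∀ r < 22, s'.reg r = s.reg r)
    (h' : ∀ a, a < n + 80 * (t + 1) ∨ n + 176 * (t + 1) ≤ a → s'.mem a = s.mem a) :
    Env w n t ν p s' := by
  have d := hp.lo
  refine ⟨?_, ?_, ?_, ?_, ?_, ?_, ?_, ?_, ?_, ?_, ?_, ?_, ?_, ?_, ?_, ?_, ?_, ?_, ?_, ?_⟩
  any_goals rw [e _ (by norm_num)]
  · exact h.r1
  · exact h.r2
  · exact h.r4
  · exact h.r7
  · exact h.r8
  · exact h.r9
  · exact h.r10
  · exact h.r12
  · exact h.r11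
  · exact h.r13
  · exact h.r14
  · exact h.r15
  · exact h.r16
  · exact h.r17
  · exact h.r18
  · exact h.r19
  · exact h.r20
  · exact h.r21
  · intro i h1 h2
    rw [h' _ (by omega)]
    exact h.inv i h1 h2
  · intro b hb
    exact (h.tab b hb).congr (h' _ (by omega)) (h' _ (by omega))

theorem Env.congr {w n t ν p : ℕ} {s s' : St} (hp : Par w n t ν p) (h : Env w n t ν p s)
    (h' : Fr 30 (n + 80 * (t + 1)) (n + 176 * (t + 1)) s s') : Env w n t ν p s' :=
  h.of_eq hp (fun r hr => h'.reg r (by omega)) h'.mem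

theorem Env.fftEnv {w n t ν p base e : ℕ} {s : St} (hp : Par w n t ν p) (h : Env w n t ν p s)
    (he : e ≤ ν) (h40 : s.reg 40 = base) (h41 : s.reg 41 = 2 ^ (e + 1)) (h42 : s.reg 42 = 2 ^ e)
    (hb : n + 80 * (t + 1) ≤ base) (hb' : base + 2 * 2 ^ (e + 1) ≤ n + 176 * (t + 1)) :
    FFTEnv w (2 ^ (64 * ν)) (n + 176 * (t + 1)) (2 ^ e) base (2 ^ (e + 1)) (2 ^ (37 * ν)) s := by
  have h1 : 2 ^ e ≤ 2 ^ ν := Nat.pow_le_pow_right (by norm_num) he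
  have h2 := hp.lo
  refine ⟨by positivity, hp.hw, hp.hM, h.r16, h.r17, h.r18, h.r2, h40, h41, h42, pow_succ' _ _, hb',
    ?_, ?_, ?_, ?_⟩
  · rw [h.r8]; omega
  · rw [h.r8]; omega
  · push_cast
    exact pow_le_pow_right₀ (by norm_num) (by omega)
  · intro b hb
    rw [h.r8]
    exact h.tab b (by omega)

theorem Cell.mono {w S : ℕ} {mem : ℕ → ℕ} {a : ℕ} {z : ℂ} {E E' : ℝ} (h : Cell w S mem a z E)
    (hE : E ≤ E') : Cell w S mem a z E' := by
  obtain ⟨x, y, hx, hy, h⟩ := h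
  exact ⟨x, y, hx, hy, h.trans hE⟩

theorem cell_natCast {w S v a : ℕ} {mem : ℕ → ℕ} (h0 : mem a = v * S) (h1 : mem (a + 1) = 0)
    (hv : v * S < 2 ^ w) : Cell w S mem a v 0 := by
  refine ⟨(v * S : ℕ), 0, by rw [h0, rep_natCast hv], ?_, ?_⟩
  · rw [h1, show (0 : ℤ) = ((0 : ℕ) : ℤ) by rfl, rep_natCast (by positivity)]
  · rw [show gi ((v * S : ℕ) : ℤ) 0 = S * (v : ℂ) by
      apply Complex.ext <;> simp [gi, mul_comm]]
    simp

/-- Load the operands of a convolution. -/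
def fillBody : Stm :=
  .ite (.v 32) (.v 31)
    (.sto (.v 13 +ₑ .c 2 *ₑ .v 32) (.ld (.v 12 +ₑ .v 30 -ₑ .v 31 +ₑ .v 32) *ₑ .v 16))
    (.sto (.v 13 +ₑ .c 2 *ₑ .v 32) (.c 0)) ;;
  .sto (.v 13 +ₑ .c 2 *ₑ .v 32 +ₑ .c 1) (.c 0) ;;
  .ite (.v 32) (.c 2 *ₑ .v 31)
    (.sto (.v 14 +ₑ .c 2 *ₑ .v 32) (.ld (.v 10 +ₑ .v 32) *ₑ .v 16))
    (.sto (.v 14 +ₑ .c 2 *ₑ .v 32) (.c 0)) ;;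
  .sto (.v 14 +ₑ .c 2 *ₑ .v 32 +ₑ .c 1) (.c 0)

def fill : Stm := .asg 32 (.c 0) ;; .upto 32 41 fillBody

/-- The truncation of a sequence. -/
def cut (h : ℕ) (F : ℕ → ℕ) (i : ℕ) : ℕ := if i < h then F i else 0

/-- One operand is the block of length `h` before `x`, the other the first `2 * h` entries of `G`.
Length `4 * h` is a power of two when `h` is one and exceeds `h + 2 * h`, so the cyclic product is
the true one. -/
theorem wp_fill {w n t ν p x h : ℕ} {s : St} {F G : ℕ → ℕ} (hp : Par w n t ν p)
    (he : Env w n t ν p s) (h30 : s.reg 30 = x) (h31 : s.reg 31 = h) (h41 : s.reg 41 = 4 * h)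
    (hhx : h ≤ x) (hxt : x ≤ t) (hF : ∀ i < x, s.mem (n + 112 * (t + 1) + i) = F i ∧ F i < p)
    (hG : ∀ i < 2 * t + 2, s.mem (n + 96 * (t + 1) + i) = G i ∧ G i < p) :
    fill.wp w (fun s' => Fr 32 (n + 144 * (t + 1)) (n + 176 * (t + 1)) s s' ∧ s'.reg 41 = s.reg 41 ∧
      s'.reg 42 = s.reg 42 ∧ s'.tm ≤ s.tm + 4 * h * 100 + 10 ∧ ∀ i < 4 * h,
        Cell w (2 ^ (64 * ν)) s'.mem (n + 144 * (t + 1) + 2 * i)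
          (cut h (fun i => F (x - h + i)) i : ℕ) 0 ∧
        Cell w (2 ^ (64 * ν)) s'.mem (n + 160 * (t + 1) + 2 * i) (cut (2 * h) G i : ℕ) 0) s := by
  have hM := hp.hM
  have hSw : 2 ^ ν * 2 ^ (64 * ν) * 2 < 2 ^ w := by
    refine lt_of_le_of_lt ?_ hp.hw
    rw [← pow_mul, ← pow_add, ← pow_succ, ← pow_succ']
    exact Nat.pow_le_pow_right (by norm_num) (by omega)
  have hpν : p ≤ 2 * 2 ^ ν := by have := hp.pt; have := hp.hi; omega
  have hvS : ∀ v < p, v * 2 ^ (64 * ν) < 2 ^ w := by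
    intro v hv
    refine lt_of_le_of_lt ?_ hSw
    nlinarith [Nat.zero_le (2 ^ (64 * ν))]
  have h0w : 0 < 2 ^ w := by positivity
  simp only [fill, Stm.wp, Ex.Ok, Ex.val, Ex.cost]
  refine ⟨h0w, ?_⟩
  refine Stm.wp_upto (lo := 0) (hi := 4 * h) (fun k s' =>
      Fr 32 (n + 144 * (t + 1)) (n + 176 * (t + 1)) s s' ∧ s'.reg 41 = s.reg 41 ∧
      s'.reg 42 = s.reg 42 ∧ s'.tm ≤ s.tm + k * 100 + 5 ∧ ∀ i < k,
        Cell w (2 ^ (64 * ν)) s'.mem (n + 144 * (t + 1) + 2 * i)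
          (cut h (fun i => F (x - h + i)) i : ℕ) 0 ∧
        Cell w (2 ^ (64 * ν)) s'.mem (n + 160 * (t + 1) + 2 * i) (cut (2 * h) G i : ℕ) 0)
    (by omega) (Nat.zero_le _) (by simp) (by simpa using h41)
    ⟨(Fr.refl s).set le_rfl, by simp, by simp, by simp, by omega⟩ ?_ (by norm_num) ?_
  · rintro j s1 - hj e32 e41 ⟨hf, f41, f42, ht, hc⟩
    have he1 := he.congr hp (hf.mono (by norm_num) (by omega) (by omega))
    have e30 : s1.reg 30 = x := by rw [hf.reg 30 (by norm_num), h30]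
    have e31 : s1.reg 31 = h := by rw [hf.reg 31 (by norm_num), h31]
    -- the values to be stored
    have hAv : j < h → s1.mem (n + 112 * (t + 1) + x - h + j) = F (x - h + j) ∧ F (x - h + j) < p := by
      intro hjh
      rw [hf.mem _ (by omega), show n + 112 * (t + 1) + x - h + j =
        n + 112 * (t + 1) + (x - h + j) by omega]
      exact hF _ (by omega)
    have hGv : j < 2 * h → s1.mem (n + 96 * (t + 1) + j) = G j ∧ G j < p := by
      intro hjh
      rw [hf.mem _ (by omega)]
      exact hG _ (by omega)
    -- Both operands, one of them, or none may be zero padding at index `j`; all feasible branches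
    -- end in memory of this form, with different `va` and `vb`.
    have hend : ∀ (s2 : St) (va vb : ℕ), va = cut h (fun i => F (x - h + i)) j →
        vb = cut (2 * h) G j → va < p → vb < p → s2.reg = s1.reg → s2.coins = s1.coins →
        s2.tm ≤ s1.tm + 90 →
        (∀ a, s2.mem a = if a = n + 160 * (t + 1) + 2 * j + 1 then 0 else
          if a = n + 160 * (t + 1) + 2 * j then vb * 2 ^ (64 * ν) else
          if a = n + 144 * (t + 1) + 2 * j + 1 then 0 else
          if a = n + 144 * (t + 1) + 2 * j then va * 2 ^ (64 * ν) else s1.mem a) →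
        (Fr 32 (n + 144 * (t + 1)) (n + 176 * (t + 1)) s (s2.set 32 (j + 1) 4) ∧
          (s2.set 32 (j + 1) 4).reg 41 = s.reg 41 ∧ (s2.set 32 (j + 1) 4).reg 42 = s.reg 42 ∧
          (s2.set 32 (j + 1) 4).tm ≤ s.tm + (j + 1) * 100 + 5 ∧ ∀ i < j + 1,
        Cell w (2 ^ (64 * ν)) (s2.set 32 (j + 1) 4).mem (n + 144 * (t + 1) + 2 * i)
          (cut h (fun i => F (x - h + i)) i : ℕ) 0 ∧
        Cell w (2 ^ (64 * ν)) (s2.set 32 (j + 1) 4).mem (n + 160 * (t + 1) + 2 * i)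
          (cut (2 * h) G i : ℕ) 0) := by
      intro s2 va vb hva hvb hva' hvb' hr hcn htm hm
      refine ⟨?_, ?_, ?_, ?_, ?_⟩
      · refine (hf.trans ⟨fun r _ => by rw [hr], fun a ha => ?_, hcn⟩).set le_rfl
        rw [hm, if_neg (by omega), if_neg (by omega), if_neg (by omega), if_neg (by omega)]
      · simp [hr, f41]
      · simp [hr, f42]
      · simp only [St.set_tm]; omega
      · intro i hi
        simp only [St.set_mem]
        rcases eq_or_ne i j with rfl | hij
        · rw [← hva, ← hvb]
          refine ⟨cell_natCast ?_ ?_ (hvS _ hva'), cell_natCast ?_ ?_ (hvS _ hvb')⟩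
          · rw [hm, if_neg (by omega), if_neg (by omega), if_neg (by omega), if_pos rfl]
          · rw [hm, if_neg (by omega), if_neg (by omega), if_pos rfl]
          · rw [hm, if_neg (by omega), if_pos rfl]
          · rw [hm, if_pos rfl]
        · have := hc i (by omega)
          refine ⟨this.1.congr ?_ ?_, this.2.congr ?_ ?_⟩ <;>
          rw [hm, if_neg (by omega), if_neg (by omega), if_neg (by omega), if_neg (by omega)]
    have hpp := hp.prime.pos
    have hA : j < h → F (x - h + j) * 2 ^ (64 * ν) < 2 ^ w := fun hh => hvS _ (hAv hh).2
    have hB : j < 2 * h → G j * 2 ^ (64 * ν) < 2 ^ w := fun hh => hvS _ (hGv hh).2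
    simp only [fillBody, Stm.wp, Ex.Ok, Ex.val, Ex.cost, St.tick_reg, St.put_reg, St.tick_mem,
      e30, e31, e32, he1.r13, he1.r14, he1.r12, he1.r10, he1.r16, true_and, St.put_mem]
    refine ⟨fun hjh => ⟨by omega, ?_, by omega, by omega, by omega, fun hj2 => ⟨by omega, ?_, by omega,
      by omega, ?_⟩, fun hj2 => absurd hj2 (by omega)⟩, fun hjh => ⟨by omega, by omega, by omega,
      by omega, by omega, fun hj2 => ⟨by omega, ?_, by omega, by omega, ?_⟩, fun hj2 => ⟨by omega, 
      by omega, by omega, by omega, ?_⟩⟩⟩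
    · refine ⟨by omega, ?_⟩
      rw [(hAv hjh).1]; exact hA hjh
    · refine ⟨by omega, ?_⟩
      rw [if_neg (by omega), if_neg (by omega), (hGv hj2).1]; exact hB hj2
    · refine ⟨e41, ?_⟩
      refine hend _ (F (x - h + j)) (G j) (by rw [cut, if_pos hjh]) (by rw [cut, if_pos hj2])
        (hAv hjh).2 (hGv hj2).2 (by rfl) (by rfl) ?_ ?_
      · simp only [St.put_tm, St.tick_tm]; omega
      · intro a
        simp only [St.put_mem, St.tick_mem]
        rw [if_neg (show ¬ n + 96 * (t + 1) + j = n + 144 * (t + 1) + 2 * j + 1 by omega),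
          if_neg (show ¬ n + 96 * (t + 1) + j = n + 144 * (t + 1) + 2 * j by omega), (hGv hj2).1,
          (hAv hjh).1]
    · refine ⟨by omega, ?_⟩
      rw [if_neg (by omega), if_neg (by omega), (hGv hj2).1]; exact hB hj2
    · refine ⟨e41, ?_⟩
      refine hend _ 0 (G j) (by rw [cut, if_neg (by omega)]) (by rw [cut, if_pos hj2])
        hpp (hGv hj2).2 (by rfl) (by rfl) ?_ ?_
      · simp only [St.put_tm, St.tick_tm]; omega
      · intro a
        simp only [St.put_mem, St.tick_mem]
        rw [if_neg (show ¬ n + 96 * (t + 1) + j = n + 144 * (t + 1) + 2 * j + 1 by omega),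
          if_neg (show ¬ n + 96 * (t + 1) + j = n + 144 * (t + 1) + 2 * j by omega), (hGv hj2).1,
          zero_mul]
    · refine ⟨e41, ?_⟩
      refine hend _ 0 0 (by rw [cut, if_neg (by omega)]) (by rw [cut, if_neg (by omega)])
        hpp hpp (by rfl) (by rfl) ?_ ?_
      · simp only [St.put_tm, St.tick_tm]; omega
      · intro a
        simp only [St.put_mem, St.tick_mem, zero_mul]
  · rintro s1 - - ⟨hf, f41, f42, ht, hc⟩
    refine ⟨hf.tick, f41, f42, by simp only [St.tick_tm]; omega, hc⟩

end WordRAM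

/-! ### Pointwise products, and recovery of the integer coefficients -/

namespace WordRAM

/-- Multiply the transforms pointwise. -/
def ptw : Stm := .asg 32 (.c 0) ;; .upto 32 41 (
  .asg 33 (.v 13 +ₑ .c 2 *ₑ .v 32) ;;
  .asg 34 (.v 14 +ₑ .c 2 *ₑ .v 32) ;;
  .asg 35 (.ld (.v 33)) ;;
  .asg 36 (.ld (.v 33 +ₑ .c 1)) ;;
  .asg 37 (.ld (.v 34)) ;;
  .asg 38 (.ld (.v 34 +ₑ .c 1)) ;;
  .sto (.v 33) (rd (.raw .sub (.raw .mul (.v 35) (.v 37)) (.raw .mul (.v 36) (.v 38)))) ;;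
  .sto (.v 33 +ₑ .c 1) (rd (.raw .add (.raw .mul (.v 35) (.v 38)) (.raw .mul (.v 36) (.v 37)))))

theorem wp_ptw {w n t ν p N : ℕ} {s : St} {z z' : ℕ → ℂ} {α V α' : ℝ} (hp : Par w n t ν p)
    (he : Env w n t ν p s) (h41 : s.reg 41 = N) (hN : N ≤ 4 * t) (hα : 0 ≤ α)
    (hz : ∀ j < N, Cell w (2 ^ (64 * ν)) s.mem (n + 144 * (t + 1) + 2 * j) (z j) α ∧ ‖z j‖ ≤ V)
    (hz' : ∀ j < N, Cell w (2 ^ (64 * ν)) s.mem (n + 160 * (t + 1) + 2 * j) (z' j) α ∧ ‖z' j‖ ≤ V)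
    (hS : ((2 ^ (64 * ν) : ℕ) * V + α) * ((2 ^ (64 * ν) : ℕ) * V + α) < ((2 ^ (64 * ν) : ℕ) : ℝ) ^ 3)
    (hα' : α * (V + α / (2 ^ (64 * ν) : ℕ)) + V * α + 2 ≤ α') :
    ptw.wp w (fun s' => Fr 32 (n + 144 * (t + 1)) (n + 160 * (t + 1)) s s' ∧
      s'.reg 41 = s.reg 41 ∧ s'.reg 42 = s.reg 42 ∧ s'.tm ≤ s.tm + N * 100 + 10 ∧ ∀ j < N,
        Cell w (2 ^ (64 * ν)) s'.mem (n + 144 * (t + 1) + 2 * j) (z j * z' j) α') s := by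
  have hM := hp.hM
  simp only [ptw, Stm.wp, Ex.Ok, Ex.val, Ex.cost]
  refine ⟨by positivity, ?_⟩
  refine Stm.wp_upto (lo := 0) (hi := N) (fun k s' =>
      Fr 32 (n + 144 * (t + 1)) (n + 160 * (t + 1)) s s' ∧ s'.reg 41 = s.reg 41 ∧
      s'.reg 42 = s.reg 42 ∧ s'.tm ≤ s.tm + k * 100 + 5 ∧
      (∀ j, k ≤ j → j < N → Cell w (2 ^ (64 * ν)) s'.mem (n + 144 * (t + 1) + 2 * j) (z j) α) ∧
      ∀ j < k, Cell w (2 ^ (64 * ν)) s'.mem (n + 144 * (t + 1) + 2 * j) (z j * z' j) α')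
    (by omega) (Nat.zero_le _) (by simp) (by simpa using h41)
    ⟨(Fr.refl s).set le_rfl, by simp, by simp, by simp, fun j _ hj => (hz j hj).1, by omega⟩
    ?_ (by norm_num) ?_
  · rintro j s1 - hj e32 e41 ⟨hf, f41, f42, ht, hc, hc'⟩
    have he1 := he.congr hp (hf.mono (by norm_num) (by omega) (by omega))
    obtain ⟨a, b, ha, hb, hab⟩ := hc j le_rfl hj
    obtain ⟨c, d, hcc, hdd, hcd⟩ := (hz' j hj).1
    have hSpos : 0 < 2 ^ (64 * ν) := by positivity
    obtain ⟨k1, k2, k3⟩ := rep_mul_round (w := w) hSpos hp.hw hab hcd (by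
      refine lt_of_le_of_lt ?_ hS
      have h1 := (hz j hj).2
      have h2 := (hz' j hj).2
      have h3 : 0 ≤ V := (norm_nonneg _).trans h1
      gcongr)
    have k4 := k3.trans (le_trans (by
      have h1 := (hz j hj).2
      have h2 := (hz' j hj).2
      gcongr) hα')
    have m1 : s1.mem (n + 160 * (t + 1) + 2 * j) = rep w c := by rw [hf.mem _ (by omega), hcc]
    have m2 : s1.mem (n + 160 * (t + 1) + 2 * j + 1) = rep w d := by rw [hf.mem _ (by omega), hdd]
    simp only [rd, Stm.wp, Ex.Ok, Ex.val, Ex.cost, St.tick_reg, St.set_reg, St.put_reg, St.tick_mem,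
      St.set_mem, e32, he1.r13, he1.r14, he1.r16, he1.r17, he1.r18, reduceIte, Nat.reduceEqDiff,
      true_and, ha, hb, m1, m2, k1, k2]
    refine ⟨by omega, by omega, by omega, by omega, by omega, e41, ?_, f41, f42, ?_, ?_, ?_⟩
    · have hf1 : Fr 32 (n + 144 * (t + 1)) (n + 160 * (t + 1)) s (s1.tick 1) := hf.tick
      exact (((((((((hf1.set (by norm_num)).set (by norm_num)).set (by norm_num)).set
        (by norm_num)).set (by norm_num)).set (by norm_num)).put (by omega) (by omega)).put
        (by omega) (by omega)).set (by norm_num))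
    · simp only [St.set_tm, St.put_tm, St.tick_tm]; omega
    · intro i hi1 hi2
      refine (hc i (by omega) hi2).congr ?_ ?_ <;>
      · simp only [St.set_mem, St.put_mem, St.tick_mem]
        rw [if_neg (by omega), if_neg (by omega)]
    · intro i hi
      rcases eq_or_ne i j with rfl | hij
      · refine ⟨(a * c - b * d) / (2 ^ (64 * ν) : ℕ), (a * d + b * c) / (2 ^ (64 * ν) : ℕ), ?_, ?_, k4⟩
        · simp only [St.set_mem, St.put_mem]
          rw [if_neg (by omega), if_pos trivial]
        · simp only [St.set_mem, St.put_mem]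
          rw [if_pos trivial]
      · refine (hc' i (by omega)).congr ?_ ?_ <;>
        · simp only [St.set_mem, St.put_mem, St.tick_mem]
          rw [if_neg (by omega), if_neg (by omega)]
  · rintro s1 - - ⟨hf, f41, f42, ht, -, hc⟩
    exact ⟨hf.tick, f41, f42, by simp only [St.tick_tm]; omega, hc⟩

/-- Recover the coefficients of the product and add them to the accumulator. -/
def accum : Stm := .asg 32 (.c 0) ;; .upto 32 31 (
  .sto (.v 11 +ₑ .v 30 +ₑ .v 32) ((.ld (.v 11 +ₑ .v 30 +ₑ .v 32) +ₑ
    (.raw .add (.ld (.v 13 +ₑ .c 2 *ₑ (.v 31 +ₑ .v 32))) (.c 2 *ₑ .v 31 *ₑ .v 16) /ₑ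
      (.c 4 *ₑ .v 31 *ₑ .v 16)) %ₑ .v 19) %ₑ .v 19))

/-- The inverse transform yields `4 * h * S * c` with an error below half of that scale. Adding `2 *
h * S` makes the value nonnegative and turns the floor of the quotient into rounding to the nearest
integer. -/
theorem eval_add_div {w h S c : ℕ} {X : ℤ} (hh : 0 < h) (hS : 0 < S)
    (hX : |X - 4 * h * S * c| < 2 * h * S) (hw : 4 * h * S * (c + 1) < 2 ^ w) :
    BinOp.add.eval w (rep w X) (2 * h * S) / (4 * h * S) = c := by
  have hb := abs_lt.1 hX
  have e : 4 * h * S * (c + 1) = 4 * h * S * c + 4 * h * S := by ring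
  have e4 : 4 * h * S = 2 * (2 * h * S) := by ring
  have hpos : 0 < 2 * h * S := by positivity
  rw [show 2 * h * S = rep w ((2 * h * S : ℕ) : ℤ) from (rep_natCast (by nlinarith)).symm,
    eval_add_rep]
  have hw' : (4 * h * S * c + 4 * h * S : ℤ) < 2 ^ w := by rw [e] at hw; exact_mod_cast hw
  have hw2 : (4 * h * S : ℤ) = 2 * (2 * h * S) := by ring
  have hpos' : (0 : ℤ) < 2 * h * S := by exact_mod_cast hpos
  have hc0 : (0 : ℤ) ≤ 4 * h * S * c := by positivity
  rw [rep, Int.emod_eq_of_lt (by push_cast; linarith) (by push_cast; linarith)]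
  apply Nat.div_eq_of_lt_le
  · zify
    rw [Int.toNat_of_nonneg (by linarith)]
    linarith
  · zify
    rw [Int.toNat_of_nonneg (by linarith)]
    linarith

/-- The block starts at `x - h`, so coefficient `h + (i - x)` of the product belongs to index `i`.
Only the window of length `h` from `x` on is used. -/
theorem wp_accum {w n t ν p x h : ℕ} {s : St} {Ac c : ℕ → ℕ} (hp : Par w n t ν p)
    (he : Env w n t ν p s) (h30 : s.reg 30 = x) (h31 : s.reg 31 = h) (hh : 0 < h)
    (hhx : h ≤ x) (hxt : x ≤ t)
    (hAc : ∀ i < 2 * t + 2, s.mem (n + 128 * (t + 1) + i) = Ac i ∧ Ac i < p)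
    (hc : ∀ j, h ≤ j → j < 2 * h → ∃ X : ℤ, s.mem (n + 144 * (t + 1) + 2 * j) = rep w X ∧
      |X - 4 * h * (2 ^ (64 * ν) : ℕ) * c j| < 2 * h * (2 ^ (64 * ν) : ℕ))
    (hcw : ∀ j, h ≤ j → j < 2 * h → 4 * h * 2 ^ (64 * ν) * (c j + 1) < 2 ^ w) :
    accum.wp w (fun s' => Fr 32 (n + 128 * (t + 1)) (n + 144 * (t + 1)) s s' ∧
      s'.tm ≤ s.tm + h * 100 + 10 ∧ ∀ i < 2 * t + 2, s'.mem (n + 128 * (t + 1) + i) =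
        if x ≤ i ∧ i < x + h then (Ac i + c (h + (i - x))) % p else Ac i) s := by
  have hM := hp.hM
  have hpt := hp.pt
  have hpp := hp.prime.pos
  simp only [accum, Stm.wp, Ex.Ok, Ex.val, Ex.cost]
  refine ⟨by positivity, ?_⟩
  refine Stm.wp_upto (lo := 0) (hi := h) (fun k s' =>
      Fr 32 (n + 128 * (t + 1)) (n + 144 * (t + 1)) s s' ∧ s'.tm ≤ s.tm + k * 100 + 5 ∧
      ∀ i < 2 * t + 2, s'.mem (n + 128 * (t + 1) + i) =
        if x ≤ i ∧ i < x + k then (Ac i + c (h + (i - x))) % p else Ac i)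
    (by omega) (Nat.zero_le _) (by simp) (by simpa using h31)
    ⟨(Fr.refl s).set le_rfl, by simp, fun i hi => ?_⟩ ?_ (by norm_num) ?_
  · rw [if_neg (by omega)]; exact (hAc i hi).1
  · rintro j s1 - hj e32 e31 ⟨hf, ht, hm⟩
    have he1 := he.congr hp (hf.mono (by norm_num) (by omega) (by omega))
    have e30 : s1.reg 30 = x := by rw [hf.reg 30 (by norm_num), h30]
    obtain ⟨X, hX, hXc⟩ := hc (h + j) (by omega) (by omega)
    have hcj := hcw (h + j) (by omega) (by omega)
    have hSpos : 0 < 2 ^ (64 * ν) := by positivity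
    have e1 := eval_add_div (w := w) hh hSpos hXc hcj
    have hAx := hAc (x + j) (by omega)
    have m1 : s1.mem (n + 128 * (t + 1) + x + j) = Ac (x + j) := by
      rw [add_assoc, hm _ (by omega), if_neg (by omega)]
    have m2 : s1.mem (n + 144 * (t + 1) + 2 * (h + j)) = rep w X := by
      rw [hf.mem _ (by omega), hX]
    have hmod := Nat.mod_lt (c (h + j)) hpp
    have hle : 4 * h * 2 ^ (64 * ν) ≤ 4 * h * 2 ^ (64 * ν) * (c (h + j) + 1) :=
      Nat.le_mul_of_pos_right _ (by omega)
    have h2w : 2 * h * 2 ^ (64 * ν) < 2 ^ w := by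
      refine lt_of_le_of_lt ?_ hcj
      refine le_trans ?_ hle
      gcongr; norm_num
    simp only [Stm.wp, Ex.Ok, Ex.val, Ex.cost, St.tick_reg, St.tick_mem, St.put_reg, e32, e30, e31,
      he1.r11, he1.r13, he1.r16, he1.r19, m1, m2, e1, true_and, and_true, and_assoc]
    repeat refine ⟨by omega, ?_⟩
    refine ⟨((hf.tick (k := 1)).put (by omega) (by omega)).set (by norm_num), ?_, ?_⟩
    · simp only [St.set_tm, St.put_tm, St.tick_tm]; omega
    · intro i hi
      simp only [St.set_mem, St.put_mem, St.tick_mem]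
      rcases eq_or_ne i (x + j) with rfl | hij
      · rw [if_pos (by omega), if_pos (by omega), show x + j - x = j by omega, Nat.add_mod_mod]
      · rw [if_neg (by omega), hm i hi]
        congr 1
        apply propext
        omega
  · rintro s1 - - ⟨hf, ht, hm⟩
    exact ⟨hf.tick, by simp only [St.tick_tm]; omega, hm⟩

end WordRAM

/-! ### Exact convolution modulo the prime -/

namespace WordRAM

/-- Add the product of the block of length `31` before `30` of the sequence at `12`, and of the
sequence at `10`, to the accumulator. -/
def conv : Stm :=
  .asg 41 (.c 4 *ₑ .v 31) ;; .asg 42 (.c 2 *ₑ .v 31) ;; fill ;;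
  .asg 40 (.v 13) ;; fft ;; .asg 40 (.v 14) ;; fft ;; ptw ;; .asg 40 (.v 13) ;; ifft ;; accum

/-- The error bounds of the convolution, in terms of `u = 2 ^ ν`. -/
theorem error_bounds {u : ℝ} (hu : 2 ≤ u) :
    u ^ 6 * (0 + (2 * u ^ 37 * u ^ 4 + 2)) ≤ u ^ 49 ∧
    4 * (u ^ 64 * u ^ 4 + u ^ 49) < (u ^ 64) ^ 2 ∧
    (u ^ 64 * u ^ 4 + u ^ 49) * (u ^ 64 * u ^ 4 + u ^ 49) < (u ^ 64) ^ 3 ∧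
    u ^ 49 * (u ^ 4 + u ^ 49 / u ^ 64) + u ^ 4 * u ^ 49 + 2 ≤ u ^ 55 ∧
    u ^ 6 * (u ^ 55 + (2 * u ^ 37 * u ^ 10 + 2)) ≤ u ^ 62 ∧
    4 * (u ^ 64 * u ^ 10 + u ^ 62) < (u ^ 64) ^ 2 := by
  have hu1 : 1 ≤ u := by linarith
  have hu0 : 0 < u := by linarith
  have mono : ∀ a b, a ≤ b → u ^ a ≤ u ^ b := fun a b h => pow_le_pow_right₀ hu1 h
  have dbl : ∀ a, 2 * u ^ a ≤ u ^ (a + 1) := by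
    intro a; rw [pow_succ]; nlinarith [pow_pos hu0 a]
  have one : ∀ a, 1 ≤ u ^ a := fun a => one_le_pow₀ hu1
  refine ⟨?_, ?_, ?_, ?_, ?_, ?_⟩
  · calc u ^ 6 * (0 + (2 * u ^ 37 * u ^ 4 + 2)) ≤ u ^ 6 * u ^ 43 := by
          gcongr
          have := dbl 41; have := dbl 42; have := mono 1 42 (by norm_num)
          rw [show 2 * u ^ 37 * u ^ 4 = 2 * u ^ 41 by ring]; norm_num at *; linarith
      _ = u ^ 49 := by ring
  · rw [← pow_add, ← pow_mul]
    have := mono 49 68 (by norm_num); have := dbl 68; have := dbl 69; have := dbl 70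
    have := mono 72 (64 * 2) (by norm_num); have := dbl 71; have := one 71
    norm_num at *; linarith
  · have h1 : u ^ 64 * u ^ 4 + u ^ 49 ≤ u ^ 69 := by
      rw [← pow_add]
      have := mono 49 68 (by norm_num); have := dbl 68
      norm_num at *; linarith
    calc (u ^ 64 * u ^ 4 + u ^ 49) * (u ^ 64 * u ^ 4 + u ^ 49) ≤ u ^ 69 * u ^ 69 := by gcongr
      _ = u ^ 138 := by ring
      _ < u ^ 139 := by have := dbl 138; have := one 138; norm_num at *; linarith
      _ ≤ u ^ 192 := mono _ _ (by norm_num)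
      _ = _ := by ring
  · have h1 : u ^ 49 / u ^ 64 ≤ u ^ 4 := by
      rw [div_le_iff₀ (by positivity), ← pow_add]; exact mono _ _ (by norm_num)
    calc u ^ 49 * (u ^ 4 + u ^ 49 / u ^ 64) + u ^ 4 * u ^ 49 + 2
        ≤ u ^ 49 * (u ^ 4 + u ^ 4) + u ^ 4 * u ^ 49 + u := by gcongr
      _ = 3 * u ^ 53 + u := by ring
      _ ≤ u ^ 55 := by
        have := mono 1 53 (by norm_num); have := dbl 53; have := dbl 54
        norm_num at *; linarith
  · calc u ^ 6 * (u ^ 55 + (2 * u ^ 37 * u ^ 10 + 2)) ≤ u ^ 6 * u ^ 56 := by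
          gcongr
          have := dbl 47; have := dbl 48; have := mono 1 48 (by norm_num); have := dbl 55
          have := mono 49 55 (by norm_num)
          rw [show 2 * u ^ 37 * u ^ 10 = 2 * u ^ 47 by ring]; norm_num at *; linarith
      _ = u ^ 62 := by ring
  · rw [← pow_add, ← pow_mul]
    have := mono 62 74 (by norm_num); have := dbl 74; have := dbl 75; have := dbl 76
    have := mono 78 (64 * 2) (by norm_num); have := dbl 77; have := one 77
    norm_num at *; linarith

theorem cut_of_le {h i : ℕ} {F : ℕ → ℕ} (hi : h ≤ i) : cut h F i = 0 := by
  rw [cut, if_neg (by omega)]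

theorem cauchy_natCast (f g : ℕ → ℕ) (n : ℕ) :
    cauchy (fun i => (f i : ℂ)) (fun i => (g i : ℂ)) n = (cauchy f g n : ℕ) := by
  simp [cauchy]

theorem sum_norm_cut_le {h N p : ℕ} {F : ℕ → ℕ} (hF : ∀ i < h, F i < p) :
    ∑ k ∈ Finset.range N, ‖((cut h F k : ℕ) : ℂ)‖ ≤ N * p := by
  refine (Finset.sum_le_card_nsmul _ _ (p : ℝ) fun k _ => ?_).trans (by simp)
  rw [Complex.norm_natCast, cut]
  split_ifs with hk
  · exact_mod_cast (hF k hk).le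
  · simp

theorem cauchy_cut_le {h h' p : ℕ} {F G : ℕ → ℕ} (hF : ∀ i < h, F i < p) (hG : ∀ i < h', G i < p)
    (j : ℕ) : cauchy (cut h F) (cut h' G) j ≤ h * (p * p) := by
  calc cauchy (cut h F) (cut h' G) j ≤ ∑ i ∈ Finset.range (j + 1), if i < h then p * p else 0 := by
        refine Finset.sum_le_sum fun i _ => ?_
        split_ifs with hi
        · refine Nat.mul_le_mul ?_ ?_
          · rw [cut, if_pos hi]; exact (hF i hi).le
          · rw [cut]
            split_ifs with h2
            · exact (hG _ h2).le
            · exact Nat.zero_le _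
        · rw [cut_of_le (by omega)]; simp
    _ ≤ ∑ i ∈ Finset.range h, p * p := by
        rw [← Finset.sum_filter]
        refine Finset.sum_le_sum_of_subset ?_
        intro i hi
        simp only [Finset.mem_filter, Finset.mem_range] at hi ⊢
        exact hi.2
    _ = h * (p * p) := by simp

theorem conv_word_bound {w ν p h c : ℕ} (hν : 1 ≤ ν) (h4 : 4 * h ≤ 2 ^ (2 * ν))
    (hp : p ≤ 2 ^ (2 * ν)) (hc : c ≤ h * (p * p)) (hw : 2 * (2 ^ (64 * ν)) ^ 3 < 2 ^ w) :
    4 * h * 2 ^ (64 * ν) * (c + 1) < 2 ^ w := by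
  have hc1 : c + 1 ≤ 2 ^ (7 * ν) := by
    have h1 : h * (p * p) ≤ 2 ^ (6 * ν) := by
      calc h * (p * p) ≤ 2 ^ (2 * ν) * (2 ^ (2 * ν) * 2 ^ (2 * ν)) := by gcongr; omega
        _ = 2 ^ (6 * ν) := by rw [← pow_add, ← pow_add]; congr 1; ring
    have h2 : 2 * 2 ^ (6 * ν) ≤ 2 ^ (7 * ν) := by
      rw [← pow_succ']; exact Nat.pow_le_pow_right (by norm_num) (by omega)
    have h3 : 0 < 2 ^ (6 * ν) := by positivity
    omega
  calc 4 * h * 2 ^ (64 * ν) * (c + 1) ≤ 2 ^ (2 * ν) * 2 ^ (64 * ν) * 2 ^ (7 * ν) := by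
        gcongr
    _ ≤ (2 ^ (64 * ν)) ^ 3 := by
        rw [← pow_add, ← pow_add, ← pow_mul]
        exact Nat.pow_le_pow_right (by norm_num) (by omega)
    _ ≤ 2 * (2 ^ (64 * ν)) ^ 3 := by omega
    _ < 2 ^ w := hw

/-- With `u = 2 ^ ν` and unit `u ^ 64`, the table has error `u ^ 37`, the forward transforms `u ^
49`, their product `u ^ 55`, and the inverse transform `u ^ 62`. The magnitudes are bounded by `ℓ¹`
norms: the length `4 * h` and the residues are at most `u ^ 2`, so the operands have norm at most `u
^ 4`, and the product, scaled by the length, at most `u ^ 10`. -/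
theorem wp_conv {w n t ν p x e : ℕ} {s : St} {F G Ac : ℕ → ℕ} (hp : Par w n t ν p)
    (he : Env w n t ν p s) (h30 : s.reg 30 = x) (h31 : s.reg 31 = 2 ^ e)
    (hhx : 2 ^ e ≤ x) (hxt : x ≤ t)
    (hF : ∀ i < x, s.mem (n + 112 * (t + 1) + i) = F i ∧ F i < p)
    (hG : ∀ i < 2 * t + 2, s.mem (n + 96 * (t + 1) + i) = G i ∧ G i < p)
    (hAc : ∀ i < 2 * t + 2, s.mem (n + 128 * (t + 1) + i) = Ac i ∧ Ac i < p) :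
    conv.wp w (fun s' => Fr 32 (n + 128 * (t + 1)) (n + 176 * (t + 1)) s s' ∧
      s'.tm ≤ s.tm + 2000 * ((e + 2) * 2 ^ e) ∧
      ∀ i < 2 * t + 2, s'.mem (n + 128 * (t + 1) + i) =
        if x ≤ i ∧ i < x + 2 ^ e then
          (Ac i + cauchy (cut (2 ^ e) (fun i => F (x - 2 ^ e + i))) (cut (2 * 2 ^ e) G)
            (2 ^ e + (i - x))) % p
        else Ac i) s := by
  set h := 2 ^ e with hh
  have hM := hp.hM
  have hpt := hp.pt
  have hhpos : 0 < h := by positivity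
  have heν : e + 1 ≤ ν := by
    have : 2 ^ e < 2 ^ ν := by have := hp.hi; omega
    exact (Nat.pow_lt_pow_iff_right (by norm_num)).1 this
  have hN : 2 ^ (e + 1 + 1) = 4 * h := by rw [hh]; ring
  have hN2 : 2 ^ (e + 1) = 2 * h := by rw [hh]; ring
  set S := 2 ^ (64 * ν) with hS
  set a : ℕ → ℕ := cut h (fun i => F (x - h + i)) with ha
  set b : ℕ → ℕ := cut (2 * h) G with hb
  set u : ℝ := 2 ^ ν with hu
  have hu2 : 2 ≤ u := by
    calc (2 : ℝ) = 2 ^ 1 := by norm_num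
      _ ≤ 2 ^ ν := pow_le_pow_right₀ (by norm_num) hp.hν
  have hu0 : 0 < u := by linarith
  have hSu : (S : ℝ) = u ^ 64 := by rw [hS, hu, ← pow_mul]; push_cast; rw [mul_comm]
  have hτu : (2 : ℝ) ^ (37 * ν) = u ^ 37 := by rw [hu, ← pow_mul, mul_comm]
  -- There are `e + 2 ≤ 2 * ν` stages, and `8 ^ (2 * ν) = u ^ 6` is the growth factor of a
  -- transform.
  have h8 : (8 : ℝ) ^ (e + 1 + 1) ≤ u ^ 6 := by
    have h1 : (8 : ℝ) ^ (e + 1 + 1) ≤ 8 ^ (ν + ν) := pow_le_pow_right₀ (by norm_num) (by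
      have := hp.hν; omega)
    refine h1.trans (le_of_eq ?_)
    rw [hu, ← pow_mul, show (8 : ℝ) = 2 ^ 3 by norm_num, ← pow_mul]
    congr 1; ring
  have h4u : ((4 * h : ℕ) : ℝ) ≤ u ^ 2 := by
    rw [← hN, hu, ← pow_mul]; push_cast
    exact pow_le_pow_right₀ (by norm_num) (by omega)
  have hpu : (p : ℝ) ≤ u ^ 2 := by
    have : p ≤ 2 ^ (ν * 2) := by
      have h1 := hp.pt
      have h2 := hp.hi
      have h3 : 2 * 2 ^ ν ≤ 2 ^ (ν * 2) := by
        rw [← pow_succ']; exact Nat.pow_le_pow_right (by norm_num) (by have := hp.hν; omega)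
      omega
    rw [hu, ← pow_mul]; exact_mod_cast this
  have hFp : ∀ i < h, F (x - h + i) < p := fun i hi => (hF _ (by omega)).2
  have hGp : ∀ i < 2 * h, G i < p := fun i hi => (hG _ (by omega)).2
  have hVa : ∑ k ∈ Finset.range (2 ^ (e + 1 + 1)), ‖((a k : ℕ) : ℂ)‖ ≤ u ^ 4 := by
    rw [hN]
    refine (sum_norm_cut_le hFp).trans ?_
    calc ((4 * h : ℕ) : ℝ) * p ≤ u ^ 2 * u ^ 2 := by gcongr
      _ = u ^ 4 := by ring
  have hVb : ∑ k ∈ Finset.range (2 ^ (e + 1 + 1)), ‖((b k : ℕ) : ℂ)‖ ≤ u ^ 4 := by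
    rw [hN]
    refine (sum_norm_cut_le hGp).trans ?_
    calc ((4 * h : ℕ) : ℝ) * p ≤ u ^ 2 * u ^ 2 := by gcongr
      _ = u ^ 4 := by ring
  have ha0 : ∀ i, h ≤ i → ((a i : ℕ) : ℂ) = 0 := fun i hi => by rw [ha, cut_of_le hi]; simp
  have hb0 : ∀ i, 2 * h ≤ i → ((b i : ℕ) : ℂ) = 0 := fun i hi => by rw [hb, cut_of_le hi]; simp
  have hab := sum_norm_cauchy_le ha0 hb0 (N := 2 ^ (e + 1 + 1)) (by rw [hN]; omega)
  have hVc : 2 ^ (e + 1 + 1) * ∑ k ∈ Finset.range (2 ^ (e + 1 + 1)),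
      ‖cauchy (fun i => ((a i : ℕ) : ℂ)) (fun i => ((b i : ℕ) : ℂ)) k‖ ≤ u ^ 10 := by
    have h1 : (2 : ℝ) ^ (e + 1 + 1) ≤ u ^ 2 := by
      have : ((2 ^ (e + 1 + 1) : ℕ) : ℝ) ≤ u ^ 2 := by rw [hN]; exact h4u
      exact_mod_cast this
    calc _ ≤ u ^ 2 * (u ^ 4 * u ^ 4) := by
          refine mul_le_mul h1 (hab.trans ?_) (Finset.sum_nonneg fun _ _ => norm_nonneg _)
            (by positivity)
          exact mul_le_mul hVa hVb (Finset.sum_nonneg fun _ _ => norm_nonneg _) (by positivity)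
      _ = u ^ 10 := by ring
  obtain ⟨q1, q2, q3, q4, q5, q6⟩ := error_bounds hu2
  have q1' : (8 : ℝ) ^ (e + 1 + 1) * (0 + (2 * 2 ^ (37 * ν) * u ^ 4 + 2)) ≤ u ^ 49 := by
    rw [hτu]; exact (mul_le_mul_of_nonneg_right h8 (by positivity)).trans q1
  have q5' : (8 : ℝ) ^ (e + 1 + 1) * (u ^ 55 + (2 * 2 ^ (37 * ν) * u ^ 10 + 2)) ≤ u ^ 62 := by
    rw [hτu]; exact (mul_le_mul_of_nonneg_right h8 (by positivity)).trans q5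
  have h4w : 4 < 2 ^ w := by have := hp.ht; omega
  simp only [conv, Stm.wp, Ex.Ok, Ex.val, Ex.cost, St.set_reg, h31, reduceIte, Nat.reduceEqDiff,
    true_and]
  refine ⟨⟨h4w, by omega⟩, ⟨by omega, by omega⟩, ?_⟩
  refine Stm.wp_mono _ ?_ (wp_fill hp (he.congr hp ?_) ?_ ?_ ?_ hhx hxt hF hG)
  rotate_left
  · exact ((Fr.refl s).set (by norm_num)).set (by norm_num)
  · simpa using h30
  · simpa using h31
  · simp
  rintro s1 ⟨f1, f41, f42, t1, c1⟩
  simp only [St.set_reg, reduceIte, Nat.reduceEqDiff] at f41 f42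
  have f1' : Fr 30 (n + 128 * (t + 1)) (n + 176 * (t + 1)) s s1 :=
    (((Fr.refl s).set (by norm_num)).set (by norm_num)).trans
      (f1.mono (by norm_num) (by omega) (by omega))
  have f30 : s1.reg 30 = x := by rw [f1.reg 30 (by norm_num)]; simpa using h30
  have f31 : s1.reg 31 = h := by rw [f1.reg 31 (by norm_num)]; simpa using h31
  have he1 := he.congr hp (f1'.mono (by norm_num) (by omega) (by omega))
  have g1 : FFTEnv w S (n + 176 * (t + 1)) (2 ^ (e + 1)) (n + 144 * (t + 1)) (2 ^ (e + 1 + 1))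
      (2 ^ (37 * ν)) (s1.set 40 (s1.reg 13) (1 + 1)) := by
    refine (he1.congr hp ((Fr.refl s1).set (by norm_num))).fftEnv hp heν ?_ ?_ ?_ (by omega)
      (by rw [hN]; omega)
    · simp [he1.r13]
    · simp [f41, hN]
    · simp [f42, hN2]
  have v0 : (0 : ℝ) ≤ 2 ^ (37 * ν) := by positivity
  refine Stm.wp_mono _ ?_ (wp_fft (V := u ^ 4) (E := 0) (a := fun i => ((a i : ℕ) : ℂ)) g1 v0 le_rfl
    (fun j hj => (c1 j (by omega)).1) hVa ?_)
  rotate_left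
  · rw [hSu]; refine lt_of_le_of_lt ?_ q2; gcongr
  rintro s2 ⟨f2, t2, c2⟩
  have f2' : Fr 30 (n + 144 * (t + 1)) (n + 160 * (t + 1)) s1 s2 :=
    ((Fr.refl s1).set (by norm_num)).trans (f2.mono (by norm_num) le_rfl (by rw [hN]; omega))
  have he2 := he1.congr hp (f2'.mono le_rfl (by omega) (by omega))
  have g2 : FFTEnv w S (n + 176 * (t + 1)) (2 ^ (e + 1)) (n + 160 * (t + 1)) (2 ^ (e + 1 + 1))
      (2 ^ (37 * ν)) (s2.set 40 (s2.reg 14) (1 + 1)) := by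
    refine (he2.congr hp ((Fr.refl s2).set (by norm_num))).fftEnv hp heν ?_ ?_ ?_ (by omega)
      (by rw [hN]; omega)
    · simp [he2.r14]
    · simp [f2.reg 41 (by norm_num), f41, hN]
    · simp [f2.reg 42 (by norm_num), f42, hN2]
  refine Stm.wp_mono _ ?_ (wp_fft (V := u ^ 4) (E := 0) (a := fun i => ((b i : ℕ) : ℂ)) g2 v0 le_rfl
    (fun j hj => ?_) hVb ?_)
  rotate_left
  · exact ((c1 j (by omega)).2).congr (f2.mem _ (by omega)) (f2.mem _ (by omega))
  · rw [hSu]; refine lt_of_le_of_lt ?_ q2; gcongr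
  rintro s3 ⟨f3, t3, c3⟩
  have f3' : Fr 30 (n + 160 * (t + 1)) (n + 176 * (t + 1)) s2 s3 :=
    ((Fr.refl s2).set (by norm_num)).trans (f3.mono (by norm_num) le_rfl (by rw [hN]; omega))
  have he3 := he2.congr hp (f3'.mono le_rfl (by omega) (by omega))
  have f3r : ∀ r, 32 ≤ r → r < 43 → r ≠ 40 → s3.reg r = s1.reg r := by
    intro r h1 h2 h3
    rw [f3.reg r h2, St.set_reg, if_neg h3, f2.reg r h2, St.set_reg, if_neg h3]
  refine Stm.wp_mono _ ?_ (wp_ptw (V := u ^ 4) (α := u ^ 49) (α' := u ^ 55) (N := 4 * h)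
    (z := ft (fun i => ((a i : ℕ) : ℂ)) (2 ^ (e + 1 + 1)) 1)
    (z' := ft (fun i => ((b i : ℕ) : ℂ)) (2 ^ (e + 1 + 1)) 1) hp he3 ?_ (by omega) (by positivity)
    (fun j hj => ⟨?_, ?_⟩) (fun j hj => ⟨?_, ?_⟩) ?_ ?_)
  rotate_left
  · rw [f3r 41 (by norm_num) (by norm_num) (by norm_num), f41]
  · exact ((c2 j (by omega)).congr (f3.mem _ (by omega)) (f3.mem _ (by omega))).mono q1'
  · exact (norm_ft_le _ one_pos).trans hVa
  · exact (c3 j (by omega)).mono q1'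
  · exact (norm_ft_le _ one_pos).trans hVb
  · rw [hSu]; exact q3
  · rw [hSu]; exact q4
  rintro s4 ⟨f4, f441, f442, t4, c4⟩
  have he4 := he3.congr hp (f4.mono (by norm_num) (by omega) (by omega))
  have g4 : FFTEnv w S (n + 176 * (t + 1)) (2 ^ (e + 1)) (n + 144 * (t + 1)) (2 ^ (e + 1 + 1))
      (2 ^ (37 * ν)) (s4.set 40 (s4.reg 13) (1 + 1)) := by
    refine (he4.congr hp ((Fr.refl s4).set (by norm_num))).fftEnv hp heν ?_ ?_ ?_ (by omega)
      (by rw [hN]; omega)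
    · simp [he4.r13]
    · simp [f441, f3r 41 (by norm_num) (by norm_num) (by norm_num), f41, hN]
    · simp [f442, f3r 42 (by norm_num) (by norm_num) (by norm_num), f42, hN2]
  refine Stm.wp_mono _ ?_ (wp_ifft (V := u ^ 10) (E := u ^ 55)
    (a := cauchy (fun i => ((a i : ℕ) : ℂ)) (fun i => ((b i : ℕ) : ℂ))) g4 v0 (by positivity)
    (fun j hj => ?_) hVc ?_)
  rotate_left
  · rw [ft_cauchy ha0 hb0 (by rw [hN]; omega)]
    exact c4 j (by omega)
  · rw [hSu]; refine lt_of_le_of_lt ?_ q6; gcongr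
  rintro s5 ⟨f5, t5, c5⟩
  have f5' : Fr 30 (n + 144 * (t + 1)) (n + 160 * (t + 1)) s4 s5 :=
    ((Fr.refl s4).set (by norm_num)).trans (f5.mono (by norm_num) le_rfl (by rw [hN]; omega))
  have he5 := he4.congr hp (f5'.mono le_rfl (by omega) (by omega))
  have k5 : ∀ r, r < 32 → s5.reg r = s1.reg r := by
    intro r hr
    rw [f5.reg r (by omega), St.set_reg, if_neg (by omega), f4.reg r hr, f3.reg r (by omega),
      St.set_reg, if_neg (by omega), f2.reg r (by omega), St.set_reg, if_neg (by omega)]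
  have m5 : ∀ i, i < n + 144 * (t + 1) → s5.mem i = s.mem i := by
    intro i hi
    rw [f5'.mem i (by omega), f4.mem i (by omega), f3'.mem i (by omega), f2'.mem i (by omega),
      f1.mem i (by omega)]
    rfl
  -- The error `u ^ 62` is less than `2 * h * S`, half of the scale `4 * h * S`, because `S = u ^
  -- 64`.
  have cval : ∀ j < 4 * h, ∃ X : ℤ, s5.mem (n + 144 * (t + 1) + 2 * j) = rep w X ∧
      |X - 4 * h * (S : ℕ) * (cauchy a b j : ℕ)| < 2 * h * (S : ℕ) := by
    intro j hj
    obtain ⟨X, Y, hX, -, hXY⟩ := (c5 j (by omega)).mono q5'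
    refine ⟨X, hX, ?_⟩
    rw [cauchy_natCast] at hXY
    have e1 : gi X Y - (S : ℂ) * (2 ^ (e + 1 + 1) * (cauchy a b j : ℕ)) =
        gi (X - 4 * h * S * (cauchy a b j : ℕ)) Y := by
      have : (2 : ℂ) ^ (e + 1 + 1) = 4 * h := by exact_mod_cast hN
      rw [this]
      apply Complex.ext <;> simp [gi]
      ring
    rw [e1] at hXY
    have h1 := (abs_le_norm_gi _ _).1.trans hXY
    have h2 : u ^ 62 < ((2 * h * S : ℕ) : ℝ) := by
      push_cast
      rw [hSu]
      have h3 : (1 : ℝ) ≤ h := by exact_mod_cast hhpos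
      have h4 : u ^ 62 ≤ u ^ 64 := pow_le_pow_right₀ (by linarith) (by norm_num)
      have h5 : 0 < u ^ 64 := by positivity
      nlinarith
    have h3 := h1.trans_lt h2
    exact_mod_cast h3
  have cwb : ∀ j, 4 * h * S * (cauchy a b j + 1) < 2 ^ w := by
    intro j
    refine conv_word_bound hp.hν ?_ ?_ (cauchy_cut_le hFp hGp j) hp.hw
    · rw [← hN]; exact Nat.pow_le_pow_right (by norm_num) (by omega)
    · rw [hu, ← pow_mul, mul_comm ν] at hpu
      exact_mod_cast hpu
  refine Stm.wp_mono _ ?_ (wp_accum (x := x) (h := h) (c := cauchy a b) hp he5 ?_ ?_ hhpos hhx hxt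
    (fun i hi => ⟨?_, (hAc i hi).2⟩) (fun j _ hj => cval j (by omega)) (fun j _ _ => cwb j))
  rotate_left
  · rw [k5 30 (by norm_num), f30]
  · rw [k5 31 (by norm_num), f31]
  · rw [m5 _ (by omega)]; exact (hAc i hi).1
  rintro s6 ⟨f6, t6, c6⟩
  refine ⟨⟨fun r hr => ?_, fun i hi => ?_, ?_⟩, ?_, c6⟩
  · rw [f6.reg r hr, k5 r hr, f1.reg r hr, St.set_reg, if_neg (by omega), St.set_reg,
      if_neg (by omega)]
  · rw [f6.mem i (by omega)]
    rcases hi with hi | hi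
    · exact m5 i (by omega)
    · rw [f5'.mem i (by omega), f4.mem i (by omega), f3'.mem i (by omega), f2'.mem i (by omega),
        f1.mem i (by omega)]
      rfl
  · rw [f6.coins, f5'.coins, f4.coins, f3'.coins, f2'.coins, f1.coins]; rfl
  · rw [hN2] at t2 t3 t5
    simp only [St.set_tm] at t1 t2 t3 t5
    have e1 : (e + 1 + 1) * (2 * h * 160 + 20) = 320 * ((e + 2) * h) + 20 * (e + 2) := by ring
    have e2 : (e + 2) ≤ (e + 2) * h := Nat.le_mul_of_pos_right _ hhpos
    have e3 : 2 * h ≤ (e + 2) * h := Nat.mul_le_mul_right _ (by omega)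
    rw [e1] at t2 t3 t5
    omega

end WordRAM

/-! ### Lowest bits and the block decomposition behind online convolution -/

namespace WordRAM

/-- The exponent of the lowest bit of a number. -/
def lb (x : ℕ) : ℕ := padicValNat 2 x

theorem two_pow_dvd_iff {x : ℕ} (hx : x ≠ 0) (k : ℕ) : 2 ^ k ∣ x ↔ k ≤ lb x := by
  have : Fact (Nat.Prime 2) := ⟨Nat.prime_two⟩
  exact padicValNat_dvd_iff_le hx

theorem two_pow_lb_le {x : ℕ} (hx : x ≠ 0) : 2 ^ lb x ≤ x :=
  Nat.le_of_dvd (Nat.pos_of_ne_zero hx) ((two_pow_dvd_iff hx _).2 le_rfl)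

/-- The blocks `[y - 2 ^ lb y, y)` with `y ≤ x < y + 2 ^ lb y` cover `[0, x)` exactly. -/
theorem sum_blocks {R : Type*} [AddCommMonoid R] (φ : ℕ → R) (x : ℕ) :
    ∑ y ∈ (Finset.range (x + 1)).filter (fun y => 1 ≤ y ∧ x < y + 2 ^ lb y),
      ∑ a ∈ Finset.Ico (y - 2 ^ lb y) y, φ a = ∑ a ∈ Finset.range x, φ a := by
  induction x using Nat.strong_induction_on with
  | _ x ih =>
    rcases Nat.eq_zero_or_pos x with rfl | hx
    · rw [Finset.range_zero, Finset.sum_empty]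
      refine Finset.sum_eq_zero fun y hy => ?_
      simp only [Finset.mem_filter, Finset.mem_range] at hy
      omega
    · have hx0 : x ≠ 0 := by omega
      have hle := two_pow_lb_le hx0
      have hpos : 0 < 2 ^ lb x := by positivity
      -- The admissible `y` are the numbers obtained from `x` by repeatedly clearing the lowest bit:
      -- `x` itself, and those belonging to `x - 2 ^ lb x`. The blocks are then consecutive
      -- intervals.
      have hset : (Finset.range (x + 1)).filter (fun y => 1 ≤ y ∧ x < y + 2 ^ lb y) =
          insert x ((Finset.range (x - 2 ^ lb x + 1)).filter
            (fun y => 1 ≤ y ∧ x - 2 ^ lb x < y + 2 ^ lb y)) := by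
        have hdvd : 2 ^ (lb x + 1) ∣ x - 2 ^ lb x := by
          obtain ⟨u, hu⟩ := (two_pow_dvd_iff hx0 (lb x)).2 le_rfl
          have h2 : ¬ 2 ^ (lb x + 1) ∣ x := by rw [two_pow_dvd_iff hx0]; omega
          have hodd : u % 2 = 1 := by
            by_contra h
            apply h2
            obtain ⟨v, rfl⟩ : 2 ∣ u := by omega
            exact ⟨v, by rw [pow_succ, mul_assoc]; exact hu⟩
          have hu' : u = 2 * (u / 2) + 1 := by omega
          have h3 : x = 2 ^ lb x * (2 * (u / 2) + 1) := by rw [← hu']; exact hu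
          exact ⟨u / 2, Nat.sub_eq_of_eq_add (h3.trans (by ring))⟩
        ext y
        simp only [Finset.mem_filter, Finset.mem_range, Finset.mem_insert]
        constructor
        · rintro ⟨h1, h2, h3⟩
          rcases eq_or_ne y x with rfl | hyx
          · exact Or.inl rfl
          · right
            have hy0 : y ≠ 0 := by omega
            -- `x - y` is a positive number below `2 ^ lb y`
            have h4 : lb x < lb y := by
              by_contra h
              have h5 : 2 ^ lb y ∣ x := (two_pow_dvd_iff hx0 _).2 (by omega)
              have h6 : 2 ^ lb y ∣ x - y := Nat.dvd_sub h5 ((two_pow_dvd_iff hy0 _).2 le_rfl)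
              have := Nat.le_of_dvd (by omega) h6
              omega
            have h5 : 2 ^ lb x ∣ x - y := Nat.dvd_sub ((two_pow_dvd_iff hx0 _).2 le_rfl)
              ((two_pow_dvd_iff hy0 _).2 h4.le)
            have := Nat.le_of_dvd (by omega) h5
            exact ⟨by omega, by omega, by omega⟩
        · rintro (rfl | ⟨h1, h2, h3⟩)
          · exact ⟨by omega, by omega, by omega⟩
          · have hy0 : y ≠ 0 := by omega
            have h4 : lb x < lb y := by
              by_contra h
              have h5 : 2 ^ (lb y + 1) ∣ x - 2 ^ lb x :=
                (pow_dvd_pow 2 (by omega)).trans hdvd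
              obtain ⟨u, hu⟩ := (two_pow_dvd_iff hy0 (lb y)).2 le_rfl
              have h6 : 2 ^ lb y ∣ x - 2 ^ lb x - y := Nat.dvd_sub
                ((pow_dvd_pow 2 (by omega)).trans h5) ((two_pow_dvd_iff hy0 _).2 le_rfl)
              have h7 : x - 2 ^ lb x - y = 0 := Nat.eq_zero_of_dvd_of_lt h6 (by omega)
              have h8 : x - 2 ^ lb x = y := by omega
              rw [h8, two_pow_dvd_iff hy0] at h5
              omega
            obtain ⟨u, hu⟩ : 2 ^ (lb x + 1) ∣ y := (two_pow_dvd_iff hy0 _).2 h4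
            obtain ⟨v, hv⟩ := hdvd
            obtain ⟨z, hz⟩ : 2 ^ (lb x + 1) ∣ 2 ^ lb y := pow_dvd_pow 2 h4
            have h9 : v < u + z := by
              refine lt_of_mul_lt_mul_left (a := 2 ^ (lb x + 1)) ?_ (Nat.zero_le _)
              rw [mul_add, ← hv, ← hu, ← hz]
              exact h3
            have h10 : 2 ^ (lb x + 1) * (v + 1) ≤ 2 ^ (lb x + 1) * (u + z) :=
              Nat.mul_le_mul_left _ h9
            rw [mul_add, mul_add, ← hv, ← hu, ← hz, mul_one, pow_succ] at h10
            exact ⟨by omega, h2, by omega⟩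
      rw [hset, Finset.sum_insert, ih _ (by omega), add_comm, Finset.range_eq_Ico,
        Finset.range_eq_Ico, Finset.sum_Ico_consecutive _ (Nat.zero_le _) (Nat.sub_le _ _)]
      simp only [Finset.mem_filter, Finset.mem_range]
      omega

/-- Find the lowest bit of register `30`. -/
def lowbit : Stm :=
  .asg 31 (.c 1) ;; .asg 32 (.v 30 %ₑ .c 2) ;; .asg 33 (.c 1) ;;
  .whl 32 33 (.asg 31 (.c 2 *ₑ .v 31) ;; .asg 32 (.v 30 %ₑ (.c 2 *ₑ .v 31)))

/-- The remainder modulo `2 ^ (i + 1)` is zero exactly while `i < lb x`; comparing it with the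
constant `1` in register `33` tests for zero. -/
theorem wp_lowbit {w x : ℕ} {s : St} (h30 : s.reg 30 = x) (hx : 1 ≤ x) (hw : 4 * x < 2 ^ w) :
    lowbit.wp w (fun s' => Fr 31 0 0 s s' ∧ s'.reg 31 = 2 ^ lb x ∧
      s'.tm ≤ s.tm + 20 * lb x + 20) s := by
  have hx0 : x ≠ 0 := by omega
  simp only [lowbit, Stm.wp, Ex.Ok, Ex.val, Ex.cost, St.set_reg, reduceIte, Nat.reduceEqDiff, h30,
    true_and]
  refine ⟨by omega, by omega, by omega, ?_⟩
  refine ⟨fun i s' => Fr 31 0 0 s s' ∧ s'.reg 31 = 2 ^ i ∧ s'.reg 32 = x % 2 ^ (i + 1) ∧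
    s'.reg 33 = 1 ∧ s'.tm ≤ s.tm + 20 * i + 15, lb x, ?_, ?_, ?_⟩
  · refine ⟨(((Fr.refl s).set (by norm_num)).set (by norm_num)).set (by norm_num), ?_, ?_, ?_, ?_⟩ <;>
    simp
  · rintro i hi s' ⟨hf, e31, e32, e33, htm⟩
    have h1 : 2 ^ (i + 1) ∣ x := (two_pow_dvd_iff hx0 _).2 hi
    have h2 : x % 2 ^ (i + 1) = 0 := Nat.mod_eq_zero_of_dvd h1
    have h3 := Nat.le_of_dvd hx h1
    have e30 : s'.reg 30 = x := by rw [hf.reg 30 (by norm_num), h30]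
    have h4 : 2 ^ (i + 1) = 2 * 2 ^ i := pow_succ' _ _
    have h5 : 2 ^ (i + 1 + 1) = 2 * (2 * 2 ^ i) := by ring
    refine ⟨by omega, ?_⟩
    simp only [St.tick_reg, St.set_reg, reduceIte, Nat.reduceEqDiff, e31, e30, e33, true_and]
    refine ⟨⟨by omega, by omega⟩, ⟨by omega, by omega⟩, ?_, ?_, ?_, ?_⟩
    · exact (hf.tick.set (by norm_num)).set (by norm_num)
    · rw [h4]
    · rw [h5]
    · simp only [St.set_tm, St.tick_tm]; omega
  · rintro s' ⟨hf, e31, e32, e33, htm⟩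
    have h1 : ¬ 2 ^ (lb x + 1) ∣ x := by rw [two_pow_dvd_iff hx0]; omega
    have h2 : x % 2 ^ (lb x + 1) ≠ 0 := fun h => h1 (Nat.dvd_of_mod_eq_zero h)
    refine ⟨by omega, hf.tick, e31, ?_⟩
    simp only [St.tick_tm]; omega

end WordRAM

/-! ### Online convolution -/

namespace WordRAM

/-- Truncating `G` to length `2 * h` loses nothing: for `a` in the block and `i < x + h`, the
difference `i - a` is below `2 * h`. -/
theorem cast_cauchy_cut {p x h i : ℕ} {F G : ℕ → ℕ} {c g : ℕ → ZMod p} (hhx : h ≤ x) (hxi : x ≤ i)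
    (hi : i < x + h) (hF : ∀ a < x, (F a : ZMod p) = c a) (hG : ∀ j ≤ i, (G j : ZMod p) = g j) :
    ((cauchy (cut h (fun i => F (x - h + i))) (cut (2 * h) G) (h + (i - x)) : ℕ) : ZMod p) =
      ∑ a ∈ Finset.Ico (x - h) x, c a * g (i - a) := by
  rw [cauchy, Finset.sum_Ico_eq_sum_range, show x - (x - h) = h by omega, Nat.cast_sum]
  symm
  refine Finset.sum_subset_zero_on_sdiff (Finset.range_mono (by omega)) ?_ ?_
  · intro k hk
    simp only [Finset.mem_sdiff, Finset.mem_range] at hk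
    rw [cut, if_neg hk.2, zero_mul, Nat.cast_zero]
  · intro k hk
    have hk := Finset.mem_range.1 hk
    rw [cut, cut, if_pos hk, if_pos (by omega), Nat.cast_mul, hF _ (by omega), hG _ (by omega)]
    congr 2
    omega

/-- One step of the online convolution. -/
def fstep : Stm :=
  lowbit ;; conv ;; .sto (.v 12 +ₑ .v 30)
    ((.ld (.v 11 +ₑ .v 30) *ₑ .ld (.v 7 +ₑ .v 30)) %ₑ .v 19)

/-- Solve `x * f x = ∑ a < x, f a * g (x - a)` modulo the prime. -/
def floop : Stm := .asg 30 (.c 1) ;; .upto 30 20 fstep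

/-- Before step `x`, accumulator cell `i ≥ x` holds the contributions of the blocks ending at those
`y < x` whose window `[y, y + 2 ^ lb y)` contains `i`. Each block is multiplied as soon as all its
values are known, so only values already computed are used. -/
theorem wp_floop {w n t ν p : ℕ} {s : St} {G : ℕ → ℕ} {c g : ℕ → ZMod p} (hp : Par w n t ν p)
    (he : Env w n t ν p s)
    (hG : ∀ i < 2 * t + 2, s.mem (n + 96 * (t + 1) + i) = G i ∧ G i < p)
    (hGg : ∀ i ≤ t, (G i : ZMod p) = g i)
    (hAc : ∀ i < 2 * t + 2, s.mem (n + 128 * (t + 1) + i) = 0)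
    (hf0 : s.mem (n + 112 * (t + 1)) = 1) (hc0 : c 0 = 1)
    (hc : ∀ x, 1 ≤ x → x ≤ t → (x : ZMod p) * c x = ∑ a ∈ Finset.range x, c a * g (x - a)) :
    floop.wp w (fun s' => Fr 30 (n + 112 * (t + 1)) (n + 176 * (t + 1)) s s' ∧
      s'.tm ≤ s.tm + 10 + ∑ y ∈ Finset.Ico 1 (t + 1), 2100 * ((lb y + 2) * 2 ^ lb y) ∧
      ∀ i ≤ t, s'.mem (n + 112 * (t + 1) + i) < p ∧
        (s'.mem (n + 112 * (t + 1) + i) : ZMod p) = c i) s := by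
  have hM := hp.hM
  have hpt := hp.pt
  have hpp := hp.prime.one_lt
  have htp := hp.tp
  simp only [floop, Stm.wp, Ex.Ok, Ex.val, Ex.cost]
  refine ⟨by omega, ?_⟩
  refine Stm.wp_upto (lo := 1) (hi := t + 1) (fun x s' =>
      Fr 30 (n + 112 * (t + 1)) (n + 176 * (t + 1)) s s' ∧
      s'.tm ≤ s.tm + 5 + ∑ y ∈ Finset.Ico 1 x, 2100 * ((lb y + 2) * 2 ^ lb y) ∧
      (∀ i < x, s'.mem (n + 112 * (t + 1) + i) < p ∧
        (s'.mem (n + 112 * (t + 1) + i) : ZMod p) = c i) ∧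
      (∀ i < 2 * t + 2, s'.mem (n + 128 * (t + 1) + i) < p) ∧
      ∀ i, x ≤ i → i ≤ t → (s'.mem (n + 128 * (t + 1) + i) : ZMod p) =
        ∑ y ∈ (Finset.range x).filter (fun y => 1 ≤ y ∧ i < y + 2 ^ lb y),
          ∑ a ∈ Finset.Ico (y - 2 ^ lb y) y, c a * g (i - a))
    (by omega) (by omega) (by simp) (by simpa using he.r20)
    ⟨(Fr.refl s).set le_rfl, by simp, ?_, ?_, ?_⟩ ?_ (by norm_num) ?_
  · intro i hi
    obtain rfl : i = 0 := by omega
    simp only [St.set_mem, add_zero, hf0, hc0, Nat.cast_one, and_true]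
    exact hpp
  · intro i hi
    simp only [St.set_mem, hAc i hi]
    omega
  · intro i hi hit
    simp only [St.set_mem, hAc i (by omega), Nat.cast_zero]
    symm
    refine Finset.sum_eq_zero fun y hy => ?_
    simp only [Finset.mem_filter, Finset.mem_range] at hy
    omega
  · rintro x s1 hx1 hxt e30 e20 ⟨hf, ht, hF, hA, hAg⟩
    have hx0 : x ≠ 0 := by omega
    have hlb := two_pow_lb_le hx0
    have hlbpos : 0 < 2 ^ lb x := by positivity
    refine Stm.wp_seq _ (wp_lowbit (x := x) (by simpa using e30) hx1 (by omega)) ?_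
    rintro s2 ⟨f2, e31, ht2⟩
    have f2' : Fr 30 (n + 112 * (t + 1)) (n + 176 * (t + 1)) s s2 :=
      (hf.tick (k := 1)).trans ⟨fun r hr => f2.reg r (by omega), fun a _ => f2.mem a (by omega),
        f2.coins⟩
    have he2 := he.congr hp (f2'.mono le_rfl (by omega) (by omega))
    have m2 : ∀ a, s2.mem a = s1.mem a := fun a => f2.mem a (by omega)
    refine Stm.wp_seq _ (wp_conv hp he2 (x := x) (e := lb x)
      (F := fun i => s1.mem (n + 112 * (t + 1) + i)) (G := G)
      (Ac := fun i => s1.mem (n + 128 * (t + 1) + i)) ?_ e31 hlb (by omega) ?_ ?_ ?_) ?_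
    · rw [f2.reg 30 (by norm_num)]; exact e30
    · exact fun i hi => ⟨m2 _, (hF i hi).1⟩
    · intro i hi
      rw [f2'.mem _ (by omega)]
      exact hG i hi
    · exact fun i hi => ⟨m2 _, hA i hi⟩
    rintro s3 ⟨f3, ht3, hA3⟩
    have f3' : Fr 30 (n + 112 * (t + 1)) (n + 176 * (t + 1)) s s3 :=
      f2'.trans (f3.mono (by norm_num) (by omega) (by omega))
    have he3 := he.congr hp (f3'.mono le_rfl (by omega) (by omega))
    have e30' : s3.reg 30 = x := by rw [f3.reg 30 (by norm_num), f2.reg 30 (by norm_num)]; exact e30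
    have hA3p : ∀ i < 2 * t + 2, s3.mem (n + 128 * (t + 1) + i) < p := by
      intro i hi
      rw [hA3 i hi]
      split_ifs
      · exact Nat.mod_lt _ (by omega)
      · exact hA i hi
    have hA3g : ∀ i, x ≤ i → i ≤ t → (s3.mem (n + 128 * (t + 1) + i) : ZMod p) =
        ∑ y ∈ (Finset.range (x + 1)).filter (fun y => 1 ≤ y ∧ i < y + 2 ^ lb y),
          ∑ a ∈ Finset.Ico (y - 2 ^ lb y) y, c a * g (i - a) := by
      intro i hxi hit
      rw [hA3 i (by omega), Finset.range_add_one, Finset.filter_insert]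
      by_cases hi : i < x + 2 ^ lb x
      · rw [if_pos ⟨hxi, hi⟩, if_pos ⟨hx1, hi⟩, Finset.sum_insert (by simp), ZMod.natCast_mod,
          Nat.cast_add, hAg i hxi hit, cast_cauchy_cut hlb hxi hi (fun a ha => (hF a ha).2)
          (fun j hj => hGg j (by omega)), add_comm]
      · rw [if_neg (by tauto), if_neg (by tauto), hAg i hxi hit]
    obtain ⟨hinv, hinv1⟩ := he3.inv x hx1 (by omega)
    have hmul : s3.mem (n + 128 * (t + 1) + x) * s3.mem (n + 48 * (t + 1) + x) < 2 ^ w := by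
      have h1 : s3.mem (n + 128 * (t + 1) + x) ≤ 2 ^ (64 * ν) := by
        have h2 := hA3p x (by omega)
        have h3 : 2 * 2 ^ ν ≤ 2 ^ (64 * ν) := by
          rw [← pow_succ']
          exact Nat.pow_le_pow_right (by norm_num) (by have := hp.hν; omega)
        have := hp.hi
        omega
      have h1' : s3.mem (n + 48 * (t + 1) + x) ≤ 2 ^ (64 * ν) := by
        have h3 : 2 * 2 ^ ν ≤ 2 ^ (64 * ν) := by
          rw [← pow_succ']
          exact Nat.pow_le_pow_right (by norm_num) (by have := hp.hν; omega)
        have := hp.hi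
        omega
      have h4 := Nat.mul_le_mul h1 h1'
      have h5 : 1 ≤ 2 ^ (64 * ν) := Nat.one_le_two_pow
      have h6 := hp.hw
      nlinarith
    simp only [Stm.wp, Ex.Ok, Ex.val, Ex.cost, e30', he3.r12, he3.r11, he3.r7, he3.r19, true_and,
      and_true, St.put_reg]
    refine ⟨by omega, ⟨by omega, by omega, hmul⟩, ?_, ?_, ?_, ?_, ?_, ?_⟩
    · rw [he3.r20]
    · exact (f3'.put (by omega) (by omega)).set le_rfl
    · rw [Finset.sum_Ico_succ_top hx1]
      simp only [St.set_tm, St.put_tm, St.tick_tm] at ht2 ht3 ⊢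
      have h1 : lb x < 2 ^ lb x := Nat.lt_two_pow_self
      have h2 : (lb x + 2) * 2 ^ lb x = lb x * 2 ^ lb x + 2 * 2 ^ lb x := by ring
      omega
    · intro i hi
      simp only [St.set_mem, St.put_mem]
      rcases eq_or_ne i x with rfl | hix
      · rw [if_pos rfl]
        refine ⟨Nat.mod_lt _ (by omega), ?_⟩
        have := Fact.mk hp.prime
        have hiz : (i : ZMod p) ≠ 0 := by
          rw [Ne, ZMod.natCast_eq_zero_iff]
          exact fun h => absurd (Nat.le_of_dvd hx1 h) (by omega)
        apply mul_left_cancel₀ hiz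
        have hi1 : (i : ZMod p) * (s3.mem (n + 48 * (t + 1) + i) : ZMod p) = 1 := by
          have := congrArg (Nat.cast (R := ZMod p)) hinv1
          rwa [ZMod.natCast_mod, Nat.cast_mul, Nat.cast_one] at this
        -- After the block of `x` itself has been added, the windows containing `x` are those of
        -- `sum_blocks`: the accumulator is the full right side of the recursion, and the inverse of
        -- `x` finishes it.
        rw [ZMod.natCast_mod, Nat.cast_mul, hA3g i le_rfl (by omega), sum_blocks, hc i hx1 (by omega),
          mul_left_comm, hi1, mul_one]
      · rw [if_neg (by omega), f3.mem _ (by omega), m2]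
        exact hF i (by omega)
    · intro i hi
      simp only [St.set_mem, St.put_mem]
      rw [if_neg (by omega)]
      exact hA3p i hi
    · intro i hxi hit
      simp only [St.set_mem, St.put_mem]
      rw [if_neg (by omega)]
      exact hA3g i (by omega) hit
  · rintro s1 - - ⟨hf, ht, hF, -⟩
    refine ⟨hf.tick, ?_, fun i hi => hF i (by omega)⟩
    simp only [St.tick_tm]; omega

end WordRAM

/-! ### The weighted generating function and its logarithmic derivative -/

namespace WordRAM

section Series
open PowerSeries
variable {R : Type*} [CommRing R]

/-- The generating function of weighted subset sums. -/
noncomputable def sumSeries (its : ℕ → ℕ) (m : ℕ) (r : ℕ → R) : PowerSeries R :=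
  ∏ i ∈ Finset.range m, (1 + C (r i) * X ^ its i)

theorem coeff_sumSeries (its : ℕ → ℕ) (m : ℕ) (r : ℕ → R) (x : ℕ) :
    coeff x (sumSeries its m r) =
      ∑ I ∈ (Finset.range m).powerset.filter (fun I => ∑ i ∈ I, its i = x), ∏ i ∈ I, r i := by
  rw [sumSeries, Finset.prod_one_add, map_sum, Finset.sum_filter]
  refine Finset.sum_congr rfl fun I _ => ?_
  rw [Finset.prod_mul_distrib, Finset.prod_pow_eq_pow_sum, ← map_prod, coeff_C_mul, coeff_X_pow]
  simp only [eq_comm, mul_ite, mul_one, mul_zero]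

/-- A coefficient of `s * r * X ^ s / (1 + r * X ^ s)`. -/
def logTerm (s : ℕ) (r : R) (x : ℕ) : R :=
  if x ≠ 0 ∧ s ∣ x then s * (-1) ^ (x / s - 1) * r ^ (x / s) else 0

/-- This is the geometric series of `s * r * X ^ s / (1 + r * X ^ s)`, with the denominator
multiplied out: from the second multiple of `s` on, consecutive terms cancel. -/
theorem mk_logTerm_mul {s : ℕ} (hs : 1 ≤ s) (r : R) :
    mk (logTerm s r) * (1 + C r * X ^ s) = C (s * r) * X ^ s := by
  ext n
  rw [mul_add, mul_one, map_add, coeff_mk, ← mul_assoc, mul_comm _ (C r), mul_assoc, coeff_C_mul,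
    coeff_mul_X_pow', coeff_C_mul, coeff_X_pow]
  simp only [coeff_mk, logTerm]
  by_cases hn : s ∣ n
  · obtain ⟨k, rfl⟩ := hn
    rcases k with - | k
    · simp; omega
    · rw [if_pos ⟨by positivity, dvd_mul_right _ _⟩, if_pos (by nlinarith),
        show s * (k + 1) - s = s * k by rw [mul_add, mul_one, Nat.add_sub_cancel],
        Nat.mul_div_cancel_left _ (by omega), Nat.mul_div_cancel_left _ (by omega)]
      rcases k with - | k
      · simp
      · rw [if_pos ⟨by positivity, dvd_mul_right _ _⟩, if_neg (by
          intro h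
          have : 0 < s * (k + 1) := by positivity
          rw [mul_add, mul_one] at h
          omega)]
        simp only [Nat.add_sub_cancel]
        ring
  · have h1 : n ≠ s := fun h => hn (by rw [h])
    rw [if_neg (by tauto), if_neg h1, mul_zero, zero_add]
    split_ifs with h2 h3
    · exact absurd ((Nat.dvd_sub_iff_left h2 dvd_rfl).1 h3.2) hn
    · rw [mul_zero]
    · rw [mul_zero]

/-- The logarithmic derivative of a product is the sum of those of its factors; multiplying through
by the product avoids division, so any commutative ring will do. -/
theorem X_mul_derivative_sumSeries {its : ℕ → ℕ} {m : ℕ} (h : ∀ i < m, 1 ≤ its i) (r : ℕ → R) :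
    X * d⁄dX R (sumSeries its m r) =
      mk (fun x => ∑ i ∈ Finset.range m, logTerm (its i) (r i) x) * sumSeries its m r := by
  induction m with
  | zero => ext; simp [sumSeries]
  | succ m ih =>
    have h1 : X * d⁄dX R (1 + C (r m) * X ^ its m) =
        mk (logTerm (its m) (r m)) * (1 + C (r m) * X ^ its m) := by
      rw [mk_logTerm_mul (h m (by omega))]
      obtain ⟨k, hk⟩ : ∃ k, its m = k + 1 := ⟨its m - 1, by have := h m (by omega); omega⟩
      simp only [map_add, Derivation.leibniz, Derivation.leibniz_pow, hk, map_mul]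
      simp
      ring
    have h2 : mk (fun x => ∑ i ∈ Finset.range (m + 1), logTerm (its i) (r i) x) =
        mk (fun x => ∑ i ∈ Finset.range m, logTerm (its i) (r i) x) +
          mk (logTerm (its m) (r m)) := by
      ext x
      simp [Finset.sum_range_succ]
    have ih := ih (fun i hi => h i (by omega))
    rw [h2, sumSeries, Finset.prod_range_succ, ← sumSeries, Derivation.leibniz, smul_eq_mul,
      smul_eq_mul]
    linear_combination (1 + C (r m) * X ^ its m) * ih + sumSeries its m r * h1

/-- Comparison of coefficients. The logarithmic derivative has no constant term, so the coefficient
at `x` itself drops out of the right side and the identity is a recursion. -/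
theorem natCast_mul_coeff_sumSeries {its : ℕ → ℕ} {m : ℕ} (h : ∀ i < m, 1 ≤ its i) (r : ℕ → R)
    {x : ℕ} (hx : 1 ≤ x) : (x : R) * coeff x (sumSeries its m r) =
      ∑ a ∈ Finset.range x, coeff a (sumSeries its m r) *
        ∑ i ∈ Finset.range m, logTerm (its i) (r i) (x - a) := by
  have h1 := congrArg (coeff x) (X_mul_derivative_sumSeries h r)
  obtain ⟨x, rfl⟩ : ∃ k, x = k + 1 := ⟨x - 1, by omega⟩
  rw [coeff_succ_X_mul, coeff_derivative, mul_comm _ (sumSeries its m r), coeff_mul,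
    Finset.Nat.sum_antidiagonal_eq_sum_range_succ
      (fun a b => coeff a (sumSeries its m r) * coeff b (mk _)), Finset.sum_range_succ] at h1
  simp only [coeff_mk, Nat.sub_self] at h1
  rw [show ∑ i ∈ Finset.range m, logTerm (its i) (r i) 0 = 0 from
    Finset.sum_eq_zero fun i _ => by simp [logTerm], mul_zero, add_zero] at h1
  rw [← h1]
  push_cast
  ring

theorem coeff_zero_sumSeries {its : ℕ → ℕ} {m : ℕ} (h : ∀ i < m, 1 ≤ its i) (r : ℕ → R) :
    coeff 0 (sumSeries its m r) = 1 := by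
  rw [sumSeries, coeff_zero_eq_constantCoeff, map_prod]
  refine Finset.prod_eq_one fun i hi => ?_
  have := h i (Finset.mem_range.1 hi)
  simp [show its i ≠ 0 by omega]

end Series
end WordRAM

/-! ### One randomized trial -/

namespace WordRAM

/-- The number that is written by `k` bits, the first one being the most significant. -/
def bits (ω : ℕ → Bool) : ℕ → ℕ
  | 0 => 0
  | k + 1 => 2 * bits ω k + (ω k).toNat

theorem bits_lt (ω : ℕ → Bool) (k : ℕ) : bits ω k < 2 ^ k := by
  induction k with
  | zero => simp [bits]
  | succ k ih =>
    rw [bits, pow_succ]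
    have := Bool.toNat_le (ω k)
    omega

/-- The random weight of the item `i`, from `κ` coin tosses. -/
def weight (κ : ℕ) (ω : ℕ → Bool) (i : ℕ) : ℕ := bits (fun k => ω (i * κ + k)) κ

/-- Toss coins for the random weights. -/
def rloop : Stm := .asg 30 (.c 0) ;; .upto 30 5 (
  .asg 33 (.c 0) ;; .asg 34 (.c 0) ;;
  .upto 34 15 (.flip 35 ;; .asg 33 (.c 2 *ₑ .v 33 +ₑ .v 35)) ;;
  .sto (.v 9 +ₑ .v 30) (.v 33))

/-- The coins left over are stated exactly: `m * (ν - 1)` of them are used, a separate group for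
each item. This is what makes the weights independent, and the successive trials as well. -/
theorem wp_rloop {w n t ν p m : ℕ} {s : St} (hp : Par w n t ν p) (he : Env w n t ν p s)
    (h5 : s.reg 5 = m) (hm : m ≤ 2 * t) :
    rloop.wp w (fun s' => (∀ r < 30, s'.reg r = s.reg r) ∧
      (∀ a, a < n + 80 * (t + 1) ∨ n + 96 * (t + 1) ≤ a → s'.mem a = s.mem a) ∧
      (s'.coins = fun k => s.coins (m * (ν - 1) + k)) ∧
      s'.tm ≤ s.tm + 10 + m * (30 * ν + 30) ∧
      ∀ i < m, s'.mem (n + 80 * (t + 1) + i) = weight (ν - 1) s.coins i) s := by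
  have hM := hp.hM
  have hνw : 2 ^ (ν - 1) ≤ t := by
    have := hp.lo
    rw [show ν = (ν - 1) + 1 by have := hp.hν; omega, pow_succ] at this
    omega
  have hνl : ν - 1 < 2 ^ (ν - 1) := Nat.lt_two_pow_self
  simp only [rloop, Stm.wp, Ex.Ok, Ex.val, Ex.cost]
  refine ⟨by omega, ?_⟩
  refine Stm.wp_upto (lo := 0) (hi := m) (fun i s' => (∀ r < 30, s'.reg r = s.reg r) ∧
      (∀ a, a < n + 80 * (t + 1) ∨ n + 96 * (t + 1) ≤ a → s'.mem a = s.mem a) ∧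
      (s'.coins = fun k => s.coins (i * (ν - 1) + k)) ∧
      s'.tm ≤ s.tm + 5 + i * (30 * ν + 30) ∧
      ∀ j < i, s'.mem (n + 80 * (t + 1) + j) = weight (ν - 1) s.coins j)
    (by omega) (Nat.zero_le _) (by simp) (by simpa using h5)
    ⟨fun r hr => by rw [St.set_reg, if_neg (by omega)], by simp, by simp, by simp, by omega⟩ ?_
    (by norm_num) ?_
  · rintro i s1 - hi e30 e5 ⟨hr, hm1, hc, ht, hw⟩
    have he1 := he.of_eq hp (fun r h => hr r (by omega)) (fun a ha => hm1 a (by omega))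
    simp only [Stm.wp, Ex.Ok, Ex.val, Ex.cost]
    refine ⟨by omega, by omega, ?_⟩
    refine Stm.wp_upto (lo := 0) (hi := ν - 1) (fun k s' => (∀ r < 33, s'.reg r = s1.reg r) ∧
        s'.mem = s1.mem ∧ (s'.coins = fun l => s.coins (i * (ν - 1) + k + l)) ∧
        s'.reg 33 = bits (fun k => s.coins (i * (ν - 1) + k)) k ∧
        s'.tm ≤ s1.tm + 10 + k * 20)
      (by omega) (Nat.zero_le _) (by simp) (by simpa using he1.r15)
      ⟨fun r hr => ?_, by simp, by simp [hc], by simp [bits], by simp⟩ ?_ (by norm_num) ?_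
    · simp only [St.set_reg, St.tick_reg]
      rw [if_neg (by omega), if_neg (by omega)]
    · rintro k s2 - hk e34 e15 ⟨hr2, hm2, hc2, hb2, ht2⟩
      have hb := bits_lt (fun k => s.coins (i * (ν - 1) + k)) k
      have hkν : 2 ^ k ≤ 2 ^ (ν - 1) := Nat.pow_le_pow_right (by norm_num) hk.le
      have hbb : ((s2.tick 1).coins 0).toNat = (s.coins (i * (ν - 1) + k)).toNat := by
        simp [hc2]
      have := Bool.toNat_le (s.coins (i * (ν - 1) + k))
      simp only [Stm.wp, Ex.Ok, Ex.val, Ex.cost, St.toss_reg, St.set_reg, St.tick_reg, reduceIte,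
        Nat.reduceEqDiff, hbb, hb2, true_and]
      refine ⟨⟨⟨by omega, by omega⟩, by omega⟩, e34, e15, fun r hr => ?_, hm2, ?_, ?_, ?_⟩
      · rw [if_neg (by omega), if_neg (by omega), if_neg (by omega), hr2 r hr]
      · funext l
        simp only [St.set_coins, St.toss_coins, St.tick_coins, hc2]
        congr 1; ring
      · rw [bits]
      · simp only [St.set_tm, St.toss_tm, St.tick_tm]; omega
    · rintro s2 - - ⟨hr2, hm2, hc2, hb2, ht2⟩
      have e30' : s2.reg 30 = i := by rw [hr2 30 (by norm_num), e30]
      have e9 : s2.reg 9 = n + 80 * (t + 1) := by rw [hr2 9 (by norm_num), he1.r9]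
      have e5' : s2.reg 5 = m := by rw [hr2 5 (by norm_num), e5]
      simp only [St.tick_reg, e30', e9, e5', St.put_reg, true_and, and_true]
      refine ⟨by omega, fun r h => ?_, fun a ha => ?_, ?_, ?_, fun j hj => ?_⟩
      · simp only [St.set_reg, St.put_reg, St.tick_reg]
        rw [if_neg (by omega), hr2 r (by omega), hr r h]
      · simp only [St.set_mem, St.put_mem, St.tick_mem]
        rw [if_neg (by omega), hm2, hm1 a ha]
      · funext k
        simp only [St.set_coins, St.put_coins, St.tick_coins, hc2]
        congr 1; ring
      · simp only [St.set_tm, St.put_tm, St.tick_tm]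
        have : (i + 1) * (30 * ν + 30) = i * (30 * ν + 30) + (30 * ν + 30) := by ring
        omega
      · simp only [St.set_mem, St.put_mem, St.tick_mem]
        rcases eq_or_ne j i with rfl | hji
        · rw [if_pos rfl, hb2, weight]
        · rw [if_neg (by omega), hm2, hw j (by omega)]
  · rintro s1 - - ⟨hr, hm1, hc, ht, hw⟩
    refine ⟨hr, hm1, hc, ?_, hw⟩
    simp only [St.tick_tm]; omega

/-- Clear the tables of the online convolution. -/
def clear : Stm := .asg 30 (.c 0) ;; .upto 30 21 (.sto (.v 10 +ₑ .v 30) (.c 0) ;;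
  .sto (.v 11 +ₑ .v 30) (.c 0)) ;; .sto (.v 12) (.c 1)

theorem wp_clear {w n t ν p : ℕ} {s : St} (hp : Par w n t ν p) (he : Env w n t ν p s) :
    clear.wp w (fun s' => Fr 30 (n + 96 * (t + 1)) (n + 176 * (t + 1)) s s' ∧
      s'.tm ≤ s.tm + 20 + (2 * t + 2) * 30 ∧
      (∀ i < 2 * t + 2, s'.mem (n + 96 * (t + 1) + i) = 0) ∧
      (∀ i < 2 * t + 2, s'.mem (n + 128 * (t + 1) + i) = 0) ∧
      s'.mem (n + 112 * (t + 1)) = 1) s := by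
  have hM := hp.hM
  simp only [clear, Stm.wp, Ex.Ok, Ex.val, Ex.cost]
  refine ⟨by omega, ?_⟩
  refine Stm.wp_upto (lo := 0) (hi := 2 * t + 2) (fun i s' =>
      Fr 30 (n + 96 * (t + 1)) (n + 176 * (t + 1)) s s' ∧
      s'.tm ≤ s.tm + 5 + i * 30 ∧
      (∀ j < i, s'.mem (n + 96 * (t + 1) + j) = 0) ∧
      (∀ j < i, s'.mem (n + 128 * (t + 1) + j) = 0))
    (by omega) (Nat.zero_le _) (by simp) (by simpa using he.r21)
    ⟨(Fr.refl s).set le_rfl, by simp, by omega, by omega⟩ ?_ (by norm_num) ?_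
  · rintro i s1 - hi e30 e21 ⟨hf, ht, hg, hA⟩
    have he1 := he.congr hp (hf.mono le_rfl (by omega) (by omega))
    simp only [Stm.wp, Ex.Ok, Ex.val, Ex.cost, St.tick_reg, St.put_reg, e30, he1.r10, he1.r11,
      true_and, e21]
    refine ⟨by omega, by omega, by omega, by omega, ?_, ?_, ?_, ?_⟩
    · exact ((hf.tick.put (by omega) (by omega)).put (by omega) (by omega)).set le_rfl
    · simp only [St.set_tm, St.put_tm, St.tick_tm]; omega
    · intro j hj
      simp only [St.set_mem, St.put_mem, St.tick_mem]
      rw [if_neg (by omega)]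
      split_ifs
      · rfl
      · exact hg j (by omega)
    · intro j hj
      simp only [St.set_mem, St.put_mem, St.tick_mem]
      split_ifs
      · rfl
      · omega
      · exact hA j (by omega)
  · rintro s1 - - ⟨hf, ht, hg, hA⟩
    have he1 := he.congr hp (hf.mono le_rfl (by omega) (by omega))
    simp only [St.tick_reg, he1.r12, true_and]
    refine ⟨by omega, hf.tick.put (by omega) (by omega), ?_, ?_, ?_, ?_⟩
    · simp only [St.put_tm, St.tick_tm]; omega
    · intro i hi
      simp only [St.put_mem, St.tick_mem]
      rw [if_neg (by omega), hg i hi]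
    · intro i hi
      simp only [St.put_mem, St.tick_mem]
      rw [if_neg (by omega), hA i hi]
    · simp

/-- Add the contribution of the item `30` to the logarithmic derivative. -/
def gitem : Stm :=
  .asg 33 (.ld (.v 4 +ₑ .v 30)) ;; .asg 34 (.ld (.v 9 +ₑ .v 30)) ;;
  .asg 35 ((.v 33 *ₑ .v 34) %ₑ .v 19) ;; .asg 36 (.v 33) ;;
  .whl 36 20 (.sto (.v 10 +ₑ .v 36) ((.ld (.v 10 +ₑ .v 36) +ₑ .v 35) %ₑ .v 19) ;;
    .asg 35 (((.v 19 -ₑ .v 35) *ₑ .v 34) %ₑ .v 19) ;; .asg 36 (.v 36 +ₑ .v 33))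

theorem Par.mul_lt {w n t ν p a b : ℕ} (hp : Par w n t ν p) (ha : a ≤ p) (hb : b ≤ p) :
    a * b < 2 ^ w := by
  have h1 : p ≤ 2 ^ (64 * ν) := by
    have h3 : 2 * 2 ^ ν ≤ 2 ^ (64 * ν) := by
      rw [← pow_succ']
      exact Nat.pow_le_pow_right (by norm_num) (by have := hp.hν; omega)
    have := hp.hi
    have := hp.pt
    omega
  have h4 := Nat.mul_le_mul (ha.trans h1) (hb.trans h1)
  have h5 : 1 ≤ 2 ^ (64 * ν) := Nat.one_le_two_pow
  have h6 := hp.hw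
  nlinarith

/-- Register `35` runs through `a * (-1) ^ j * r ^ (j + 1)`: replacing `v` by `(p - v) * r`
multiplies by `-r`. Only the `t / a` multiples of `a` up to `t` are visited, which is the whole cost
of the item. -/
theorem wp_gitem {w n t ν p i a r : ℕ} {s : St} (hp : Par w n t ν p) (he : Env w n t ν p s)
    (h30 : s.reg 30 = i) (hi : i < 2 * t) (ha : s.mem (n + 16 * (t + 1) + i) = a)
    (hr : s.mem (n + 80 * (t + 1) + i) = r) (ha1 : 1 ≤ a) (hat : a ≤ t) (hrp : r < p)
    (hG : ∀ x < 2 * t + 2, s.mem (n + 96 * (t + 1) + x) < p) :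
    gitem.wp w (fun s' => Fr 31 (n + 96 * (t + 1)) (n + 112 * (t + 1)) s s' ∧
      s'.tm ≤ s.tm + 30 + 30 * (t / a) ∧
      (∀ x < 2 * t + 2, s'.mem (n + 96 * (t + 1) + x) < p) ∧
      (∀ x ≤ t, (s'.mem (n + 96 * (t + 1) + x) : ZMod p) =
        s.mem (n + 96 * (t + 1) + x) + logTerm a (r : ZMod p) x)) s := by
  have hM := hp.hM
  have hpp := hp.prime.one_lt
  have htp := hp.tp
  have hpt := hp.pt
  have hmul : a * r < 2 ^ w := hp.mul_lt (by omega) hrp.le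
  simp only [gitem, Stm.wp, Ex.Ok, Ex.val, Ex.cost, St.set_reg, St.set_mem, reduceIte,
    Nat.reduceEqDiff, he.r4, he.r9, h30, he.r19, ha, hr, true_and, and_true]
  refine ⟨by omega, by omega, hmul, ?_⟩
  refine ⟨fun j s' => Fr 31 (n + 96 * (t + 1)) (n + 112 * (t + 1)) s s' ∧
      s'.reg 33 = a ∧ s'.reg 34 = r ∧ s'.reg 36 = a * (j + 1) ∧ s'.reg 35 < p ∧
      (s'.reg 35 : ZMod p) = a * (-1) ^ j * r ^ (j + 1) ∧
      s'.tm ≤ s.tm + 25 + 30 * j ∧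
      (∀ x < 2 * t + 2, s'.mem (n + 96 * (t + 1) + x) < p) ∧
      (∀ x ≤ t, (s'.mem (n + 96 * (t + 1) + x) : ZMod p) =
        s.mem (n + 96 * (t + 1) + x) + if x < a * (j + 1) then logTerm a (r : ZMod p) x else 0),
    t / a, ?_, ?_, ?_⟩
  · refine ⟨?_, by simp, by simp, by simp, ?_, ?_, by simp, hG, fun x hx => ?_⟩
    · exact (((((Fr.refl s).set (by norm_num)).set (by norm_num)).set (by norm_num)).set
        (by norm_num))
    · simp only [St.set_reg, reduceIte, Nat.reduceEqDiff]
      exact Nat.mod_lt _ (by omega)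
    · simp [ZMod.natCast_mod]
    · simp only [St.set_mem]
      have h0 : (if x < a * (0 + 1) then logTerm a (r : ZMod p) x else 0) = 0 := by
        split_ifs with h
        · rw [logTerm, if_neg]
          rintro ⟨h1, h2⟩
          have := Nat.le_of_dvd (by omega) h2
          omega
        · rfl
      rw [h0, add_zero]
  · rintro j hj s1 ⟨hf, e33, e34, e36, e35, e35c, ht, hg, hgc⟩
    have hjt : a * (j + 1) ≤ t := by
      have := (Nat.le_div_iff_mul_le (by omega)).1 (show j + 1 ≤ t / a by omega)
      rwa [mul_comm] at this
    have he1 : Env w n t ν p s1 := he.of_eq hp (fun r h => hf.reg r (by omega))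
      (fun x hx => hf.mem x (by omega))
    refine ⟨by rw [e36, he1.r20]; omega, ?_⟩
    set v := s1.reg 35 with hv
    set y := a * (j + 1) with hy
    have hmul2 : (p - v) * r < 2 ^ w := hp.mul_lt (by omega) hrp.le
    have hyg := hg y (by omega)
    have hy2 : a * (j + 1 + 1) = y + a := by rw [hy]; ring
    simp only [Stm.wp, Ex.Ok, Ex.val, Ex.cost, St.tick_reg, St.set_reg, St.put_reg, St.tick_mem,
      e33, e34, e36, he1.r10, he1.r19, reduceIte, Nat.reduceEqDiff, true_and, and_true, and_assoc, ← hv, hy2]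
    refine ⟨by omega, by omega, by omega, by omega, by omega, hmul2, by omega, ?_, ?_, ?_, ?_, ?_, ?_⟩
    · exact ((hf.tick.put (by omega) (by omega)).set (by norm_num)).set (by norm_num)
    · exact Nat.mod_lt _ (by omega)
    · rw [ZMod.natCast_mod, Nat.cast_mul, Nat.cast_sub e35.le, e35c, ZMod.natCast_self]
      ring
    · simp only [St.set_tm, St.put_tm, St.tick_tm]; omega
    · intro x hx
      simp only [St.set_mem, St.put_mem, St.tick_mem]
      split_ifs
      · exact Nat.mod_lt _ (by omega)
      · exact hg x hx
    · intro x hx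
      simp only [St.set_mem, St.put_mem, St.tick_mem]
      rcases eq_or_ne x y with rfl | hxy
      · rw [if_pos rfl, if_pos (by omega), ZMod.natCast_mod, Nat.cast_add, hgc _ hx,
          if_neg (by omega), add_zero, e35c, logTerm, if_pos ⟨by positivity, dvd_mul_right _ _⟩,
          hy, Nat.mul_div_cancel_left _ (by omega), Nat.add_sub_cancel]
      · rw [if_neg (by omega), hgc x hx]
        congr 1
        by_cases h1 : x < y
        · rw [if_pos h1, if_pos (by omega)]
        · rw [if_neg h1]
          split_ifs with h2
          · rw [logTerm, if_neg]
            rintro ⟨-, h3⟩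
            have h4 : a ∣ x - y := Nat.dvd_sub h3 (dvd_mul_right _ _)
            have := Nat.le_of_dvd (by omega) h4
            omega
          · rfl
  · rintro s1 ⟨hf, e33, e34, e36, e35, e35c, ht, hg, hgc⟩
    have he1 : Env w n t ν p s1 := he.of_eq hp (fun r h => hf.reg r (by omega))
      (fun x hx => hf.mem x (by omega))
    have hat : t < a * (t / a + 1) := Nat.lt_mul_div_succ t (by omega)
    refine ⟨by rw [e36, he1.r20]; omega, hf.tick, by simp only [St.tick_tm]; omega, hg, fun x hx => ?_⟩
    rw [St.tick_mem, hgc x hx, if_pos (by omega)]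

/-- The logarithmic derivative. -/
def gloop : Stm := .asg 30 (.c 0) ;; .upto 30 5 gitem

theorem wp_gloop {w n t ν p m : ℕ} {s : St} {its r : ℕ → ℕ} (hp : Par w n t ν p)
    (he : Env w n t ν p s) (h5 : s.reg 5 = m) (hm : m ≤ 2 * t)
    (hi : ∀ i < m, s.mem (n + 16 * (t + 1) + i) = its i ∧ 1 ≤ its i ∧ its i ≤ t)
    (hr : ∀ i < m, s.mem (n + 80 * (t + 1) + i) = r i ∧ r i < p)
    (hG : ∀ x < 2 * t + 2, s.mem (n + 96 * (t + 1) + x) = 0) :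
    gloop.wp w (fun s' => Fr 30 (n + 96 * (t + 1)) (n + 112 * (t + 1)) s s' ∧
      s'.tm ≤ s.tm + 10 + ∑ i ∈ Finset.range m, (40 + 30 * (t / its i)) ∧
      (∀ x < 2 * t + 2, s'.mem (n + 96 * (t + 1) + x) < p) ∧
      (∀ x ≤ t, (s'.mem (n + 96 * (t + 1) + x) : ZMod p) =
        ∑ i ∈ Finset.range m, logTerm (its i) (r i : ZMod p) x)) s := by
  have hM := hp.hM
  have hpp := hp.prime.one_lt
  simp only [gloop, Stm.wp, Ex.Ok, Ex.val, Ex.cost]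
  refine ⟨by omega, ?_⟩
  refine Stm.wp_upto (lo := 0) (hi := m) (fun i s' =>
      Fr 30 (n + 96 * (t + 1)) (n + 112 * (t + 1)) s s' ∧
      s'.tm ≤ s.tm + 5 + ∑ i ∈ Finset.range i, (40 + 30 * (t / its i)) ∧
      (∀ x < 2 * t + 2, s'.mem (n + 96 * (t + 1) + x) < p) ∧
      (∀ x ≤ t, (s'.mem (n + 96 * (t + 1) + x) : ZMod p) =
        ∑ i ∈ Finset.range i, logTerm (its i) (r i : ZMod p) x))
    (by omega) (Nat.zero_le _) (by simp) (by simpa using h5)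
    ⟨(Fr.refl s).set le_rfl, by simp, fun x hx => ?_, fun x hx => ?_⟩ ?_ (by norm_num) ?_
  · rw [St.set_mem, hG x hx]; omega
  · rw [St.set_mem, hG x (by omega)]; simp
  · rintro i s1 - him e30 e5 ⟨hf, ht, hg, hgc⟩
    have hf1 := hf.tick (k := 1)
    have he1 : Env w n t ν p (s1.tick 1) := he.of_eq hp (fun r h => hf1.reg r (by omega))
      (fun x hx => hf1.mem x (by omega))
    refine Stm.wp_mono _ ?_ (wp_gitem hp he1 (i := i) (a := its i) (r := r i) e30 (by omega) ?_ ?_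
      (hi i him).2.1 (hi i him).2.2 (hr i him).2 hg)
    · rintro s2 ⟨f2, t2, g2, c2⟩
      refine ⟨by rw [f2.reg 30 (by norm_num)]; exact e30, by rw [f2.reg 5 (by norm_num)]; exact e5,
        (hf1.trans (f2.mono (by norm_num) le_rfl le_rfl)).set le_rfl, ?_, g2, fun x hx => ?_⟩
      · rw [Finset.sum_range_succ]
        simp only [St.set_tm, St.tick_tm] at t2 ⊢
        omega
      · rw [St.set_mem, c2 x hx, Finset.sum_range_succ, St.tick_mem, hgc x hx]
    · rw [hf1.mem _ (by omega), (hi i him).1]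
    · rw [hf1.mem _ (by omega), (hr i him).1]
  · rintro s1 - - ⟨hf, ht, hg, hgc⟩
    refine ⟨hf.tick, by simp only [St.tick_tm]; omega, hg, hgc⟩

/-- One randomized test. -/
def trial : Stm := rloop ;; clear ;; gloop ;; floop ;;
  .ite (.c 0) (.ld (.v 12 +ₑ .v 1)) (.asg 22 (.c 1)) (.asg 22 (.v 22))

/-- A bound for the time of a trial. -/
def trialTime (its : ℕ → ℕ) (t ν m : ℕ) : ℕ :=
  200 + 60 * t + m * (30 * ν + 30) + ∑ i ∈ Finset.range m, (40 + 30 * (t / its i)) +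
    ∑ y ∈ Finset.Ico 1 (t + 1), 2100 * ((lb y + 2) * 2 ^ lb y)

/-- The outcome of a trial. -/
noncomputable def outcome (its : ℕ → ℕ) (t ν m p : ℕ) (ω : ℕ → Bool) : ZMod p :=
  PowerSeries.coeff t (sumSeries its m fun i => (weight (ν - 1) ω i : ZMod p))

-- Register `22` is set if the coefficient is nonzero and kept otherwise, so over several trials it
-- collects their disjunction.
open Classical in
theorem wp_trial {w n t ν p m : ℕ} {s : St} {its : ℕ → ℕ} (hp : Par w n t ν p)
    (he : Env w n t ν p s) (h5 : s.reg 5 = m) (hm : m ≤ 2 * t)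
    (hi : ∀ i < m, s.mem (n + 16 * (t + 1) + i) = its i ∧ 1 ≤ its i ∧ its i ≤ t) :
    trial.wp w (fun s' => (∀ r < 22, s'.reg r = s.reg r) ∧
      s'.reg 22 = (if outcome its t ν m p s.coins ≠ 0 then 1 else s.reg 22) ∧
      (∀ a, a < n + 80 * (t + 1) ∨ n + 176 * (t + 1) ≤ a → s'.mem a = s.mem a) ∧
      (s'.coins = fun k => s.coins (m * (ν - 1) + k)) ∧
      s'.tm ≤ s.tm + trialTime its t ν m) s := by
  have hM := hp.hM
  have hpp := hp.prime.one_lt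
  have hκt : 2 ^ (ν - 1) ≤ t := by
    have := hp.lo
    rw [show ν = (ν - 1) + 1 by have := hp.hν; omega, pow_succ] at this
    omega
  have htp := hp.tp
  have hpt := hp.pt
  set r : ℕ → ℕ := weight (ν - 1) s.coins with hrd
  have hrlt : ∀ i, r i < p := fun i => (bits_lt _ _).trans_le (by omega)
  refine Stm.wp_seq _ (wp_rloop hp he h5 hm) ?_
  rintro s1 ⟨r1, m1, c1, t1, w1⟩
  have he1 := he.of_eq hp (fun r h => r1 r (by omega)) (fun a ha => m1 a (by omega))
  refine Stm.wp_seq _ (wp_clear hp he1) ?_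
  rintro s2 ⟨f2, t2, g2, a2, z2⟩
  have he2 := he1.congr hp (f2.mono le_rfl (by omega) (by omega))
  refine Stm.wp_seq _ (wp_gloop hp he2 (m := m) (its := its) (r := r) ?_ hm ?_ ?_ g2) ?_
  · rw [f2.reg 5 (by norm_num), r1 5 (by norm_num), h5]
  · intro i him
    rw [f2.mem _ (by omega), m1 _ (by omega)]
    exact hi i him
  · intro i him
    rw [f2.mem _ (by omega), w1 i him]
    exact ⟨rfl, hrlt i⟩
  rintro s3 ⟨f3, t3, g3, c3⟩
  have he3 := he2.congr hp (f3.mono le_rfl (by omega) (by omega))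
  refine Stm.wp_seq _ (wp_floop hp he3 (G := fun i => s3.mem (n + 96 * (t + 1) + i))
    (c := fun x => PowerSeries.coeff x (sumSeries its m fun i => (r i : ZMod p)))
    (fun i hi => ⟨rfl, g3 i hi⟩) c3 ?_ ?_ ?_ ?_) ?_
  · intro i hi
    rw [f3.mem _ (by omega), a2 i hi]
  · rw [f3.mem _ (by omega), z2]
  · exact coeff_zero_sumSeries (fun i h => (hi i h).2.1) _
  · exact fun x hx _ => natCast_mul_coeff_sumSeries (fun i h => (hi i h).2.1) _ hx
  rintro s4 ⟨f4, t4, c4⟩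
  have he4 := he3.congr hp (f4.mono le_rfl (by omega) (by omega))
  have hr4 : ∀ r < 30, s4.reg r = s.reg r := fun r h => by
    rw [f4.reg r h, f3.reg r h, f2.reg r h, r1 r h]
  have hm4 : ∀ a, a < n + 80 * (t + 1) ∨ n + 176 * (t + 1) ≤ a → s4.mem a = s.mem a := fun a h => by
    rw [f4.mem a (by omega), f3.mem a (by omega), f2.mem a (by omega), m1 a (by omega)]
  have hc4 : s4.coins = fun k => s.coins (m * (ν - 1) + k) := by
    rw [f4.coins, f3.coins, f2.coins, c1]
  have htm : s4.tm + 20 ≤ s.tm + trialTime its t ν m := by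
    rw [trialTime]; omega
  obtain ⟨h1, h2⟩ := c4 t le_rfl
  -- The stored representative is below `p`, so it is positive exactly if its residue is nonzero.
  have h3 : outcome its t ν m p s.coins ≠ 0 ↔ 0 < s4.mem (n + 112 * (t + 1) + t) := by
    rw [outcome, ← h2, Ne, ZMod.natCast_eq_zero_iff, Nat.pos_iff_ne_zero]
    refine not_congr ⟨fun h => ?_, fun h => h ▸ dvd_zero _⟩
    exact Nat.eq_zero_of_dvd_of_lt h h1
  simp only [Stm.wp, Ex.Ok, Ex.val, Ex.cost, St.tick_reg, St.set_reg, he4.r12, he4.r1, reduceIte,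
    true_and]
  refine ⟨by omega, by omega, fun h => ⟨by omega, ?_, ?_, hm4, hc4, ?_⟩, fun h => ⟨?_, ?_, hm4, hc4, ?_⟩⟩
  · intro r hr
    rw [if_neg (by omega), hr4 r (by omega)]
  · rw [if_pos (h3.2 h)]
  · simp only [St.set_tm, St.tick_tm]; omega
  · intro r hr
    rw [if_neg (by omega), hr4 r (by omega)]
  · rw [if_neg (fun h' => by have := h3.1 h'; omega), hr4 22 (by norm_num)]
  · simp only [St.set_tm, St.tick_tm]; omega

end WordRAM

/-! ### Integer square roots and halving of angles -/

namespace WordRAM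

/-- The integer square root of register `33`, by bisection. -/
def isqrt : Stm := .asg 34 (.c 0) ;; .asg 35 (.v 16) ;;
  .whl 2 35 (.ite (.v 33) ((.v 34 +ₑ .v 35) *ₑ (.v 34 +ₑ .v 35)) (.asg 34 (.v 34))
    (.asg 34 (.v 34 +ₑ .v 35)) ;; .asg 35 (.v 35 /ₑ .c 2))

/-- The root is found bit by bit from `2 ^ k` down: after `i` rounds it lies in an interval of
length `2 ^ (k + 1 - i)` from the current guess. The initial length `2 ^ (k + 1)` suffices since `X
≤ (2 ^ k) ^ 2`. -/
theorem wp_isqrt {w k X : ℕ} {s : St} (h33 : s.reg 33 = X) (h16 : s.reg 16 = 2 ^ k)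
    (h2 : s.reg 2 = 0) (hX : X ≤ (2 ^ k) ^ 2) (hk : 1 ≤ k) (hw : 2 * (2 ^ k) ^ 3 < 2 ^ w) :
    isqrt.wp w (fun s' => Fr 34 0 0 s s' ∧ s'.reg 34 ^ 2 ≤ X ∧ X < (s'.reg 34 + 1) ^ 2 ∧
      s'.tm ≤ s.tm + 10 + 30 * (k + 1)) s := by
  have hS2 : 2 ≤ 2 ^ k := by
    calc 2 = 2 ^ 1 := by norm_num
      _ ≤ 2 ^ k := Nat.pow_le_pow_right (by norm_num) hk
  simp only [isqrt, Stm.wp, Ex.Ok, Ex.val, Ex.cost, St.set_reg, reduceIte, Nat.reduceEqDiff, h16,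
    true_and]
  refine ⟨by omega, ?_⟩
  set S := 2 ^ k with hS
  have hSS : 4 * S ^ 2 ≤ 2 * S ^ 3 := by nlinarith [Nat.zero_le (S ^ 2)]
  have hSle : S ≤ S ^ 2 := Nat.le_self_pow (by norm_num) S
  refine ⟨fun i s' => Fr 34 0 0 s s' ∧ s'.reg 35 = S / 2 ^ i ∧ s'.reg 34 ^ 2 ≤ X ∧
    X < (s'.reg 34 + 2 ^ (k + 1 - i)) ^ 2 ∧ s'.tm ≤ s.tm + 5 + 30 * i, k + 1, ?_, ?_, ?_⟩
  · refine ⟨((Fr.refl s).set le_rfl).set (by norm_num), by simp, by simp, ?_, by simp⟩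
    simp only [St.set_reg, reduceIte, Nat.reduceEqDiff, zero_add, Nat.sub_zero]
    have : 2 ^ (k + 1) = 2 * S := by rw [hS]; ring
    rw [this]
    nlinarith
  · rintro i hi s1 ⟨hf, e35, hr, hr2, ht⟩
    have hdiv : S / 2 ^ i = 2 ^ (k - i) := by
      rw [hS, Nat.pow_div (by omega) (by norm_num)]
    have hle : 2 ^ (k - i) ≤ S := Nat.pow_le_pow_right (by norm_num) (by omega)
    have hpos : 0 < 2 ^ (k - i) := by positivity
    have e2 : s1.reg 2 = 0 := by rw [hf.reg 2 (by norm_num), h2]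
    have e33 : s1.reg 33 = X := by rw [hf.reg 33 (by norm_num), h33]
    have hb2 : 2 ^ (k - i) / 2 = S / 2 ^ (i + 1) := by
      rw [← hdiv, Nat.div_div_eq_div_mul, pow_succ]
    have hk1 : k + 1 - (i + 1) = k - i := by omega
    have hk2 : 2 ^ (k + 1 - i) = 2 ^ (k - i) + 2 ^ (k - i) := by
      rw [show k + 1 - i = (k - i) + 1 by omega]; ring
    rw [hdiv] at e35
    refine ⟨by omega, ?_⟩
    set r := s1.reg 34 with hrdef
    set b := 2 ^ (k - i) with hb
    have hrS : r ≤ S := by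
      exact (Nat.pow_le_pow_iff_left (by norm_num)).1 (hr.trans hX)
    have hlt0 : (r + b) * (r + b) ≤ (2 * S) * (2 * S) := Nat.mul_le_mul (by omega) (by omega)
    have hS4 : (2 * S) * (2 * S) = 4 * S ^ 2 := by ring
    have hlt : (r + b) * (r + b) < 2 ^ w := by omega
    have hlt2 : r + b < 2 ^ w := (Nat.le_mul_self _).trans_lt hlt
    rw [hk2] at hr2
    simp only [Stm.wp, Ex.Ok, Ex.val, Ex.cost, St.set_reg, St.tick_reg, reduceIte,
      Nat.reduceEqDiff, true_and, and_true, and_assoc, e33, e35, ← hrdef, hb2, hk1]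
    refine ⟨hlt2, hlt2, hlt, fun h => ⟨by omega, ?_, hr, ?_, ?_⟩,
      fun h => ⟨by omega, by omega, ?_, ?_, ?_, ?_⟩⟩
    · exact (hf.tick.tick.set (by norm_num)).set (by norm_num)
    · rw [pow_two]; exact h
    · simp only [St.set_tm, St.tick_tm]; omega
    · exact (hf.tick.tick.set (by norm_num)).set (by norm_num)
    · rw [pow_two]; exact h
    · rwa [add_assoc]
    · simp only [St.set_tm, St.tick_tm]; omega
  · rintro s1 ⟨hf, e35, hr, hr2, ht⟩
    have : S / 2 ^ (k + 1) = 0 := Nat.div_eq_of_lt (by rw [hS]; exact Nat.pow_lt_pow_right (by norm_num) (by omega))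
    refine ⟨by omega, hf.tick, hr, ?_, ?_⟩
    · simpa using hr2
    · simp only [St.tick_tm]; omega

theorem abs_sub_sqrt_le {r X : ℕ} (h1 : r ^ 2 ≤ X) (h2 : X < (r + 1) ^ 2) :
    |(r : ℝ) - √X| ≤ 1 := by
  have h3 : (r : ℝ) ≤ √X := Real.le_sqrt_of_sq_le (by exact_mod_cast h1)
  have h4 : √(X : ℝ) ≤ r + 1 := Real.sqrt_le_iff.2 ⟨by positivity, by exact_mod_cast h2.le⟩
  rw [abs_le]
  constructor <;> linarith

/-- Halving the angle in fixed point arithmetic. -/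
theorem half_angle {S C C' D' : ℕ} {θ B : ℝ} (hS : 1 ≤ S) (hC : C ≤ 2 * S) (hθ0 : 0 ≤ θ)
    (hθ : θ ≤ Real.pi / 2) (hCc : |(C : ℝ) - 2 * S * Real.cos θ| ≤ 4)
    (hC1 : C' ^ 2 ≤ (2 * S + C) * S) (hC2 : (2 * S + C) * S < (C' + 1) ^ 2)
    (hD1 : D' ^ 2 ≤ (2 * S - C) * S) (hD2 : (2 * S - C) * S < (D' + 1) ^ 2)
    (hB0 : 0 ≤ B) (hB : 4 * S ≤ B ^ 2) :
    |(C' : ℝ) - 2 * S * Real.cos (θ / 2)| ≤ 4 ∧ |(D' : ℝ) - 2 * S * Real.sin (θ / 2)| ≤ B + 1 := by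
  have hS' : (1 : ℝ) ≤ S := by exact_mod_cast hS
  have e1 := abs_sub_sqrt_le hC1 hC2
  have e2 := abs_sub_sqrt_le hD1 hD2
  have hcos : Real.cos θ = 2 * Real.cos (θ / 2) ^ 2 - 1 := by
    rw [← Real.cos_two_mul]; congr 1; ring
  have hsin : Real.sin (θ / 2) ^ 2 = 1 - Real.cos (θ / 2) ^ 2 := Real.sin_sq _
  have hpi := Real.pi_pos
  have hs0 : 0 ≤ Real.sin (θ / 2) := Real.sin_nonneg_of_nonneg_of_le_pi (by linarith) (by linarith)
  have hc0 : 0.7 ≤ Real.cos (θ / 2) := by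
    have h1 : Real.cos (Real.pi / 4) ≤ Real.cos (θ / 2) :=
      Real.cos_le_cos_of_nonneg_of_le_pi (by linarith) (by linarith) (by linarith)
    rw [Real.cos_pi_div_four] at h1
    have h2 : (1.4 : ℝ) ≤ √2 := Real.le_sqrt_of_sq_le (by norm_num)
    linarith
  set c := Real.cos (θ / 2)
  set z := Real.sin (θ / 2)
  set X : ℝ := (((2 * S + C) * S : ℕ) : ℝ) with hX
  set Y : ℝ := (((2 * S - C) * S : ℕ) : ℝ) with hY
  have hXe : X - (2 * S * c) ^ 2 = S * (C - 2 * S * Real.cos θ) := by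
    rw [hX, hcos]; push_cast; ring
  have hYe : Y - (2 * S * z) ^ 2 = - (S * (C - 2 * S * Real.cos θ)) := by
    rw [hY, hcos, mul_pow, hsin]; push_cast [Nat.cast_sub hC]; ring
  have hX0 : 0 ≤ X := Nat.cast_nonneg _
  have hY0 : 0 ≤ Y := Nat.cast_nonneg _
  have hb : |(S : ℝ) * (C - 2 * S * Real.cos θ)| ≤ 4 * S := by
    rw [abs_mul, abs_of_nonneg (by linarith : (0 : ℝ) ≤ S)]
    nlinarith
  have hsX := Real.sq_sqrt hX0
  have hsY := Real.sq_sqrt hY0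
  have hsX0 := Real.sqrt_nonneg X
  have hsY0 := Real.sqrt_nonneg Y
  set u := √X
  set v := √Y
  constructor
  -- The cosine is at least `0.7` here, so the second factor is at least `1.4 * S` and the first at
  -- most `4 / 1.4 < 3`. With the error `1` of the integer root this is `4` again: the error of the
  -- cosine does not grow under halving.
  · have h1 : |u - 2 * S * c| * (u + 2 * S * c) ≤ 4 * S := by
      rw [← abs_of_nonneg (by positivity : 0 ≤ u + 2 * S * c), ← abs_mul]
      refine le_trans (le_of_eq ?_) hb
      rw [← hXe, ← hsX]; congr 1; ring
    have h2 : |u - 2 * S * c| ≤ 3 := by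
      by_contra h
      push Not at h
      have h3 : 1.4 * S ≤ 2 * S * c := by nlinarith
      have h4 : 3 * (1.4 * S) ≤ |u - 2 * S * c| * (u + 2 * S * c) := by
        gcongr
        linarith
      linarith
    calc |(C' : ℝ) - 2 * S * c| ≤ |(C' : ℝ) - u| + |u - 2 * S * c| := abs_sub_le _ _ _
      _ ≤ 4 := by linarith
  -- The sine may be small, so there is no lower bound for the second factor. It dominates the first
  -- one, and the first is therefore at most the square root of `4 * S`.
  · have h1 : |v - 2 * S * z| * (v + 2 * S * z) ≤ 4 * S := by
      rw [← abs_of_nonneg (by positivity : 0 ≤ v + 2 * S * z), ← abs_mul]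
      refine le_trans (le_of_eq ?_) hb
      rw [← abs_neg (S * (C - 2 * S * Real.cos θ)), ← hYe, ← hsY]; congr 1; ring
    have h2 : |v - 2 * S * z| ≤ B := by
      have h3 : |v - 2 * S * z| ≤ v + 2 * S * z := by
        rw [abs_le]; constructor <;> nlinarith
      have h4 := abs_nonneg (v - 2 * S * z)
      refine abs_le_of_sq_le_sq' ?_ hB0 |>.2
      nlinarith
    calc |(D' : ℝ) - 2 * S * z| ≤ |(D' : ℝ) - v| + |v - 2 * S * z| := abs_sub_le _ _ _
      _ ≤ B + 1 := by linarith

end WordRAM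

/-! ### The table of roots of unity -/

namespace WordRAM

/-- Extend the table of roots of unity by a factor of two. -/
def extend : Stm := .asg 36 (.c 0) ;; .upto 36 32 (
  .asg 37 (.v 8 +ₑ .c 2 *ₑ .v 36) ;; .asg 38 (.v 8 +ₑ .c 2 *ₑ (.v 32 +ₑ .v 36)) ;;
  .asg 39 (.ld (.v 37)) ;; .asg 40 (.ld (.v 37 +ₑ .c 1)) ;;
  .sto (.v 38) (rd (.raw .sub (.raw .mul (.v 39) (.v 28)) (.raw .mul (.v 40) (.v 29)))) ;;
  .sto (.v 38 +ₑ .c 1) (rd (.raw .add (.raw .mul (.v 39) (.v 29)) (.raw .mul (.v 40) (.v 28)))))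

/-- In bit-reversed order the upper half of a table of length `2 ^ (j + 1)` is the lower half times
the single new root `tw (2 ^ j)`; the table is thus built by doubling. -/
theorem tw_add {j b : ℕ} (hb : b < 2 ^ j) : tw (2 ^ j + b) = tw b * tw (2 ^ j) := by
  have h1 := ang_add hb
  have h2 := ang_add (show 0 < 2 ^ j by positivity)
  rw [add_zero, ang_zero, zero_add] at h2
  rw [tw, tw, tw, h1, h2, ← Complex.exp_add]
  congr 1
  push_cast
  ring

/-- Twiddle factors have norm one, so the old error is essentially carried over and the error `δ` of
the new root enters additively. -/
theorem wp_extend {w A S j C D : ℕ} {α δ : ℝ} {s : St} (h8 : s.reg 8 = A) (h32 : s.reg 32 = 2 ^ j)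
    (h16 : s.reg 16 = S) (h17 : s.reg 17 = S ^ 2) (h18 : s.reg 18 = S ^ 3)
    (h28 : s.reg 28 = C) (h29 : s.reg 29 = D) (hA : A + 2 * 2 ^ (j + 1) < 2 ^ w)
    (hS : 5 ≤ S) (hw : 2 * S ^ 3 < 2 ^ w) (hC : C ≤ S) (hD : D ≤ S)
    (hδ : ‖gi C D - S * tw (2 ^ j)‖ ≤ δ) (hα0 : 0 ≤ α) (hαS : α ≤ S) (hδS : δ ≤ S) (hδ2 : 2 ≤ δ)
    (hT : ∀ b < 2 ^ j, Cell w S s.mem (A + 2 * b) (tw b) α) :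
    extend.wp w (fun s' => Fr 36 A (A + 2 * 2 ^ (j + 1)) s s' ∧ s'.tm ≤ s.tm + 10 + 2 ^ j * 100 ∧
      ∀ b < 2 ^ (j + 1), Cell w S s'.mem (A + 2 * b) (tw b) (α + 4 * δ)) s := by
  have h2j : 2 ^ (j + 1) = 2 * 2 ^ j := pow_succ' _ _
  have hpos : 0 < 2 ^ j := by positivity
  have hS3 : S ≤ S ^ 3 := Nat.le_self_pow (by norm_num) S
  have hSr : (5 : ℝ) ≤ S := by exact_mod_cast hS
  simp only [extend, Stm.wp, Ex.Ok, Ex.val, Ex.cost]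
  refine ⟨by positivity, ?_⟩
  refine Stm.wp_upto (lo := 0) (hi := 2 ^ j) (fun i s' => Fr 36 A (A + 2 * 2 ^ (j + 1)) s s' ∧
      s'.tm ≤ s.tm + 5 + i * 100 ∧
      (∀ b < 2 ^ j, Cell w S s'.mem (A + 2 * b) (tw b) α) ∧
      ∀ b < i, Cell w S s'.mem (A + 2 * (2 ^ j + b)) (tw (2 ^ j + b)) (α + 4 * δ))
    (by omega) (Nat.zero_le _) (by simp) (by simpa using h32)
    ⟨(Fr.refl s).set le_rfl, by simp, hT, by omega⟩ ?_ (by norm_num) ?_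
  · rintro i s1 - hi e36 e32 ⟨hf, ht, hT1, hT2⟩
    obtain ⟨x, y, hx, hy, e⟩ := hT1 i hi
    have key := rep_mul_round (w := w) (by omega) hw e hδ (by
      rw [norm_tw, norm_tw]
      have h1 : (S * 1 + α) * (S * 1 + δ) ≤ (2 * S) * (2 * S) := by
        gcongr <;> linarith
      have h2 : (2 * S : ℝ) * (2 * S) < S ^ 3 := by nlinarith [sq_nonneg (S : ℝ)]
      linarith)
    obtain ⟨k1, k2, k3⟩ := key
    rw [norm_tw, norm_tw, ← tw_add hi] at k3
    have k4 : α * (1 + δ / S) + 1 * δ + 2 ≤ α + 4 * δ := by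
      have : α * (δ / S) ≤ δ := by
        rw [mul_div_assoc', div_le_iff₀ (by linarith)]; nlinarith
      linarith
    rw [rep_natCast (show C < 2 ^ w by omega), rep_natCast (show D < 2 ^ w by omega)] at k1 k2
    have e8 : s1.reg 8 = A := by rw [hf.reg 8 (by norm_num), h8]
    have e16 : s1.reg 16 = S := by rw [hf.reg 16 (by norm_num), h16]
    have e17 : s1.reg 17 = S ^ 2 := by rw [hf.reg 17 (by norm_num), h17]
    have e18 : s1.reg 18 = S ^ 3 := by rw [hf.reg 18 (by norm_num), h18]
    have e28 : s1.reg 28 = C := by rw [hf.reg 28 (by norm_num), h28]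
    have e29 : s1.reg 29 = D := by rw [hf.reg 29 (by norm_num), h29]
    simp only [Stm.wp, rd, Ex.Ok, Ex.val, Ex.cost, St.tick_reg, St.set_reg, St.put_reg, St.tick_mem,
      St.set_mem, e8, e32, e36, e28, e29, e16, e17, e18, hx, hy, k1, k2, reduceIte,
      Nat.reduceEqDiff, true_and, and_true, and_assoc]
    repeat refine ⟨by omega, ?_⟩
    refine ⟨?_, ?_, ?_, ?_⟩
    · exact ((((((hf.tick.set (by norm_num)).set (by norm_num)).set (by norm_num)).set
        (by norm_num)).put (by omega) (by omega)).put (by omega) (by omega)).set le_rfl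
    · simp only [St.set_tm, St.put_tm, St.tick_tm]; omega
    · intro b hb
      refine (hT1 b hb).congr ?_ ?_ <;> simp only [St.put_mem, St.set_mem, St.tick_mem] <;>
      rw [if_neg (by omega), if_neg (by omega)]
    · intro b hb
      rcases eq_or_ne b i with rfl | hbi
      · refine ⟨_, _, ?_, ?_, k3.trans k4⟩
        · simp only [St.put_mem, St.set_mem, St.tick_mem]
          rw [if_neg (by omega), if_pos trivial]
        · simp only [St.put_mem, St.set_mem, St.tick_mem]
          rw [if_pos trivial]
      · refine (hT2 b (by omega)).congr ?_ ?_ <;> simp only [St.put_mem, St.set_mem, St.tick_mem] <;>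
        rw [if_neg (by omega), if_neg (by omega)]
  · rintro s1 - - ⟨hf, ht, hT1, hT2⟩
    refine ⟨hf.tick, by simp only [St.tick_tm]; omega, fun b hb => ?_⟩
    by_cases hbj : b < 2 ^ j
    · exact (hT1 b hbj).mono (by linarith)
    · have := hT2 (b - 2 ^ j) (by omega)
      rwa [Nat.add_sub_of_le (by omega)] at this

/-- Fill the table of roots of unity. -/
def roots : Stm := .sto (.v 8) (.v 16) ;; .sto (.v 8 +ₑ .c 1) (.c 0) ;; .asg 28 (.c 0) ;;
  .asg 29 (.v 16) ;; .asg 32 (.c 1) ;; .asg 31 (.v 15 +ₑ .c 1) ;; .asg 30 (.c 0) ;; .upto 30 31 (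
    extend ;; .asg 32 (.c 2 *ₑ .v 32) ;; .asg 33 ((.v 16 -ₑ .v 28) *ₑ (.v 16 /ₑ .c 2)) ;; isqrt ;;
    .asg 29 (.v 34) ;; .asg 33 ((.v 16 +ₑ .v 28) *ₑ (.v 16 /ₑ .c 2)) ;; isqrt ;; .asg 28 (.v 34))

theorem norm_gi_sub_tw_le {S C D j : ℕ} {a b : ℝ}
    (hC : |(C : ℝ) - S * Real.cos (Real.pi / 2 ^ (j + 1))| ≤ a)
    (hD : |(D : ℝ) - S * Real.sin (Real.pi / 2 ^ (j + 1))| ≤ b) :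
    ‖gi C D - S * tw (2 ^ j)‖ ≤ a + b := by
  have h2 := ang_add (show 0 < 2 ^ j by positivity)
  rw [add_zero, ang_zero, zero_add] at h2
  refine (Complex.norm_le_abs_re_add_abs_im _).trans (add_le_add ?_ ?_)
  · refine le_trans (le_of_eq ?_) hC
    rw [tw, h2]
    simp [gi, Complex.exp_ofReal_mul_I_re, -Complex.ofReal_div]
  · refine le_trans (le_of_eq ?_) hD
    rw [tw, h2]
    simp [gi, Complex.exp_ofReal_mul_I_im, -Complex.ofReal_div]

-- Registers `28` and `29` hold cosine and sine of `π / 2 ^ (j + 1)` in units of `S`, starting from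
-- the exact values `0` and `S`. Each new sine is computed from the previous cosine, so its error of
-- order `√S` does not propagate to later angles. The table error grows linearly with the number of
-- doublings.
set_option maxHeartbeats 1000000 in
theorem wp_roots {w A ν : ℕ} {s : St} (h2 : s.reg 2 = 0) (h8 : s.reg 8 = A) (hν : 2 ≤ ν)
    (h15 : s.reg 15 = ν - 1) (h16 : s.reg 16 = 2 ^ (64 * ν)) (h17 : s.reg 17 = (2 ^ (64 * ν)) ^ 2)
    (h18 : s.reg 18 = (2 ^ (64 * ν)) ^ 3) (hA : A + 2 * 2 ^ ν < 2 ^ w)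
    (hw : 2 * (2 ^ (64 * ν)) ^ 3 < 2 ^ w) :
    roots.wp w (fun s' => Fr 22 A (A + 2 * 2 ^ ν) s s' ∧
      s'.tm ≤ s.tm + 50 + ν * (4000 * (ν + 1)) + 100 * 2 ^ ν ∧
      ∀ b < 2 ^ ν, Cell w (2 ^ (64 * ν)) s'.mem (A + 2 * b) (tw b) (2 ^ (37 * ν))) s := by
  obtain ⟨H, hH⟩ : ∃ H, 2 ^ (64 * ν) = 2 * H := ⟨2 ^ (64 * ν - 1), by
    rw [← pow_succ']; congr 1; omega⟩
  have hSbig : 2 ^ (32 * ν + 3) ≤ 2 ^ (64 * ν) := Nat.pow_le_pow_right (by norm_num) (by omega)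
  have hδ2 : 8 ≤ 2 ^ (32 * ν + 3) := by
    calc 8 = 2 ^ 3 := by norm_num
      _ ≤ _ := Nat.pow_le_pow_right (by norm_num) (by omega)
  -- The final table error; after `ν < 2 ^ ν` the exponents require `33 * ν + 5 ≤ 37 * ν`, and this
  -- is where `2 ≤ ν` matters.
  have hνS : ν * 4 * 2 ^ (32 * ν + 3) ≤ 2 ^ (37 * ν) := by
    have h1 : ν < 2 ^ ν := Nat.lt_two_pow_self
    calc ν * 4 * 2 ^ (32 * ν + 3) ≤ 2 ^ ν * 4 * 2 ^ (32 * ν + 3) := by gcongr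
      _ = 2 ^ (33 * ν + 5) := by rw [show 33 * ν + 5 = ν + 2 + (32 * ν + 3) by ring]; ring
      _ ≤ 2 ^ (37 * ν) := Nat.pow_le_pow_right (by norm_num) (by omega)
  have h37 : 2 ^ (37 * ν) ≤ 2 ^ (64 * ν) := Nat.pow_le_pow_right (by norm_num) (by omega)
  have hνw : ν < 2 ^ ν := Nat.lt_two_pow_self
  set S := 2 ^ (64 * ν) with hS
  have hSpos : 8 ≤ S := by omega
  have hS3 : S ≤ S ^ 3 := Nat.le_self_pow (by norm_num) S
  have hS2 : 2 * S ^ 2 ≤ S ^ 3 := by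
    rw [pow_succ S 2, mul_comm 2]; exact Nat.mul_le_mul_left _ (by omega)
  have hHS : S / 2 = H := by omega
  have h1S : 1 * 2 ≤ S := by omega
  simp only [roots, Stm.wp, Ex.Ok, Ex.val, Ex.cost, St.put_reg, St.set_reg, reduceIte,
    Nat.reduceEqDiff, h8, h15, h16, true_and, and_true]
  refine ⟨by omega, by omega, by omega, by omega, by omega, by omega, ?_⟩
  refine Stm.wp_upto (lo := 0) (hi := ν) (fun j s' => Fr 22 A (A + 2 * 2 ^ ν) s s' ∧
      s'.tm ≤ s.tm + 40 + j * (4000 * (ν + 1)) + 100 * 2 ^ j ∧ s'.reg 32 = 2 ^ j ∧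
      s'.reg 28 ≤ S ∧ s'.reg 29 ≤ S ∧
      |(s'.reg 28 : ℝ) - S * Real.cos (Real.pi / 2 ^ (j + 1))| ≤ 4 ∧
      |(s'.reg 29 : ℝ) - S * Real.sin (Real.pi / 2 ^ (j + 1))| ≤ 2 ^ (32 * ν + 2) ∧
      ∀ b < 2 ^ j, Cell w S s'.mem (A + 2 * b) (tw b) (j * 4 * 2 ^ (32 * ν + 3) : ℕ))
    (by omega) (Nat.zero_le _) (by simp) (by simp; omega)
    ⟨?_, ?_, by simp, by simp, by simp, ?_, ?_, ?_⟩ ?_ (by norm_num) ?_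
  · exact (((((((Fr.refl s).put le_rfl (by omega)).put (by omega) (by omega)).set (by norm_num)).set
      (by norm_num)).set (by norm_num)).set (by norm_num)).set (by norm_num)
  · simp only [St.set_tm, St.put_tm]; omega
  · simp
  · simp [h16]
  · intro b hb
    obtain rfl : b = 0 := by simpa using hb
    have := cell_natCast (w := w) (S := S) (v := 1) (a := A)
      (mem := ((((((s.put A S 3).put (A + 1) 0 5).set 28 0 2).set 29 S 2).set 32 1 2)).mem)
      (by simp) (by simp) (by omega)
    rw [show tw 0 = ((1 : ℕ) : ℂ) by simp [tw, ang_zero]]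
    simpa using this
  · rintro j s1 - hj e30 e31 ⟨hf, ht, e32, hC, hD, hCc, hDc, hT⟩
    set C := s1.reg 28 with hCdef
    set D := s1.reg 29 with hDdef
    have h2jν : 2 ^ (j + 1) ≤ 2 ^ ν := Nat.pow_le_pow_right (by norm_num) hj
    have h2j : 2 ^ (j + 1) = 2 * 2 ^ j := pow_succ' _ _
    have hδ : ‖gi C D - S * tw (2 ^ j)‖ ≤ (2 ^ (32 * ν + 3) : ℕ) := by
      refine (norm_gi_sub_tw_le hCc hDc).trans ?_
      have h4 : (4 : ℝ) ≤ 2 ^ (32 * ν + 2) := by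
        calc (4 : ℝ) = 2 ^ 2 := by norm_num
          _ ≤ _ := pow_le_pow_right₀ (by norm_num) (by omega)
      push_cast
      rw [pow_succ (2 : ℝ) (32 * ν + 2)]
      linarith
    have hjS : j * 4 * 2 ^ (32 * ν + 3) ≤ S := by
      calc j * 4 * 2 ^ (32 * ν + 3) ≤ ν * 4 * 2 ^ (32 * ν + 3) := by gcongr
        _ ≤ S := hνS.trans h37
    refine Stm.wp_seq _ (wp_extend (A := A) (S := S) (j := j) (C := C) (D := D)
      (α := (j * 4 * 2 ^ (32 * ν + 3) : ℕ)) (δ := (2 ^ (32 * ν + 3) : ℕ)) ?_ e32 ?_ ?_ ?_ (by rfl)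
      (by rfl) (by omega) (by omega) hw hC hD hδ (Nat.cast_nonneg _) (by exact_mod_cast hjS)
      (by exact_mod_cast hSbig) (by exact_mod_cast (by omega : 2 ≤ 2 ^ (32 * ν + 3))) hT) ?_
    · rw [St.tick_reg, hf.reg 8 (by norm_num), h8]
    · rw [St.tick_reg, hf.reg 16 (by norm_num), h16]
    · rw [St.tick_reg, hf.reg 17 (by norm_num), h17]
    · rw [St.tick_reg, hf.reg 18 (by norm_num), h18]
    rintro s2 ⟨f2, t2, T2⟩
    have f2' : Fr 22 A (A + 2 * 2 ^ ν) s s2 := (hf.tick (k := 1)).trans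
      (f2.mono (by norm_num) le_rfl (by omega))
    have hr2 : ∀ r < 36, s2.reg r = s1.reg r := fun r hr => f2.reg r hr
    have e16 : s2.reg 16 = S := by rw [f2'.reg 16 (by norm_num), h16]
    have e28a : s2.reg 28 = C := hr2 28 (by norm_num)
    have e32a : s2.reg 32 = 2 ^ j := (hr2 32 (by norm_num)).trans e32
    simp only [Stm.wp, Ex.Ok, Ex.val, Ex.cost, St.put_reg, St.set_reg, reduceIte,
      Nat.reduceEqDiff, e28a, e16, e32a, true_and, and_true, and_assoc, hHS]
    have hSS : S ^ 2 = (S + S) * H := by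
      calc S ^ 2 = S * S := pow_two S
        _ = S * (2 * H) := by rw [← hH]
        _ = _ := by ring
    have hSH2 : (S + C) * H ≤ S ^ 2 := by rw [hSS]; exact Nat.mul_le_mul_right _ (by omega)
    have hSH3 : (S - C) * H ≤ S ^ 2 := by rw [hSS]; exact Nat.mul_le_mul_right _ (by omega)
    have hSH : (S - C) * H < 2 ^ w := by omega
    refine ⟨by omega, by omega, by omega, by omega, by omega, hSH, ?_⟩
    refine Stm.wp_mono _ ?_ (wp_isqrt (k := 64 * ν) (X := (S - C) * H) (by simp) (by simpa using e16)
      (by simp [f2'.reg 2, h2]) hSH3 (by omega) hw)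
    rintro s3 ⟨f3, d1, d2, t3⟩
    have f3' : Fr 22 A (A + 2 * 2 ^ ν) s s3 :=
      ((f2'.set (x := 32) (v := 2 * 2 ^ j) (k := 4) (by norm_num)).set (by norm_num)).trans
        ⟨fun r hr => f3.reg r (by omega), fun a ha => f3.mem a (by omega), f3.coins⟩
    have hr3 : ∀ r < 32, s3.reg r = s1.reg r := by
      intro r hr
      rw [f3.reg r (by omega), St.set_reg, if_neg (by omega), St.set_reg, if_neg (by omega),
        hr2 r (by omega)]
    have e32' : s3.reg 32 = 2 * 2 ^ j := by rw [f3.reg 32 (by norm_num)]; simp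
    have e16' : s3.reg 16 = S := by rw [f3'.reg 16 (by norm_num), h16]
    have e28 : s3.reg 28 = C := hr3 28 (by norm_num)
    set D' := s3.reg 34 with hD'
    simp only [Stm.wp, Ex.Ok, Ex.val, Ex.cost, St.set_reg, reduceIte, Nat.reduceEqDiff, e28, e16',
      hHS, true_and, and_true, and_assoc]
    refine ⟨by omega, by omega, by omega, ?_⟩
    refine Stm.wp_mono _ ?_ (wp_isqrt (k := 64 * ν) (X := (S + C) * H) (by simp) (by simpa using e16')
      (by simp [f3'.reg 2, h2]) hSH2 (by omega) hw)
    rintro s4 ⟨f4, c1, c2, t4⟩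
    have f4' : Fr 22 A (A + 2 * 2 ^ ν) s s4 :=
      ((f3'.set (x := 29) (v := D') (k := 2) (by norm_num)).set (by norm_num)).trans
        ⟨fun r hr => f4.reg r (by omega), fun a ha => f4.mem a (by omega), f4.coins⟩
    have e30' : s4.reg 30 = j := by
      rw [f4.reg 30 (by norm_num)]
      simp [hr3, e30]
    have e31' : s4.reg 31 = ν := by
      rw [f4.reg 31 (by norm_num)]
      simp [hr3, e31]
    have e32'' : s4.reg 32 = 2 * 2 ^ j := by
      rw [f4.reg 32 (by norm_num)]
      simp [e32']
    have e29' : s4.reg 29 = D' := by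
      rw [f4.reg 29 (by norm_num)]
      simp
    set C' := s4.reg 34 with hC'
    have hpi := Real.pi_pos
    have hθ : Real.pi / 2 ^ (j + 1) ≤ Real.pi / 2 := by
      apply div_le_div_of_nonneg_left hpi.le (by norm_num)
      calc (2 : ℝ) = 2 ^ 1 := by norm_num
        _ ≤ 2 ^ (j + 1) := pow_le_pow_right₀ (by norm_num) (by omega)
    have hSHr : (S : ℝ) = 2 * H := by exact_mod_cast hH
    have hH1 : 1 ≤ H := by omega
    have hB : 4 * (H : ℝ) ≤ (2 ^ (32 * ν + 1)) ^ 2 := by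
      have h1 : 4 * H ≤ (2 ^ (32 * ν + 1)) ^ 2 := by
        have : (2 ^ (32 * ν + 1)) ^ 2 = 4 * S := by rw [hS]; ring
        omega
      exact_mod_cast h1
    rw [hH] at c1 c2 d1 d2
    rw [hSHr] at hCc
    obtain ⟨g1, g2⟩ := half_angle hH1 (by omega) (by positivity) hθ hCc c1 c2 d1 d2
      (by positivity) hB
    rw [div_div, ← pow_succ, ← hSHr] at g1 g2
    have hle : ∀ x X : ℕ, x ^ 2 ≤ X → X ≤ S ^ 2 → x ≤ S := fun x X h1 h2 =>
      (Nat.pow_le_pow_iff_left (by norm_num)).1 (h1.trans h2)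
    rw [← hH] at c1 d1
    refine ⟨e30', e31', (f4'.set (by norm_num)).set (by norm_num), ?_, ?_, hle _ _ c1 hSH2, ?_, g1, ?_, ?_⟩
    · simp only [St.set_tm, St.tick_tm] at *
      have e1 : (j + 1) * (4000 * (ν + 1)) = j * (4000 * (ν + 1)) + 4000 * (ν + 1) := by ring
      omega
    · rw [e32'', h2j]
    · rw [e29']; exact hle _ _ d1 hSH3
    · rw [e29']
      refine g2.trans ?_
      have : (1 : ℝ) ≤ 2 ^ (32 * ν + 1) := one_le_pow₀ (by norm_num)
      rw [pow_succ (2 : ℝ) (32 * ν + 1)]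
      linarith
    · intro b hb
      have hm : ∀ a, s4.mem a = s2.mem a := fun a => by
        rw [f4.mem a (by omega), St.set_mem, St.set_mem, f3.mem a (by omega), St.set_mem, St.set_mem]
      refine ((T2 b hb).congr (by simp [hm]) (by simp [hm])).mono (le_of_eq ?_)
      push_cast; ring
  · rintro s1 - - ⟨hf, ht, e32, hC, hD, hCc, hDc, hT⟩
    refine ⟨hf.tick, by simp only [St.tick_tm]; omega, fun b hb => (hT b hb).mono ?_⟩
    exact_mod_cast hνS

end WordRAM

/-! ### Word parameters, the prime, and modular inverses -/

namespace WordRAM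

/-- Compute the word length parameters. -/
def ones : Stm := .asg 15 (.c 0) ;; .asg 16 (.c 18446744073709551616) ;; .asg 30 (.c 2) ;;
  .whl 30 20 (.asg 30 (.c 2 *ₑ .v 30) ;; .asg 15 (.v 15 +ₑ .c 1) ;;
    .asg 16 (.c 18446744073709551616 *ₑ .v 16)) ;;
  .asg 17 (.v 16 *ₑ .v 16) ;; .asg 18 (.v 17 *ₑ .v 16)

/-- The literal in the code is `2 ^ 64`. The loop runs while `2 ^ (i + 1) ≤ t`, so it finds `κ =
⌊log₂ t⌋` and builds the unit without shifts by unknown amounts. -/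
theorem wp_ones {w t κ : ℕ} {s : St} (h20 : s.reg 20 = t + 1) (ht : 2 ^ κ ≤ t)
    (ht' : t < 2 ^ (κ + 1)) (hw : 2 * (2 ^ (64 * (κ + 1))) ^ 3 < 2 ^ w) (htw : 4 * t < 2 ^ w) :
    ones.wp w (fun s' => Fr 15 0 0 s s' ∧ (∀ r, 19 ≤ r → r < 30 → s'.reg r = s.reg r) ∧
      s'.reg 15 = κ ∧ s'.reg 16 = 2 ^ (64 * (κ + 1)) ∧ s'.reg 17 = (2 ^ (64 * (κ + 1))) ^ 2 ∧
      s'.reg 18 = (2 ^ (64 * (κ + 1))) ^ 3 ∧ s'.tm ≤ s.tm + 30 + 20 * κ) s := by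
  have h64 : ∀ i, 2 ^ (64 * (i + 1)) = 18446744073709551616 * 2 ^ (64 * i) := by
    intro i; rw [mul_add, pow_add]; ring
  have hκ : κ < 2 ^ κ := Nat.lt_two_pow_self
  set S := 2 ^ (64 * (κ + 1)) with hS
  have hle : ∀ i ≤ κ, 2 ^ (64 * (i + 1)) ≤ S := fun i hi =>
    Nat.pow_le_pow_right (by norm_num) (by omega)
  have hS1 : S ≤ S ^ 2 := Nat.le_self_pow (by norm_num) S
  have hS2 : S ^ 2 ≤ S ^ 3 := Nat.pow_le_pow_right (by positivity) (by norm_num)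
  have h0 := hle 0 (Nat.zero_le _)
  have h64c : 2 ^ (64 * (0 + 1)) = 18446744073709551616 := by norm_num
  simp only [ones, Stm.wp, Ex.Ok, Ex.val, Ex.cost]
  refine ⟨by omega, by omega, by omega, ?_⟩
  refine ⟨fun i s' => Fr 15 0 0 s s' ∧ (∀ r, 19 ≤ r → r < 30 → s'.reg r = s.reg r) ∧
      s'.reg 15 = i ∧ s'.reg 16 = 2 ^ (64 * (i + 1)) ∧ s'.reg 30 = 2 ^ (i + 1) ∧
      s'.tm ≤ s.tm + 10 + 20 * i, κ, ?_, ?_, ?_⟩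
  · refine ⟨(((Fr.refl s).set (by norm_num)).set (by norm_num)).set (by norm_num), fun r h1 h2 => ?_,
      by simp, ?_, by simp, by simp⟩
    · simp only [St.set_reg]
      rw [if_neg (by omega), if_neg (by omega), if_neg (by omega)]
    · rw [h64c]; simp
  · rintro i hi s1 ⟨hf, hr, e15, e16, e30, htm⟩
    have h1 : 2 ^ (i + 1) ≤ 2 ^ κ := Nat.pow_le_pow_right (by norm_num) hi
    have h2 := hle (i + 1) hi
    have h3 := h64 (i + 1)
    rw [h3] at h2
    refine ⟨by rw [hr 20 (by norm_num) (by norm_num)]; omega, ?_⟩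
    simp only [Stm.wp, Ex.Ok, Ex.val, Ex.cost, St.tick_reg, St.set_reg, reduceIte,
      Nat.reduceEqDiff, e15, e16, e30, true_and, and_true, and_assoc]
    refine ⟨by omega, by omega, by omega, by omega, by omega, by omega, ?_, ?_, ?_, ?_, ?_⟩
    · exact ((hf.tick.set (by norm_num)).set (by norm_num)).set (by norm_num)
    · intro r h1 h2
      rw [if_neg (by omega), if_neg (by omega), if_neg (by omega), hr r h1 h2]
    · rw [h3]
    · rw [pow_succ' 2 (i + 1)]
    · simp only [St.set_tm, St.tick_tm]; omega
  · rintro s1 ⟨hf, hr, e15, e16, e30, htm⟩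
    refine ⟨by rw [hr 20 (by norm_num) (by norm_num)]; omega, ?_⟩
    rw [← hS] at e16
    simp only [St.tick_reg, St.set_reg, reduceIte, Nat.reduceEqDiff, e16, e15,
      true_and, and_true, and_assoc]
    rw [← pow_two, ← pow_succ, show 2 + 1 = 3 from rfl]
    refine ⟨by omega, by omega, ?_, ?_, ?_⟩
    · exact (hf.tick.set (by norm_num)).set (by norm_num)
    · intro r h1 h2
      rw [if_neg (by omega), if_neg (by omega), hr r h1 h2]
    · simp only [St.set_tm, St.tick_tm, true_and]; omega

/-- Mark the composite numbers. -/
def sieve : Stm := .asg 30 (.c 2) ;; .upto 30 21 (.asg 31 (.v 30 +ₑ .v 30) ;;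
  .whl 31 21 (.sto (.v 6 +ₑ .v 31) (.c 1) ;; .asg 31 (.v 31 +ₑ .v 30)))

/-- Every `d`, prime or not, marks its multiples from `2 * d` on. This wastes at most a logarithmic
factor, since `∑ N / d` is harmonic. -/
theorem wp_sieve {w A N : ℕ} {s : St} (h6 : s.reg 6 = A) (h21 : s.reg 21 = N) (hN : 2 ≤ N)
    (hA : A + 4 * N < 2 ^ w) (h0 : ∀ x < N, s.mem (A + x) = 0) :
    sieve.wp w (fun s' => Fr 30 A (A + N) s s' ∧
      s'.tm ≤ s.tm + 10 + ∑ d ∈ Finset.Ico 2 N, (20 + 20 * (N / d)) ∧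
      ∀ x < N, s'.mem (A + x) ≠ 0 ↔ ∃ d, 2 ≤ d ∧ d ∣ x ∧ d + d ≤ x) s := by
  simp only [sieve, Stm.wp, Ex.Ok, Ex.val, Ex.cost]
  refine ⟨by omega, ?_⟩
  refine Stm.wp_upto (lo := 2) (hi := N) (fun d s' => Fr 30 A (A + N) s s' ∧
      s'.tm ≤ s.tm + 5 + ∑ d ∈ Finset.Ico 2 d, (20 + 20 * (N / d)) ∧
      ∀ x < N, s'.mem (A + x) ≠ 0 ↔ ∃ e, 2 ≤ e ∧ e < d ∧ e ∣ x ∧ e + e ≤ x)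
    (by omega) hN (by simp) (by simpa using h21)
    ⟨(Fr.refl s).set le_rfl, by simp, fun x hx => ?_⟩ ?_ (by norm_num) ?_
  · rw [St.set_mem, h0 x hx]
    constructor
    · intro h; exact absurd rfl h
    · rintro ⟨e, h1, h2, -⟩; omega
  · rintro d s1 hd hdN e30 e21 ⟨hf, htm, hc⟩
    simp only [Stm.wp, Ex.Ok, Ex.val, Ex.cost, St.tick_reg, e30, true_and]
    refine ⟨by omega, ?_⟩
    refine ⟨fun k s' => Fr 30 A (A + N) s s' ∧ s'.reg 30 = d ∧ s'.reg 31 = d * (k + 2) ∧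
      s'.tm ≤ s1.tm + 6 + 20 * k ∧
      ∀ x < N, s'.mem (A + x) ≠ 0 ↔ (∃ e, 2 ≤ e ∧ e < d ∧ e ∣ x ∧ e + e ≤ x) ∨
        -- Marking starts at the second multiple of `d`, and `(N - 1) / d` multiples are positive
        -- and below `N`, hence one iteration less.
        (d ∣ x ∧ d + d ≤ x ∧ x < d * (k + 2)), (N - 1) / d - 1, ?_, ?_, ?_⟩
    · refine ⟨hf.tick.set (by norm_num), by simp [e30], by simp; ring, by simp, fun x hx => ?_⟩
      rw [St.set_mem, St.tick_mem, hc x hx]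
      constructor
      · exact Or.inl
      · rintro (h | ⟨h1, h2, h3⟩)
        · exact h
        · omega
    · rintro k hk s2 ⟨f2, g30, g31, t2, c2⟩
      have hkd : d * (k + 2) ≤ N - 1 := by
        have := (Nat.le_div_iff_mul_le (by omega)).1 (show k + 2 ≤ (N - 1) / d by omega)
        rwa [mul_comm] at this
      have g21 : s2.reg 21 = N := by rw [f2.reg 21 (by norm_num), h21]
      have g6 : s2.reg 6 = A := by rw [f2.reg 6 (by norm_num), h6]
      have hk1 : d * (k + 1 + 2) = d * (k + 2) + d := by ring
      refine ⟨by omega, ?_⟩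
      set y := d * (k + 2) with hy
      have hyd : d + d ≤ y := by rw [hy]; nlinarith
      simp only [Stm.wp, Ex.Ok, Ex.val, Ex.cost, St.tick_reg, St.set_reg, St.put_reg, reduceIte,
        Nat.reduceEqDiff, g30, g31, g6, true_and, and_true, and_assoc, hk1]
      refine ⟨by omega, by omega, by omega, ?_, ?_, ?_⟩
      · exact (f2.tick.put (by omega) (by omega)).set (by norm_num)
      · simp only [St.set_tm, St.put_tm, St.tick_tm]; omega
      · intro x hx
        simp only [St.set_mem, St.put_mem, St.tick_mem]
        rcases eq_or_ne x y with rfl | hxy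
        · rw [if_pos rfl]
          exact ⟨fun _ => Or.inr ⟨dvd_mul_right _ _, hyd, by omega⟩, fun _ => one_ne_zero⟩
        · rw [if_neg (by omega), c2 x hx]
          refine or_congr_right ⟨fun h => ⟨h.1, h.2.1, by omega⟩, fun h => ⟨h.1, h.2.1, ?_⟩⟩
          by_contra h3
          have h4 : d ∣ x - y := Nat.dvd_sub h.1 (dvd_mul_right _ _)
          have := Nat.le_of_dvd (by omega) h4
          omega
    · rintro s2 ⟨f2, g30, g31, t2, c2⟩
      have g21 : s2.reg 21 = N := by rw [f2.reg 21 (by norm_num), h21]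
      have hge : N ≤ d * ((N - 1) / d - 1 + 2) := by
        have h1 : N - 1 < d * ((N - 1) / d + 1) := Nat.lt_mul_div_succ _ (by omega)
        have h2 : d * ((N - 1) / d + 1) ≤ d * ((N - 1) / d - 1 + 2) :=
          Nat.mul_le_mul_left _ (by omega)
        omega
      refine ⟨by omega, g30, g21, f2.tick.set le_rfl, ?_, fun x hx => ?_⟩
      · rw [Finset.sum_Ico_succ_top hd]
        have : (N - 1) / d ≤ N / d := Nat.div_le_div_right (by omega)
        simp only [St.set_tm, St.tick_tm]; omega
      · rw [St.set_mem, St.tick_mem, c2 x hx]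
        constructor
        · rintro (⟨e, h1, h2, h3⟩ | ⟨h1, h2, h3⟩)
          · exact ⟨e, h1, by omega, h3⟩
          · exact ⟨d, hd, by omega, h1, h2⟩
        · rintro ⟨e, h1, h2, h3, h4⟩
          rcases eq_or_ne e d with rfl | hed
          · exact Or.inr ⟨h3, h4, by omega⟩
          · exact Or.inl ⟨e, h1, by omega, h3, h4⟩
  · rintro s1 - - ⟨hf, htm, hc⟩
    refine ⟨hf.tick, by simp only [St.tick_tm]; omega, fun x hx => ?_⟩
    rw [St.tick_mem, hc x hx]
    exact ⟨fun ⟨e, h1, _, h2⟩ => ⟨e, h1, h2⟩, fun ⟨e, h1, h2, h3⟩ => ⟨e, h1, by omega, h2, h3⟩⟩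

theorem not_prime_iff {x : ℕ} (hx : 2 ≤ x) : ¬ x.Prime ↔ ∃ d, 2 ≤ d ∧ d ∣ x ∧ d + d ≤ x := by
  rw [Nat.not_prime_iff_exists_dvd_lt hx]
  constructor
  · rintro ⟨d, h1, h2, h3⟩
    refine ⟨d, h2, h1, ?_⟩
    obtain ⟨k, rfl⟩ := h1
    have : 2 ≤ k := by
      by_contra h
      have : d * k ≤ d * 1 := Nat.mul_le_mul_left _ (by omega)
      omega
    nlinarith
  · rintro ⟨d, h1, h2, h3⟩
    exact ⟨d, h2, h1, by omega⟩

/-- The least prime above a number. -/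
noncomputable def nextPrime (t : ℕ) : ℕ := Nat.find (Nat.exists_infinite_primes (t + 1))

theorem nextPrime_prime (t : ℕ) : (nextPrime t).Prime :=
  (Nat.find_spec (Nat.exists_infinite_primes (t + 1))).2

theorem lt_nextPrime (t : ℕ) : t < nextPrime t :=
  (Nat.find_spec (Nat.exists_infinite_primes (t + 1))).1

/-- Bertrand's postulate. It keeps the prime inside the sieved range and the residues of size
`O(t)`. -/
theorem nextPrime_le {t : ℕ} (ht : t ≠ 0) : nextPrime t ≤ 2 * t := by
  obtain ⟨p, hp, h1, h2⟩ := Nat.exists_prime_lt_and_le_two_mul t ht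
  exact (Nat.find_min' _ ⟨h1, hp⟩).trans h2

theorem not_prime_of_lt_nextPrime {t x : ℕ} (h1 : t < x) (h2 : x < nextPrime t) : ¬ x.Prime :=
  fun h => Nat.find_min _ h2 ⟨h1, h⟩

/-- Find the next prime. -/
def search : Stm := .asg 19 (.v 20) ;; .asg 31 (.ld (.v 6 +ₑ .v 19)) ;;
  .whl 2 31 (.asg 19 (.v 19 +ₑ .c 1) ;; .asg 31 (.ld (.v 6 +ₑ .v 19)))

theorem wp_search {w A t : ℕ} {s : St} (h2 : s.reg 2 = 0) (h6 : s.reg 6 = A) (ht : 2 ≤ t)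
    (h20 : s.reg 20 = t + 1) (hA : A + 4 * t < 2 ^ w)
    (hc : ∀ x < 2 * t + 2, s.mem (A + x) ≠ 0 ↔ ∃ d, 2 ≤ d ∧ d ∣ x ∧ d + d ≤ x) :
    search.wp w (fun s' => Fr 19 0 0 s s' ∧ (∀ r, 20 ≤ r → r < 30 → s'.reg r = s.reg r) ∧
      s'.reg 19 = nextPrime t ∧ s'.tm ≤ s.tm + 10 + 20 * t) s := by
  have hp1 := lt_nextPrime t
  have hp2 := nextPrime_le (show t ≠ 0 by omega)
  simp only [search, Stm.wp, Ex.Ok, Ex.val, Ex.cost, St.set_reg, reduceIte, Nat.reduceEqDiff, h6,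
    h20, true_and, St.set_mem]
  refine ⟨by omega, ?_⟩
  refine ⟨fun i s' => Fr 19 0 0 s s' ∧ (∀ r, 20 ≤ r → r < 30 → s'.reg r = s.reg r) ∧
      s'.reg 19 = t + 1 + i ∧ s'.reg 31 = s.mem (A + (t + 1 + i)) ∧ s'.tm ≤ s.tm + 8 + 15 * i,
    nextPrime t - (t + 1), ?_, ?_, ?_⟩
  · refine ⟨((Fr.refl s).set (by norm_num)).set (by norm_num), fun r h1 h2 => ?_, by simp, by simp,
      by simp⟩
    simp only [St.set_reg]
    rw [if_neg (by omega), if_neg (by omega)]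
  · rintro i hi s1 ⟨hf, hr, e19, e31, htm⟩
    have e2 : s1.reg 2 = 0 := by rw [hf.reg 2 (by norm_num), h2]
    have e6 : s1.reg 6 = A := by rw [hf.reg 6 (by norm_num), h6]
    have hm : ∀ a, s1.mem a = s.mem a := fun a => hf.mem a (by omega)
    have hne : s1.reg 31 ≠ 0 := by
      rw [e31, hc _ (by omega), ← not_prime_iff (by omega)]
      exact not_prime_of_lt_nextPrime (t := t) (by omega) (by omega)
    refine ⟨by omega, ?_⟩
    simp only [Stm.wp, Ex.Ok, Ex.val, Ex.cost, St.tick_reg, St.set_reg, reduceIte,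
      Nat.reduceEqDiff, e19, e6, St.set_mem, St.tick_mem, hm, true_and, and_true, and_assoc]
    refine ⟨by omega, by omega, by omega, ?_, ?_, by omega, by rw [add_assoc (t + 1)], ?_⟩
    · exact (hf.tick.set (by norm_num)).set (by norm_num)
    · intro r h1 h2
      rw [if_neg (by omega), if_neg (by omega), hr r h1 h2]
    · simp only [St.set_tm, St.tick_tm]; omega
  · rintro s1 ⟨hf, hr, e19, e31, htm⟩
    have e2 : s1.reg 2 = 0 := by rw [hf.reg 2 (by norm_num), h2]
    rw [show t + 1 + (nextPrime t - (t + 1)) = nextPrime t by omega] at e31 e19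
    have h0 : s1.reg 31 = 0 := by
      by_contra h
      rw [e31, ← Ne, hc _ (by omega), ← not_prime_iff (by omega)] at h
      exact h (nextPrime_prime t)
    refine ⟨by omega, hf.tick, hr, e19, ?_⟩
    simp only [St.tick_tm]; omega

/-- Fill the table of inverses. -/
def invs : Stm := .sto (.v 7 +ₑ .c 1) (.c 1) ;; .asg 30 (.c 2) ;; .upto 30 20 (
  .asg 31 (.v 19 %ₑ .v 30) ;;
  .sto (.v 7 +ₑ .v 30) (((.v 19 -ₑ .v 19 /ₑ .v 30) *ₑ .ld (.v 7 +ₑ .v 31)) %ₑ .v 19))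

/-- From `p = i * (p / i) + p % i` one gets `i⁻¹ = -(p / i) * (p % i)⁻¹`, and `p % i` is nonzero and
below `i`, so its inverse is already in the table. Each inverse takes constant time. -/
theorem wp_invs {w A t p : ℕ} {s : St} (h7 : s.reg 7 = A) (ht : 2 ≤ t)
    (h20 : s.reg 20 = t + 1) (h19 : s.reg 19 = p) (hp : p.Prime) (htp : t < p) (hA : A + 4 * t < 2 ^ w)
    (hpw : p * p < 2 ^ w) :
    invs.wp w (fun s' => Fr 30 A (A + t + 1) s s' ∧ s'.tm ≤ s.tm + 20 + 30 * t ∧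
      ∀ i, 1 ≤ i → i ≤ t → s'.mem (A + i) < p ∧ i * s'.mem (A + i) % p = 1) s := by
  have := Fact.mk hp
  have hp1 := hp.one_lt
  have hpp : p ≤ p * p := Nat.le_mul_self p
  simp only [invs, Stm.wp, Ex.Ok, Ex.val, Ex.cost, St.put_reg, h7, true_and]
  refine ⟨by omega, by omega, by omega, ?_⟩
  refine Stm.wp_upto (lo := 2) (hi := t + 1) (fun i s' => Fr 30 A (A + t + 1) s s' ∧
      s'.tm ≤ s.tm + 10 + 30 * (i - 2) ∧
      ∀ j, 1 ≤ j → j < i → s'.mem (A + j) < p ∧ j * s'.mem (A + j) % p = 1)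
    (by omega) (by omega) (by simp) (by simpa using h20)
    ⟨((Fr.refl s).put (by omega) (by omega)).set le_rfl, by simp, fun j hj hj' => ?_⟩ ?_
    (by norm_num) ?_
  · obtain rfl : j = 1 := by omega
    simp only [St.set_mem, St.put_mem, if_true, mul_one]
    exact ⟨hp1, Nat.mod_eq_of_lt hp1⟩
  · rintro i s1 hi hit e30 e20 ⟨hf, htm, hc⟩
    have e19 : s1.reg 19 = p := by rw [hf.reg 19 (by norm_num), h19]
    have e7 : s1.reg 7 = A := by rw [hf.reg 7 (by norm_num), h7]
    have hmod : p % i < i := Nat.mod_lt _ (by omega)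
    have hmod0 : p % i ≠ 0 := by
      intro h
      have := (Nat.dvd_prime hp).1 (Nat.dvd_of_mod_eq_zero h)
      omega
    obtain ⟨c1, c2⟩ := hc (p % i) (by omega) hmod
    have hdiv : p / i ≤ p := Nat.div_le_self _ _
    have hmul : (p - p / i) * s1.mem (A + p % i) < 2 ^ w :=
      lt_of_le_of_lt (Nat.mul_le_mul (Nat.sub_le _ _) c1.le) hpw
    simp only [Stm.wp, Ex.Ok, Ex.val, Ex.cost, St.tick_reg, St.set_reg, St.put_reg, St.tick_mem,
      St.set_mem, reduceIte, Nat.reduceEqDiff, e30, e7, e19, e20, true_and, and_true, and_assoc]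
    refine ⟨by omega, by omega, by omega, by omega, hmul, ?_, ?_, ?_⟩
    · exact ((hf.tick.set (by norm_num)).put (by omega) (by omega)).set le_rfl
    · simp only [St.set_tm, St.put_tm, St.tick_tm]; omega
    · intro j hj hji
      simp only [St.set_mem, St.put_mem, St.tick_mem]
      rcases eq_or_ne j i with rfl | hne
      · rw [if_pos rfl]
        refine ⟨Nat.mod_lt _ (by omega), ?_⟩
        have h1 : ((j * ((p - p / j) * s1.mem (A + p % j) % p) : ℕ) : ZMod p) = (1 : ℕ) := by
          have h2 : ((p % j * s1.mem (A + p % j) : ℕ) : ZMod p) = 1 := by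
            have := congrArg (Nat.cast (R := ZMod p)) c2
            rwa [ZMod.natCast_mod, Nat.cast_one] at this
          have h3 : (j : ZMod p) * (p / j : ℕ) + (p % j : ℕ) = 0 := by
            rw [← Nat.cast_mul, ← Nat.cast_add, Nat.div_add_mod, ZMod.natCast_self]
          push_cast at h2 ⊢
          rw [ZMod.natCast_mod]
          push_cast [Nat.cast_sub hdiv]
          rw [ZMod.natCast_self]
          linear_combination h2 - (s1.mem (A + p % j) : ZMod p) * h3
        rw [ZMod.natCast_eq_natCast_iff] at h1
        rw [h1, Nat.mod_eq_of_lt hp1]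
      · rw [if_neg (by omega)]
        exact hc j hj (by omega)
  · rintro s1 - - ⟨hf, htm, hc⟩
    exact ⟨hf.tick, by simp only [St.tick_tm]; omega, fun i h1 h2 => hc i h1 (by omega)⟩

end WordRAM

/-! ### Addresses of the tables, and the whole setup -/

namespace WordRAM

/-- The addresses of the tables. -/
structure Base (n t : ℕ) (s : St) : Prop where
  r0 : s.reg 0 = n
  r1 : s.reg 1 = t
  r2 : s.reg 2 = 0
  r4 : s.reg 4 = n + 16 * (t + 1)
  r6 : s.reg 6 = n + 32 * (t + 1)
  r7 : s.reg 7 = n + 48 * (t + 1)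
  r8 : s.reg 8 = n + 64 * (t + 1)
  r9 : s.reg 9 = n + 80 * (t + 1)
  r10 : s.reg 10 = n + 96 * (t + 1)
  r12 : s.reg 12 = n + 112 * (t + 1)
  r11 : s.reg 11 = n + 128 * (t + 1)
  r13 : s.reg 13 = n + 144 * (t + 1)
  r14 : s.reg 14 = n + 160 * (t + 1)
  r20 : s.reg 20 = t + 1
  r21 : s.reg 21 = 2 * t + 2

theorem Base.congr {n t : ℕ} {s s' : St} (h : Base n t s) (h1 : ∀ r < 15, s'.reg r = s.reg r)
    (h2 : s'.reg 20 = s.reg 20) (h3 : s'.reg 21 = s.reg 21) : Base n t s' := by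
  refine ⟨?_, ?_, ?_, ?_, ?_, ?_, ?_, ?_, ?_, ?_, ?_, ?_, ?_, ?_, ?_⟩
  any_goals first | rw [h2] | rw [h3] | rw [h1 _ (by norm_num)]
  · exact h.r0
  · exact h.r1
  · exact h.r2
  · exact h.r4
  · exact h.r6
  · exact h.r7
  · exact h.r8
  · exact h.r9
  · exact h.r10
  · exact h.r12
  · exact h.r11
  · exact h.r13
  · exact h.r14
  · exact h.r20
  · exact h.r21

/-- Compute the addresses of the tables. -/
def addrs : Stm := .asg 20 (.v 1 +ₑ .c 1) ;; .asg 21 (.c 2 *ₑ .v 20) ;;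
  .asg 4 (.v 0 +ₑ .c 16 *ₑ .v 20) ;; .asg 6 (.v 0 +ₑ .c 32 *ₑ .v 20) ;;
  .asg 7 (.v 0 +ₑ .c 48 *ₑ .v 20) ;; .asg 8 (.v 0 +ₑ .c 64 *ₑ .v 20) ;;
  .asg 9 (.v 0 +ₑ .c 80 *ₑ .v 20) ;; .asg 10 (.v 0 +ₑ .c 96 *ₑ .v 20) ;;
  .asg 12 (.v 0 +ₑ .c 112 *ₑ .v 20) ;; .asg 11 (.v 0 +ₑ .c 128 *ₑ .v 20) ;;
  .asg 13 (.v 0 +ₑ .c 144 *ₑ .v 20) ;; .asg 14 (.v 0 +ₑ .c 160 *ₑ .v 20)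

theorem wp_addrs {w n t : ℕ} {s : St} (h0 : s.reg 0 = n) (h1 : s.reg 1 = t) (h2 : s.reg 2 = 0)
    (hM : n + 176 * (t + 1) < 2 ^ w) :
    addrs.wp w (fun s' => Base n t s' ∧ (∀ r, 22 ≤ r → s'.reg r = s.reg r) ∧ s'.mem = s.mem ∧
      s'.coins = s.coins ∧ s'.tm ≤ s.tm + 100) s := by
  simp only [addrs, Stm.wp, Ex.Ok, Ex.val, Ex.cost, St.set_reg, reduceIte, Nat.reduceEqDiff, h0, h1,
    h2, true_and, and_true, and_assoc]
  repeat refine ⟨by omega, ?_⟩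
  refine ⟨⟨?_, ?_, ?_, ?_, ?_, ?_, ?_, ?_, ?_, ?_, ?_, ?_, ?_, ?_, ?_⟩, ?_, rfl, rfl, ?_⟩
  any_goals (simp only [St.set_reg, reduceIte, Nat.reduceEqDiff]; try omega)
  · intro r hr
    simp only [show ∀ k < 22, r = k ↔ False from fun k hk => iff_of_false (by omega) id,
      Nat.reduceLT, if_false]
  · simp only [St.set_tm]; omega

/-- Fill all tables of the randomized phase. -/
def setup : Stm := ones ;; sieve ;; search ;; invs ;; roots

/-- The word length parameter. -/
def nu (t : ℕ) : ℕ := Nat.log 2 t + 1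

/-- A bound for the time of the setup. -/
def setupTime (t : ℕ) : ℕ :=
  500 + 500 * t + nu t * (4100 * (nu t + 1)) +
    ∑ d ∈ Finset.Ico 2 (2 * t + 2), (20 + 20 * ((2 * t + 2) / d))

theorem par_nu {w n t : ℕ} (ht : 2 ≤ t) (hM : n + 176 * (t + 1) < 2 ^ w)
    (hw : 2 * (2 ^ (64 * nu t)) ^ 3 < 2 ^ w) : Par w n t (nu t) (nextPrime t) := by
  refine ⟨ht, by rw [nu]; omega, ?_, ?_, nextPrime_prime t, lt_nextPrime t, nextPrime_le (by omega),
    hM, hw⟩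
  · have := Nat.pow_log_le_self 2 (x := t) (by omega)
    rw [nu, pow_succ]; omega
  · exact Nat.lt_pow_succ_log_self (by norm_num) t

theorem wp_setup {w n t : ℕ} {s : St} (ht : 2 ≤ t) (hb : Base n t s)
    (hp : Par w n t (nu t) (nextPrime t))
    (h0 : ∀ x < 2 * t + 2, s.mem (n + 32 * (t + 1) + x) = 0) :
    setup.wp w (fun s' => Env w n t (nu t) (nextPrime t) s' ∧ Base n t s' ∧
      (∀ r < 15, s'.reg r = s.reg r) ∧
      (∀ a, a < n + 32 * (t + 1) ∨ n + 80 * (t + 1) ≤ a → s'.mem a = s.mem a) ∧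
      s'.coins = s.coins ∧ s'.tm ≤ s.tm + setupTime t) s := by
  have hM := hp.hM
  have hpt := hp.pt
  have htp := hp.tp
  have hlo := hp.lo
  have hν : 2 ≤ nu t := by
    have := Nat.log_pos (b := 2) (by norm_num) ht
    rw [nu]; omega
  refine Stm.wp_seq _ (wp_ones (κ := Nat.log 2 t) hb.r20 (Nat.pow_log_le_self 2 (by omega))
    (Nat.lt_pow_succ_log_self (by norm_num) t) hp.hw (by omega)) ?_
  rintro s1 ⟨f1, g1, e15, e16, e17, e18, t1⟩
  have hb1 := hb.congr f1.reg (g1 20 (by norm_num) (by norm_num)) (g1 21 (by norm_num) (by norm_num))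
  have m1 : ∀ a, s1.mem a = s.mem a := fun a => f1.mem a (by omega)
  refine Stm.wp_seq _ (wp_sieve (A := n + 32 * (t + 1)) (N := 2 * t + 2) hb1.r6 hb1.r21 (by omega)
    (by omega) (fun x hx => by rw [m1, h0 x hx])) ?_
  rintro s2 ⟨f2, t2, c2⟩
  have hb2 := hb1.congr (fun r hr => f2.reg r (by omega)) (f2.reg 20 (by norm_num))
    (f2.reg 21 (by norm_num))
  refine Stm.wp_seq _ (wp_search (A := n + 32 * (t + 1)) hb2.r2 hb2.r6 ht hb2.r20 (by omega) c2) ?_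
  rintro s3 ⟨f3, g3, e19, t3⟩
  have hb3 := hb2.congr (fun r hr => f3.reg r (by omega)) (g3 20 (by norm_num) (by norm_num))
    (g3 21 (by norm_num) (by norm_num))
  refine Stm.wp_seq _ (wp_invs (A := n + 48 * (t + 1)) hb3.r7 ht hb3.r20 e19 hp.prime htp (by omega)
    (hp.mul_lt le_rfl le_rfl)) ?_
  rintro s4 ⟨f4, t4, c4⟩
  have hb4 := hb3.congr (fun r hr => f4.reg r (by omega)) (f4.reg 20 (by norm_num))
    (f4.reg 21 (by norm_num))
  have e4 : ∀ r, 15 ≤ r → r < 19 → s4.reg r = s1.reg r := fun r h1 h2 => by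
    rw [f4.reg r (by omega), f3.reg r h2, f2.reg r (by omega)]
  refine Stm.wp_mono _ ?_ (wp_roots (A := n + 64 * (t + 1)) (ν := nu t) hb4.r2 hb4.r8 hν ?_ ?_ ?_ ?_
    (by omega) hp.hw)
  · rintro s5 ⟨f5, t5, c5⟩
    have hb5 := hb4.congr (fun r hr => f5.reg r (by omega)) (f5.reg 20 (by norm_num))
      (f5.reg 21 (by norm_num))
    have e5 : ∀ r, 15 ≤ r → r < 19 → s5.reg r = s1.reg r := fun r h1 h2 => by
      rw [f5.reg r (by omega), e4 r h1 h2]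
    refine ⟨⟨hb5.r1, hb5.r2, hb5.r4, hb5.r7, hb5.r8, hb5.r9, hb5.r10, hb5.r12, hb5.r11, hb5.r13,
      hb5.r14, ?_, ?_, ?_, ?_, ?_, hb5.r20, hb5.r21, ?_, c5⟩, hb5, ?_, ?_, ?_, ?_⟩
    · rw [e5 15 (by norm_num) (by norm_num), e15, nu]; omega
    · rw [e5 16 (by norm_num) (by norm_num), e16, nu]
    · rw [e5 17 (by norm_num) (by norm_num), e17, nu]
    · rw [e5 18 (by norm_num) (by norm_num), e18, nu]
    · rw [f5.reg 19 (by norm_num), f4.reg 19 (by norm_num), e19]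
    · intro i h1 h2
      rw [f5.mem _ (by omega)]
      exact c4 i h1 h2
    · intro r hr
      rw [f5.reg r (by omega), f4.reg r (by omega), f3.reg r (by omega), f2.reg r (by omega),
        f1.reg r hr]
    · intro a ha
      rw [f5.mem a (by omega), f4.mem a (by omega), f3.mem a (by omega), f2.mem a (by omega), m1]
    · rw [f5.coins, f4.coins, f3.coins, f2.coins, f1.coins]
    · have h1 : nu t * (4100 * (nu t + 1)) =
          nu t * (4000 * (nu t + 1)) + nu t * (100 * (nu t + 1)) := by ring
      have h2 : nu t ≤ nu t * (100 * (nu t + 1)) := Nat.le_mul_of_pos_right _ (by omega)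
      have h3 : Nat.log 2 t < nu t := by rw [nu]; omega
      have h4 : Nat.log 2 t ≤ t := (Nat.log_lt_self 2 (by omega)).le
      rw [setupTime]
      omega
  · rw [e4 15 (by norm_num) (by norm_num), e15, nu]; omega
  · rw [e4 16 (by norm_num) (by norm_num), e16, nu]
  · rw [e4 17 (by norm_num) (by norm_num), e17, nu]
  · rw [e4 18 (by norm_num) (by norm_num), e18, nu]

end WordRAM

/-! ### Reduction to at most two copies of each value -/

namespace WordRAM

/-- The state of the pairing phase: multiplicities, items, and the number of items. -/
structure Pairing where
  cnt : ℕ → ℕ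
  its : ℕ → ℕ
  m : ℕ

/-- Keep one or two copies of `v`, and replace pairs of further copies by copies of `2 * v`. -/
def Pairing.step (P : Pairing) (v : ℕ) : Pairing where
  cnt u := P.cnt u + if u = 2 * v then (P.cnt v - 1) / 2 else 0
  its i := if i < P.m then P.its i else v
  m := P.m + (P.cnt v - 2 * ((P.cnt v - 1) / 2))

/-- The state after the values up to `x`. -/
def pairing (c : ℕ → ℕ) : ℕ → Pairing
  | 0 => ⟨c, fun _ => 0, 0⟩
  | x + 1 => (pairing c x).step (x + 1)

theorem pairing_m_le (c : ℕ → ℕ) (x : ℕ) : (pairing c x).m ≤ 2 * x := by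
  induction x with
  | zero => rfl
  | succ x ih =>
    simp only [pairing, Pairing.step]
    omega

/-- The items come in increasing order of value and each value occurs at most twice. The last
inequality drives both the harmonic time bound and the degree bound `√(4 * t)`. -/
theorem pairing_its (c : ℕ → ℕ) (x i : ℕ) (hi : i < (pairing c x).m) :
    1 ≤ (pairing c x).its i ∧ (pairing c x).its i ≤ x ∧ i + 1 ≤ 2 * (pairing c x).its i := by
  induction x generalizing i with
  | zero => exact absurd hi (Nat.not_lt_zero _)
  | succ x ih =>
    have hm := pairing_m_le c x
    simp only [pairing, Pairing.step] at hi ⊢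
    split_ifs with h
    · have := ih i h
      omega
    · omega

/-- A pair of copies becomes a single copy, so the total multiplicity never grows and the counters
fit into words. -/
theorem sum_pairing_cnt_le (c : ℕ → ℕ) {n t x : ℕ} (hxt : x ≤ t)
    (h : ∑ u ∈ Finset.Ioc 0 t, c u ≤ n) :
    ∑ u ∈ Finset.Ioc x t, (pairing c x).cnt u ≤ n := by
  induction x with
  | zero => exact h
  | succ x ih =>
    have ih := ih (by omega)
    rw [← Finset.insert_Ioc_add_one_left_eq_Ioc (by omega), Finset.sum_insert (by simp)] at ih
    simp only [pairing, Pairing.step, Finset.sum_add_distrib, Finset.sum_ite_eq']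
    split_ifs <;> omega

theorem pairing_cnt_le (c : ℕ → ℕ) {n t x u : ℕ} (hxu : x < u) (hut : u ≤ t)
    (h : ∑ u ∈ Finset.Ioc 0 t, c u ≤ n) : (pairing c x).cnt u ≤ n :=
  (Finset.single_le_sum (f := (pairing c x).cnt) (fun _ _ => Nat.zero_le _)
    (Finset.mem_Ioc.2 ⟨hxu, hut⟩)).trans (sum_pairing_cnt_le c (by omega) h)

open scoped Pointwise

/-- Three copies of `v` produce the sums `0, v, 2v, 3v`, and so do one `v` and one `2 * v`.
Converting a pair needs a third copy that stays, which is why `e + 1` appears. -/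
theorem nsmul_pair_eq (v e k : ℕ) : (e + 1 + 2 * k) • ({0, v} : Set ℕ) =
    (e + 1) • ({0, v} : Set ℕ) + k • ({0, 2 * v} : Set ℕ) := by
  have key : ({0, v} : Set ℕ) + {0, v} + {0, v} = {0, v} + {0, 2 * v} := by
    ext x
    simp only [Set.mem_add, Set.mem_insert_iff, Set.mem_singleton_iff]
    constructor
    · rintro ⟨_, ⟨a, ha, b, hb, rfl⟩, c, hc, rfl⟩
      rcases ha with rfl | rfl <;> rcases hb with rfl | rfl <;> rcases hc with rfl | rfl
      · exact ⟨0, Or.inl rfl, 0, Or.inl rfl, by ring⟩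
      · exact ⟨c, Or.inr rfl, 0, Or.inl rfl, by ring⟩
      · exact ⟨b, Or.inr rfl, 0, Or.inl rfl, by ring⟩
      · exact ⟨0, Or.inl rfl, _, Or.inr rfl, by ring⟩
      · exact ⟨a, Or.inr rfl, 0, Or.inl rfl, by ring⟩
      · exact ⟨0, Or.inl rfl, _, Or.inr rfl, by ring⟩
      · exact ⟨0, Or.inl rfl, _, Or.inr rfl, by ring⟩
      · exact ⟨_, Or.inr rfl, _, Or.inr rfl, by ring⟩
    · rintro ⟨a, ha, b, hb, rfl⟩
      rcases ha with rfl | rfl <;> rcases hb with rfl | rfl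
      · exact ⟨_, ⟨0, Or.inl rfl, 0, Or.inl rfl, rfl⟩, 0, Or.inl rfl, by ring⟩
      · exact ⟨_, ⟨v, Or.inr rfl, v, Or.inr rfl, rfl⟩, 0, Or.inl rfl, by ring⟩
      · exact ⟨_, ⟨a, Or.inr rfl, 0, Or.inl rfl, rfl⟩, 0, Or.inl rfl, by ring⟩
      · exact ⟨_, ⟨a, Or.inr rfl, a, Or.inr rfl, rfl⟩, a, Or.inr rfl, by ring⟩
  induction k with
  | zero => simp
  | succ k ih =>
    have e1 : ∀ A B : Set ℕ, A + A + A = A + B → (e + 1 + 2 * k) • A = (e + 1) • A + k • B →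
        (e + 1 + 2 * (k + 1)) • A = (e + 1) • A + (k + 1) • B := by
      intro A B h1 h2
      calc (e + 1 + 2 * (k + 1)) • A = (e + 1 + 2 * k) • A + (A + A) := by
            rw [show e + 1 + 2 * (k + 1) = e + 1 + 2 * k + (1 + 1) by ring, add_nsmul _ _ (1 + 1),
              add_nsmul _ 1 1, one_nsmul]
        _ = e • A + (A + A + A) + k • B := by rw [h2, add_nsmul, one_nsmul]; abel
        _ = (e + 1) • A + (k + 1) • B := by
            rw [h1, add_nsmul _ e, add_nsmul _ k, one_nsmul, one_nsmul]; abel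
    exact e1 _ _ key ih

theorem mem_add_nsmul_pair_iff {T : Set ℕ} {t u k : ℕ} (hu : t < u) :
    t ∈ T + k • ({0, u} : Set ℕ) ↔ t ∈ T := by
  induction k generalizing T with
  | zero => simp
  | succ k ih =>
    rw [add_nsmul, one_nsmul, add_comm (k • _), ← add_assoc, ih, Set.mem_add]
    constructor
    · rintro ⟨a, ha, b, rfl | rfl, h⟩
      · rwa [← h]
      · omega
    · intro h
      exact ⟨t, h, 0, Or.inl rfl, rfl⟩

/-- The sums of subsets of the items. -/
def sums (its : ℕ → ℕ) (m : ℕ) : Set ℕ := ∑ i ∈ Finset.range m, ({0, its i} : Set ℕ)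

theorem mem_sums_iff {its : ℕ → ℕ} {m t : ℕ} : t ∈ sums its m ↔
    ∃ I ∈ (Finset.range m).powerset, ∑ i ∈ I, its i = t := by
  induction m generalizing t with
  | zero => simp [sums, eq_comm]
  | succ m ih =>
    rw [sums, Finset.sum_range_succ, ← sums, Set.mem_add]
    constructor
    · rintro ⟨a, ha, b, hb, rfl⟩
      obtain ⟨I, hI, rfl⟩ := ih.1 ha
      rw [Finset.mem_powerset] at hI
      rcases hb with rfl | rfl
      · exact ⟨I, Finset.mem_powerset.2 (hI.trans (Finset.range_mono (by omega))), by simp⟩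
      · have hm : m ∉ I := fun h => by simpa using hI h
        refine ⟨insert m I, ?_, by rw [Finset.sum_insert hm, add_comm]⟩
        rw [Finset.mem_powerset, Finset.range_add_one]
        exact Finset.insert_subset_insert _ hI
    · rintro ⟨I, hI, rfl⟩
      rw [Finset.mem_powerset, Finset.range_add_one] at hI
      have h1 : ∑ i ∈ I.erase m, its i ∈ sums its m := by
        refine ih.2 ⟨_, Finset.mem_powerset.2 ?_, rfl⟩
        exact Finset.subset_insert_iff.1 hI
      by_cases hm : m ∈ I
      · exact ⟨_, h1, its m, Or.inr rfl, Finset.sum_erase_add _ _ hm⟩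
      · rw [Finset.erase_eq_of_notMem hm] at h1
        exact ⟨_, h1, 0, Or.inl rfl, rfl⟩

/-- Invariant of the pairing phase: items already produced plus the multiplicities of larger values
reach `t` exactly when the original values do. -/
theorem mem_pairing_iff (c : ℕ → ℕ) {t x : ℕ} (hx : x ≤ t) :
    t ∈ sums (pairing c x).its (pairing c x).m +
      ∑ u ∈ Finset.Ioc x t, (pairing c x).cnt u • ({0, u} : Set ℕ) ↔
    t ∈ ∑ u ∈ Finset.Ioc 0 t, c u • ({0, u} : Set ℕ) := by
  induction x with
  | zero => simp [pairing, sums]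
  | succ x ih =>
    rw [← ih (by omega), ← Finset.insert_Ioc_add_one_left_eq_Ioc (show x < t by omega),
      Finset.sum_insert (by simp)]
    set P := pairing c x with hP
    have hk : P.cnt (x + 1) = (P.cnt (x + 1) - 2 * ((P.cnt (x + 1) - 1) / 2)) +
      2 * ((P.cnt (x + 1) - 1) / 2) := by omega
    set k := (P.cnt (x + 1) - 1) / 2 with hkd
    set e := P.cnt (x + 1) - 2 * k with he
    have h1 : P.cnt (x + 1) • ({0, x + 1} : Set ℕ) =
        e • ({0, x + 1} : Set ℕ) + k • ({0, 2 * (x + 1)} : Set ℕ) := by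
      -- `e` is zero only for multiplicity zero, where truncated subtraction gives `k = 0`;
      -- otherwise one or two copies are kept, as `nsmul_pair_eq` requires.
      rcases Nat.eq_zero_or_pos e with h0 | h0
      · have hk0 : k = 0 := by omega
        rw [hk, h0, hk0]; simp
      · obtain ⟨e', he'⟩ : ∃ e', e = e' + 1 := ⟨e - 1, by omega⟩
        rw [hk, he', nsmul_pair_eq]
    have h2 : sums (pairing c (x + 1)).its (pairing c (x + 1)).m =
        sums P.its P.m + e • ({0, x + 1} : Set ℕ) := by
      rw [sums, sums, pairing, ← hP, Pairing.step]
      simp only [← hkd, ← he]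
      rw [Finset.sum_range_add]
      congr 1
      · refine Finset.sum_congr rfl fun i hi => ?_
        rw [if_pos (Finset.mem_range.1 hi)]
      · rw [Finset.sum_congr rfl (g := fun _ => ({0, x + 1} : Set ℕ))
          (fun i _ => by rw [if_neg (by omega)]), Finset.sum_const, Finset.card_range]
    have h3 : ∑ u ∈ Finset.Ioc (x + 1) t, (pairing c (x + 1)).cnt u • ({0, u} : Set ℕ) =
        ∑ u ∈ Finset.Ioc (x + 1) t, P.cnt u • ({0, u} : Set ℕ) +
          if 2 * (x + 1) ≤ t then k • ({0, 2 * (x + 1)} : Set ℕ) else 0 := by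
      simp only [pairing, Pairing.step, ← hP, add_nsmul, Finset.sum_add_distrib, ← hkd]
      congr 1
      rw [Finset.sum_congr (s₁ := Finset.Ioc (x + 1) t) rfl (g := fun u => if u = 2 * (x + 1) then k • ({0, 2 * (x + 1)} : Set ℕ)
        else 0) (fun u _ => by split_ifs with h <;> simp [h]), Finset.sum_ite_eq']
      refine if_congr ?_ rfl rfl
      rw [Finset.mem_Ioc]; omega
    rw [h1, h2, h3]
    split_ifs with h
    · rw [show ∀ a b c d : Set ℕ, a + b + (c + d) = a + (b + d + c) by intros; abel]
    -- Copies of `2 * (x + 1) > t` are dropped; they cannot occur in a sum equal to `t`.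
    · rw [add_zero, show ∀ a b c d : Set ℕ, a + (b + d + c) = a + b + c + d by intros; abel,
        mem_add_nsmul_pair_iff (by omega)]

theorem mem_sums_pairing_iff (c : ℕ → ℕ) (t : ℕ) :
    t ∈ sums (pairing c t).its (pairing c t).m ↔
    t ∈ ∑ u ∈ Finset.Ioc 0 t, c u • ({0, u} : Set ℕ) := by
  rw [← mem_pairing_iff c le_rfl]
  simp

/-- Grouping by value turns the instance into multiplicities. Indices with `s i > t` cannot take
part, and positivity makes the nonzero summands identify the chosen indices. -/
theorem subsetSum_iff {n t : ℕ} {s : Fin n → ℕ} (hs : ∀ i, 0 < s i) : SubsetSum s t ↔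
    t ∈ ∑ u ∈ Finset.Ioc 0 t, (Finset.univ.filter fun i => s i = u).card • ({0, u} : Set ℕ) := by
  have h1 : ∑ u ∈ Finset.Ioc 0 t, (Finset.univ.filter fun i => s i = u).card • ({0, u} : Set ℕ) =
      ∑ i ∈ Finset.univ.filter (fun i => s i ≤ t), ({0, s i} : Set ℕ) := by
    rw [← Finset.sum_fiberwise_of_maps_to (s := Finset.univ.filter fun i => s i ≤ t)
      (t := Finset.Ioc 0 t) (g := s) (fun i hi => by
        simp only [Finset.mem_filter, Finset.mem_univ, true_and] at hi
        exact Finset.mem_Ioc.2 ⟨hs i, hi⟩)]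
    refine Finset.sum_congr rfl fun u hu => ?_
    rw [Finset.sum_congr rfl (g := fun _ => ({0, u} : Set ℕ)) (fun i hi => by
      rw [(Finset.mem_filter.1 hi).2]), Finset.sum_const]
    congr 2
    ext i
    simp only [Finset.mem_filter, Finset.mem_univ, true_and]
    have := (Finset.mem_Ioc.1 hu).2
    constructor
    · rintro rfl; exact ⟨this, rfl⟩
    · exact fun h => h.2
  rw [h1, Set.mem_finsetSum]
  constructor
  · rintro ⟨I, hI⟩
    refine ⟨fun i => if i ∈ I then s i else 0, fun {i} _ => ?_, ?_⟩
    · dsimp only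
      split_ifs <;> simp
    · rw [Finset.sum_ite, Finset.sum_const_zero, add_zero, ← hI]
      refine Finset.sum_congr ?_ fun _ _ => rfl
      ext i
      simp only [Finset.mem_filter, Finset.mem_univ, true_and, and_iff_right_iff_imp]
      intro hi
      exact Finset.single_le_sum (f := s) (fun _ _ => Nat.zero_le _) hi
  · rintro ⟨g, hg, hgt⟩
    refine ⟨(Finset.univ.filter fun i => s i ≤ t).filter (fun i => g i ≠ 0), ?_⟩
    refine Eq.trans ?_ hgt
    rw [Finset.sum_filter]
    refine Finset.sum_congr rfl fun i hi => ?_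
    rcases hg hi with h | h
    · rw [h]; simp
    · rw [Set.mem_singleton_iff] at h
      rw [h, if_pos (hs i).ne']

end WordRAM

/-! ### The programs for counting and pairing -/

namespace WordRAM

/-- Count the multiplicities of the values up to the target. -/
def count : Stm := .asg 30 (.c 0) ;; .upto 30 0 (.asg 31 (.ld (.v 30)) ;;
  .ite (.v 31) (.v 20) (.sto (.v 0 +ₑ .v 31) (.ld (.v 0 +ₑ .v 31) +ₑ .c 1)) (.asg 31 (.v 31)))

/-- The number of the first `n` cells with a given value. -/
def mult (mem : ℕ → ℕ) (n v : ℕ) : ℕ := ((Finset.range n).filter fun i => mem i = v).card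

theorem mult_le (mem : ℕ → ℕ) (n v : ℕ) : mult mem n v ≤ n :=
  (Finset.card_filter_le _ _).trans (Finset.card_range n).le

theorem mult_succ (mem : ℕ → ℕ) (n v : ℕ) :
    mult mem (n + 1) v = mult mem n v + if mem n = v then 1 else 0 := by
  rw [mult, Finset.range_add_one, Finset.filter_insert]
  split_ifs with h
  · rw [Finset.card_insert_of_notMem (by simp), mult]
  · rw [mult, add_zero]

theorem wp_count {w n t : ℕ} {s : St} (hb : Base n t s) (hM : n + 176 * (t + 1) < 2 ^ w)
    (h0 : ∀ v ≤ t, s.mem (n + v) = 0) :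
    count.wp w (fun s' => Fr 22 n (n + t + 1) s s' ∧ s'.tm ≤ s.tm + 10 + n * 30 ∧
      ∀ v ≤ t, s'.mem (n + v) = mult s.mem n v) s := by
  simp only [count, Stm.wp, Ex.Ok, Ex.val, Ex.cost]
  refine ⟨by omega, ?_⟩
  refine Stm.wp_upto (lo := 0) (hi := n) (fun i s' => Fr 22 n (n + t + 1) s s' ∧
      s'.tm ≤ s.tm + 5 + i * 30 ∧ ∀ v ≤ t, s'.mem (n + v) = mult s.mem i v)
    (by omega) (Nat.zero_le _) (by simp) (by simpa using hb.r0)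
    ⟨(Fr.refl s).set (by norm_num), by simp, fun v hv => by simp [h0 v hv, mult]⟩ ?_
    (by norm_num) ?_
  · rintro i s1 - hi e30 e0 ⟨hf, htm, hc⟩
    have e20 : s1.reg 20 = t + 1 := by rw [hf.reg 20 (by norm_num), hb.r20]
    have mi : s1.mem i = s.mem i := hf.mem i (by omega)
    simp only [Stm.wp, Ex.Ok, Ex.val, Ex.cost, St.tick_reg, St.set_reg, St.put_reg, St.tick_mem,
      St.set_mem, reduceIte, Nat.reduceEqDiff, e30, e0, e20, mi, true_and, and_true, and_assoc]
    refine ⟨fun h => ?_, fun h => ?_⟩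
    · have h1 := hc (s.mem i) (by omega)
      have h2 := mult_le s.mem i (s.mem i)
      refine ⟨by omega, by omega, by omega, by omega, ?_, ?_, fun v hv => ?_⟩
      · exact ((hf.tick.set (by norm_num)).tick.put (by omega) (by omega)).set (by norm_num)
      · simp only [St.set_tm, St.put_tm, St.tick_tm]; omega
      · simp only [St.set_mem, St.put_mem, St.tick_mem, mult_succ]
        rcases eq_or_ne v (s.mem i) with rfl | hne
        · rw [if_pos rfl, if_pos rfl, h1]
        · rw [if_neg (by omega), if_neg hne.symm, hc v hv, add_zero]
    · refine ⟨?_, ?_, fun v hv => ?_⟩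
      · exact (((hf.tick.set (by norm_num)).tick.set (by norm_num))).set (by norm_num)
      · simp only [St.set_tm, St.tick_tm]; omega
      · simp only [St.set_mem, St.tick_mem, mult_succ]
        rw [if_neg (by omega), hc v hv, add_zero]
  · rintro s1 - - ⟨hf, htm, hc⟩
    exact ⟨hf.tick, by simp only [St.tick_tm]; omega, hc⟩

/-- Produce the items of value `30`. -/
def pairBody : Stm := .asg 31 (.ld (.v 0 +ₑ .v 30)) ;;
  .ite (.c 0) (.v 31)
    (.asg 32 ((.v 31 -ₑ .c 1) /ₑ .c 2) ;;
      .sto (.v 4 +ₑ .v 5) (.v 30) ;; .asg 5 (.v 5 +ₑ .c 1) ;;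
      .ite (.c 2 *ₑ .v 32 +ₑ .c 1) (.v 31)
        (.sto (.v 4 +ₑ .v 5) (.v 30) ;; .asg 5 (.v 5 +ₑ .c 1)) (.asg 31 (.v 31)) ;;
      .ite (.c 2 *ₑ .v 30) (.v 20)
        (.sto (.v 0 +ₑ .c 2 *ₑ .v 30) (.ld (.v 0 +ₑ .c 2 *ₑ .v 30) +ₑ .v 32)) (.asg 31 (.v 31)))
    (.asg 31 (.v 31))

/-- Produce the items. -/
def pair : Stm := .asg 5 (.c 0) ;; .asg 30 (.c 1) ;; .upto 30 20 pairBody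

/-- The counters are updated in place. Those below the current value are never read again, so the
invariant describes only the ones from it upwards. -/
theorem wp_pair {w n t : ℕ} {s : St} {c : ℕ → ℕ} (hb : Base n t s)
    (hM : n + 176 * (t + 1) < 2 ^ w) (hw2 : 2 * n + 2 * t < 2 ^ w)
    (hc : ∀ v ≤ t, s.mem (n + v) = c v) (hcn : ∑ u ∈ Finset.Ioc 0 t, c u ≤ n) :
    pair.wp w (fun s' => (∀ r < 22, r ≠ 5 → s'.reg r = s.reg r) ∧ s'.reg 5 = (pairing c t).m ∧
      (∀ a, a < n ∨ n + 32 * (t + 1) ≤ a → s'.mem a = s.mem a) ∧ s'.coins = s.coins ∧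
      s'.tm ≤ s.tm + 10 + t * 100 ∧
      ∀ i < (pairing c t).m, s'.mem (n + 16 * (t + 1) + i) = (pairing c t).its i) s := by
  simp only [pair, Stm.wp, Ex.Ok, Ex.val, Ex.cost]
  refine ⟨by omega, by omega, ?_⟩
  refine Stm.wp_upto (lo := 1) (hi := t + 1) (fun x s' =>
      (∀ r < 22, r ≠ 5 → s'.reg r = s.reg r) ∧ s'.reg 5 = (pairing c (x - 1)).m ∧
      (∀ a, a < n ∨ n + 32 * (t + 1) ≤ a → s'.mem a = s.mem a) ∧ s'.coins = s.coins ∧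
      s'.tm ≤ s.tm + 5 + (x - 1) * 100 ∧
      (∀ i < (pairing c (x - 1)).m, s'.mem (n + 16 * (t + 1) + i) = (pairing c (x - 1)).its i) ∧
      ∀ v ≤ t, x ≤ v → s'.mem (n + v) = (pairing c (x - 1)).cnt v)
    (by omega) (by omega) (by simp) (by simpa using hb.r20)
    ⟨fun r h1 h2 => ?_, by simp [pairing], by simp, by simp, by simp, ?_, ?_⟩ ?_
    (by norm_num) ?_
  · simp only [St.set_reg]
    rw [if_neg (by omega), if_neg h2]
  · simp [pairing]
  · intro v hv _
    simp [hc v hv, pairing]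
  · rintro x s1 hx hxt e30 e20 ⟨hr, e5, hm, hco, htm, hi, hcnt⟩
    obtain ⟨y, rfl⟩ : ∃ y, x = y + 1 := ⟨x - 1, by omega⟩
    simp only [Nat.add_sub_cancel] at e5 htm hi hcnt ⊢
    have e0 : s1.reg 0 = n := by rw [hr 0 (by norm_num) (by norm_num), hb.r0]
    have e4 : s1.reg 4 = n + 16 * (t + 1) := by rw [hr 4 (by norm_num) (by norm_num), hb.r4]
    have hml := pairing_m_le c y
    have hstep : pairing c (y + 1) = (pairing c y).step (y + 1) := rfl
    rw [hstep]
    have hcx := hcnt (y + 1) (by omega) le_rfl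
    have hbd : ∀ v, y < v → v ≤ t → (pairing c y).cnt v ≤ n := fun v h1 h2 =>
      pairing_cnt_le c h1 h2 hcn
    have hbx := hbd (y + 1) (by omega) (by omega)
    simp only [Pairing.step]
    generalize pairing c y = P at *
    have hM2 : P.m ≤ 2 * t := by omega
    -- All branches of the body end in a state determined by the number `k` of pairs passed on and
    -- the number `e ≤ 2` of copies kept.
    have key : ∀ Q : St → Prop, (∀ (s2 : St) (k e : ℕ), k = (P.cnt (y + 1) - 1) / 2 →
        e = P.cnt (y + 1) - 2 * k →
        (∀ r < 22, r ≠ 5 → s2.reg r = s1.reg r) → s2.reg 30 = y + 1 → s2.reg 5 = P.m + e →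
        s2.coins = s1.coins → s2.tm ≤ s1.tm + 95 →
        (∀ a, s2.mem a = if a = n + 2 * (y + 1) ∧ 2 * (y + 1) ≤ t then s1.mem a + k else
          if n + 16 * (t + 1) + P.m ≤ a ∧ a < n + 16 * (t + 1) + P.m + e then y + 1
          else s1.mem a) → Q s2) → pairBody.wp w Q (s1.tick 1) := by
      intro Q hQ
      have hbd2 : 2 * (y + 1) ≤ t → s1.mem (n + 2 * (y + 1)) ≤ n := fun h => by
        rw [hcnt _ h (by omega)]; exact hbd _ (by omega) h
      simp only [pairBody, Stm.wp, Ex.Ok, Ex.val, Ex.cost, St.tick_reg, St.set_reg, St.put_reg,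
        St.tick_mem, St.set_mem, St.put_mem, reduceIte, Nat.reduceEqDiff, e30, e0, e4, e5, e20, hcx,
        true_and]
      refine ⟨by omega, by omega, fun h => ⟨by omega, by omega, by omega, by omega, fun h2 =>
        ⟨by omega, by omega, by omega, fun h3 => ⟨by omega, ⟨by omega, ?_⟩, ?_⟩, fun h3 => ?_⟩,
        fun h2 => ⟨by omega, fun h3 => ⟨by omega, ⟨by omega, ?_⟩, ?_⟩, fun h3 => ?_⟩⟩, fun h => ?_⟩
      · have := hbd2 (by omega)
        rw [if_neg (by omega), if_neg (by omega)]; omega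
      · refine hQ _ _ 2 rfl (by omega) ?_ ?_ ?_ ?_ ?_ ?_
        · intro r h1 h2
          simp only [St.set_reg, St.put_reg, St.tick_reg]
          split_ifs <;> first | rfl | omega
        · simp [e30]
        · simp
        · rfl
        · simp only [St.set_tm, St.put_tm, St.tick_tm]; omega
        · intro a
          simp only [St.set_mem, St.put_mem, St.tick_mem]
          split_ifs <;> first | rfl | omega | (subst_vars; rfl)
      · refine hQ _ _ 2 rfl (by omega) ?_ ?_ ?_ ?_ ?_ ?_
        · intro r h1 h2
          simp only [St.set_reg, St.put_reg, St.tick_reg]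
          split_ifs <;> first | rfl | omega
        · simp [e30]
        · simp
        · rfl
        · simp only [St.set_tm, St.put_tm, St.tick_tm]; omega
        · intro a
          simp only [St.set_mem, St.put_mem, St.tick_mem]
          split_ifs <;> first | rfl | omega
      · have := hbd2 (by omega)
        rw [if_neg (by omega)]; omega
      · refine hQ _ _ 1 rfl (by omega) ?_ ?_ ?_ ?_ ?_ ?_
        · intro r h1 h2
          simp only [St.set_reg, St.put_reg, St.tick_reg]
          split_ifs <;> first | rfl | omega
        · simp [e30]
        · simp
        · rfl
        · simp only [St.set_tm, St.put_tm, St.tick_tm]; omega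
        · intro a
          simp only [St.set_mem, St.put_mem, St.tick_mem]
          split_ifs <;> first | rfl | omega | (subst_vars; rfl)
      · refine hQ _ _ 1 rfl (by omega) ?_ ?_ ?_ ?_ ?_ ?_
        · intro r h1 h2
          simp only [St.set_reg, St.put_reg, St.tick_reg]
          split_ifs <;> first | rfl | omega
        · simp [e30]
        · simp
        · rfl
        · simp only [St.set_tm, St.put_tm, St.tick_tm]; omega
        · intro a
          simp only [St.set_mem, St.put_mem, St.tick_mem]
          split_ifs <;> first | rfl | omega
      · refine hQ _ 0 0 (by omega) (by omega) ?_ ?_ ?_ ?_ ?_ ?_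
        · intro r h1 h2
          simp only [St.set_reg, St.put_reg, St.tick_reg]
          split_ifs <;> first | rfl | omega
        · simp [e30]
        · simp [e5]
        · rfl
        · simp only [St.set_tm, St.put_tm, St.tick_tm]; omega
        · intro a
          simp only [St.set_mem, St.put_mem, St.tick_mem]
          split_ifs <;> first | rfl | omega
    refine key _ ?_
    rintro s2 k e hk he h1 h2 h3 h4 h5 h6
    rw [← hk, ← he]
    refine ⟨h2, by rw [h1 20 (by norm_num) (by norm_num), e20], fun r hr1 hr2 => ?_, ?_,
      fun a ha => ?_, h4.trans hco, ?_, fun i him => ?_, fun v hv hyv => ?_⟩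
    · rw [St.set_reg, if_neg (by omega), h1 r hr1 hr2, hr r hr1 hr2]
    · rw [St.set_reg, if_neg (by omega), h3]
    · rw [St.set_mem, h6, if_neg (by omega), if_neg (by omega), hm a ha]
    · simp only [St.set_tm]; omega
    · rw [St.set_mem, h6, if_neg (by omega)]
      split_ifs
      · omega
      · rfl
      · exact hi i (by assumption)
      · omega
    · rw [St.set_mem, h6]
      have := hcnt v hv (by omega)
      split_ifs <;> omega
  · rintro s1 - - ⟨hr, e5, hm, hco, htm, hi, -⟩
    exact ⟨hr, e5, hm, hco, by simp only [St.tick_tm]; omega, hi⟩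

end WordRAM

/-! ### Dynamic programming and the whole program -/

namespace WordRAM

/-- Dynamic programming over the items. -/
def dp : Stm := .sto (.v 6) (.c 1) ;; .asg 30 (.c 0) ;; .upto 30 5 (
    .asg 33 (.ld (.v 4 +ₑ .v 30)) ;; .asg 32 (.v 20 -ₑ .v 33) ;; .asg 31 (.c 0) ;; .upto 31 32 (
      .asg 34 (.ld (.v 6 +ₑ (.v 1 -ₑ .v 31 -ₑ .v 33))) ;;
      .ite (.c 0) (.v 34) (.sto (.v 6 +ₑ (.v 1 -ₑ .v 31)) (.c 1)) (.asg 34 (.v 34)))) ;;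
  .asg 22 (.ld (.v 6 +ₑ .v 1))

open scoped Pointwise in
theorem mem_sums_succ {its : ℕ → ℕ} {m x : ℕ} : x ∈ sums its (m + 1) ↔
    x ∈ sums its m ∨ its m ≤ x ∧ x - its m ∈ sums its m := by
  rw [sums, Finset.sum_range_succ, ← sums, Set.mem_add]
  constructor
  · rintro ⟨a, ha, b, rfl | rfl, rfl⟩
    · exact Or.inl ha
    · exact Or.inr ⟨Nat.le_add_left _ _, by simpa using ha⟩
  · rintro (h | ⟨h1, h2⟩)
    · exact ⟨x, h, 0, Or.inl rfl, rfl⟩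
    · exact ⟨_, h2, its m, Or.inr rfl, by simpa using Nat.sub_add_cancel h1⟩

theorem wp_dp {w n t m : ℕ} {s : St} {its : ℕ → ℕ} (hb : Base n t s)
    (hM : n + 176 * (t + 1) < 2 ^ w) (h5 : s.reg 5 = m) (hm : m ≤ 2 * t)
    (hi : ∀ i < m, s.mem (n + 16 * (t + 1) + i) = its i ∧ 1 ≤ its i ∧ its i ≤ t)
    (h0 : ∀ x < 2 * t + 2, s.mem (n + 32 * (t + 1) + x) = 0) :
    dp.wp w (fun s' => s'.reg 22 ≤ 1 ∧ (s'.reg 22 = 1 ↔ t ∈ sums its m) ∧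
      s'.tm ≤ s.tm + 20 + m * (50 + 50 * (t + 1))) s := by
  simp only [dp, Stm.wp, Ex.Ok, Ex.val, Ex.cost, St.put_reg, hb.r6, true_and]
  refine ⟨by omega, by omega, ?_⟩
  refine Stm.wp_upto (lo := 0) (hi := m) (fun i s' =>
      Fr 22 (n + 32 * (t + 1)) (n + 48 * (t + 1)) s s' ∧
      s'.tm ≤ s.tm + 10 + i * (50 + 50 * (t + 1)) ∧
      ∀ x ≤ t, s'.mem (n + 32 * (t + 1) + x) ≤ 1 ∧
        (s'.mem (n + 32 * (t + 1) + x) = 1 ↔ x ∈ sums its i))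
    (by omega) (Nat.zero_le _) (by simp) (by simpa using h5)
    ⟨((Fr.refl s).put le_rfl (by omega)).set (by norm_num), by simp, fun x hx => ?_⟩ ?_
    (by norm_num) ?_
  · simp only [St.set_mem, St.put_mem]
    rcases Nat.eq_zero_or_pos x with rfl | hx0
    · simp [sums]
    · rw [if_neg (by omega), h0 x (by omega)]
      simp [sums]; omega
  · rintro i s1 - him e30 e5 ⟨hf, htm, hc⟩
    have hb1 := hb.congr (fun r hr => hf.reg r (by omega)) (hf.reg 20 (by norm_num))
      (hf.reg 21 (by norm_num))
    obtain ⟨hi1, hi2, hi3⟩ := hi i him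
    have mi : s1.mem (n + 16 * (t + 1) + i) = its i := by rw [hf.mem _ (by omega), hi1]
    set a := its i with ha
    simp only [Stm.wp, Ex.Ok, Ex.val, Ex.cost, St.tick_reg, St.set_reg, St.tick_mem,
      reduceIte, Nat.reduceEqDiff, e30, hb1.r4, hb1.r20, mi, true_and, and_assoc]
    refine ⟨by omega, by omega, by omega, by omega, ?_⟩
    -- The targets are visited downwards, as `t - j`, so entry `t - j - a` still refers to the
    -- earlier items and no item is used twice. Targets below `a` need no update.
    refine Stm.wp_upto (lo := 0) (hi := t + 1 - a) (fun j s' =>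
      Fr 22 (n + 32 * (t + 1)) (n + 48 * (t + 1)) s s' ∧ s'.reg 30 = i ∧ s'.reg 33 = a ∧
      s'.tm ≤ s1.tm + 30 + j * 50 ∧
      ∀ x ≤ t, s'.mem (n + 32 * (t + 1) + x) ≤ 1 ∧
        (s'.mem (n + 32 * (t + 1) + x) = 1 ↔ x ∈ sums its (if t < x + j then i + 1 else i)))
      (by omega) (Nat.zero_le _) (by simp) (by simp)
      ⟨((hf.tick.set (by norm_num)).set (by norm_num)).set (by norm_num), by simp [e30], by simp,
        by simp, fun x hx => ?_⟩ ?_ (by norm_num) ?_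
    · rw [if_neg (by omega)]
      exact hc x hx
    · rintro j s2 - hj e31 e32 ⟨f2, g30, g33, t2, c2⟩
      have hb2 := hb.congr (fun r hr => f2.reg r (by omega)) (f2.reg 20 (by norm_num))
        (f2.reg 21 (by norm_num))
      obtain ⟨c3, c4⟩ := c2 (t - j - a) (by omega)
      obtain ⟨c5, c6⟩ := c2 (t - j) (by omega)
      rw [if_neg (by omega)] at c4 c6
      have hsucc : t - j ∈ sums its (i + 1) ↔ t - j ∈ sums its i ∨ t - j - a ∈ sums its i := by
        rw [mem_sums_succ, ← ha]
        exact or_congr_right ⟨fun h => h.2, fun h => ⟨by omega, h⟩⟩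
      simp only [Stm.wp, Ex.Ok, Ex.val, Ex.cost, St.tick_reg, St.set_reg, St.put_reg, St.tick_mem,
        reduceIte, Nat.reduceEqDiff, e31, e32, g30, g33, hb2.r1, hb2.r6, true_and, and_assoc]
      refine ⟨by omega, by omega, by omega, by omega, by omega, by omega, fun h => ⟨by omega, by omega,
        by omega, by omega, ?_, ?_, fun x hx => ?_⟩, fun h => ⟨?_, ?_, fun x hx => ?_⟩⟩
      · exact ((f2.tick.set (by norm_num)).tick.put (by omega) (by omega)).set (by norm_num)
      · simp only [St.set_tm, St.put_tm, St.tick_tm]; omega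
      · simp only [St.set_mem, St.put_mem, St.tick_mem]
        rcases eq_or_ne x (t - j) with rfl | hne
        · rw [if_pos rfl, if_pos (by omega), hsucc]
          exact ⟨le_rfl, fun _ => Or.inr (c4.1 (by omega)), fun _ => rfl⟩
        · rw [if_neg (by omega), if_congr (show t < x + (j + 1) ↔ t < x + j by omega) rfl rfl]
          exact c2 x hx
      · exact ((f2.tick.set (by norm_num)).tick.set (by norm_num)).set (by norm_num)
      · simp only [St.set_tm, St.tick_tm]; omega
      · simp only [St.set_mem, St.tick_mem]
        rcases eq_or_ne x (t - j) with rfl | hne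
        · rw [if_pos (by omega), hsucc]
          refine ⟨c5, c6.trans ⟨Or.inl, ?_⟩⟩
          rintro (h1 | h1)
          · exact h1
          · have := c4.2 h1; omega
        · rw [if_congr (show t < x + (j + 1) ↔ t < x + j by omega) rfl rfl]
          exact c2 x hx
    · rintro s2 - - ⟨f2, g30, g33, t2, c2⟩
      refine ⟨g30, by rw [St.tick_reg, f2.reg 5 (by norm_num), h5], f2.tick.set (by norm_num), ?_,
        fun x hx => ?_⟩
      · simp only [St.set_tm, St.tick_tm]
        have : (i + 1) * (50 + 50 * (t + 1)) = i * (50 + 50 * (t + 1)) + (50 + 50 * (t + 1)) := by ring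
        omega
      · obtain ⟨c3, c4⟩ := c2 x hx
        refine ⟨c3, c4.trans ?_⟩
        split_ifs with h
        · exact Iff.rfl
        · rw [mem_sums_succ, ← ha]
          exact ⟨Or.inl, fun h' => h'.elim id fun h' => absurd h'.1 (by omega)⟩
  · rintro s1 - - ⟨hf, htm, hc⟩
    have hb1 := hb.congr (fun r hr => hf.reg r (by omega)) (hf.reg 20 (by norm_num))
      (hf.reg 21 (by norm_num))
    simp only [St.tick_reg, St.set_reg, St.tick_mem, hb1.r6, hb1.r1, reduceIte, true_and]
    refine ⟨by omega, (hc t le_rfl).1, (hc t le_rfl).2, ?_⟩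
    simp only [St.set_tm, St.tick_tm]; omega

/-- The randomized phase. -/
def randomized : Stm := setup ;; .asg 22 (.c 0) ;; trial ;; trial ;; trial ;; trial

/-- The program. -/
def prog : Stm := addrs ;; count ;; pair ;; .asg 23 (.v 1 *ₑ .v 1) ;; .asg 24 (.v 0 +ₑ .c 1) ;;
  .ite (.v 23) (.v 24) dp randomized ;; .asg 0 (.v 22)

theorem prog_wf : prog.wf = true := by rfl

/-- The coins that are left after `d` tosses. -/
def later (ω : ℕ → Bool) (d : ℕ) : ℕ → Bool := fun k => ω (d + k)

/-- Some of the first `k` trials is successful. -/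
def Success (its : ℕ → ℕ) (t ν m p : ℕ) (ω : ℕ → Bool) (k : ℕ) : Prop :=
  ∃ j < k, outcome its t ν m p (later ω (j * (m * (ν - 1)))) ≠ 0

open Classical in
/-- The state after `k` trials. -/
structure AfterTrials (n t ν m p : ℕ) (its : ℕ → ℕ) (s : St) (k : ℕ) (s' : St) : Prop where
  reg : ∀ r < 22, s'.reg r = s.reg r
  mem : ∀ a, a < n + 80 * (t + 1) ∨ n + 176 * (t + 1) ≤ a → s'.mem a = s.mem a
  coins : s'.coins = later s.coins (k * (m * (ν - 1)))
  ans : s'.reg 22 = if Success its t ν m p s.coins k then 1 else 0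
  tm : s'.tm ≤ s.tm + 2 + k * trialTime its t ν m

theorem AfterTrials.wp_trial {w n t ν p m k : ℕ} {s s' : St} {its : ℕ → ℕ} (hp : Par w n t ν p)
    (he : Env w n t ν p s) (h5 : s.reg 5 = m) (hm : m ≤ 2 * t)
    (hi : ∀ i < m, s.mem (n + 16 * (t + 1) + i) = its i ∧ 1 ≤ its i ∧ its i ≤ t)
    (h : AfterTrials n t ν m p its s k s') :
    trial.wp w (AfterTrials n t ν m p its s (k + 1)) s' := by
  have he' := he.of_eq hp h.reg h.mem
  refine Stm.wp_mono _ ?_ (WordRAM.wp_trial hp he' (m := m) (its := its) ?_ hm ?_)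
  · rintro s2 ⟨r2, a2, m2, c2, t2⟩
    refine ⟨fun r hr => by rw [r2 r hr, h.reg r hr], fun a ha => by rw [m2 a ha, h.mem a ha], ?_, ?_, ?_⟩
    · rw [c2, h.coins]
      funext j
      simp only [later]
      congr 1; ring
    · rw [a2, h.coins, h.ans]
      have : Success its t ν m p s.coins (k + 1) ↔
          outcome its t ν m p (later s.coins (k * (m * (ν - 1)))) ≠ 0 ∨
            Success its t ν m p s.coins k := by
        simp only [Success]
        constructor
        · rintro ⟨j, h1, h2⟩
          rcases eq_or_ne j k with rfl | hjk
          · exact Or.inl h2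
          · exact Or.inr ⟨j, by omega, h2⟩
        · rintro (h1 | ⟨j, h1, h2⟩)
          · exact ⟨k, by omega, h1⟩
          · exact ⟨j, by omega, h2⟩
      by_cases h1 : outcome its t ν m p (later s.coins (k * (m * (ν - 1)))) ≠ 0
      · rw [if_pos h1, if_pos (this.2 (Or.inl h1))]
      · rw [if_neg h1]
        by_cases h2 : Success its t ν m p s.coins k
        · rw [if_pos h2, if_pos (this.2 (Or.inr h2))]
        · rw [if_neg h2, if_neg (fun h => h2 ((this.1 h).resolve_left h1))]
    · have := h.tm
      have e : (k + 1) * trialTime its t ν m = k * trialTime its t ν m + trialTime its t ν m := by ring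
      omega
  · rw [h.reg 5 (by norm_num), h5]
  · intro i him
    have := hp.lo
    rw [h.mem _ (by omega)]
    exact hi i him

open Classical in
theorem wp_randomized {w n t m : ℕ} {s : St} {its : ℕ → ℕ} (ht : 2 ≤ t) (hb : Base n t s)
    (hM : n + 176 * (t + 1) < 2 ^ w) (hw : 2 * (2 ^ (64 * nu t)) ^ 3 < 2 ^ w)
    (h5 : s.reg 5 = m) (hm : m ≤ 2 * t)
    (hi : ∀ i < m, s.mem (n + 16 * (t + 1) + i) = its i ∧ 1 ≤ its i ∧ its i ≤ t)
    (h0 : ∀ x < 2 * t + 2, s.mem (n + 32 * (t + 1) + x) = 0) :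
    randomized.wp w (fun s' =>
      s'.reg 22 = (if Success its t (nu t) m (nextPrime t) s.coins 4 then 1 else 0) ∧
      s'.tm ≤ s.tm + setupTime t + 2 + 4 * trialTime its t (nu t) m) s := by
  have hp := par_nu ht hM hw
  refine Stm.wp_seq _ (wp_setup ht hb hp h0) ?_
  rintro s1 ⟨he, hb1, r1, m1, c1, t1⟩
  have h5' : s1.reg 5 = m := by rw [r1 5 (by norm_num), h5]
  have hi' : ∀ i < m, s1.mem (n + 16 * (t + 1) + i) = its i ∧ 1 ≤ its i ∧ its i ≤ t := by
    intro i him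
    rw [m1 _ (by omega)]
    exact hi i him
  have step : ∀ k s', AfterTrials n t (nu t) m (nextPrime t) its s1 k s' →
      trial.wp w (AfterTrials n t (nu t) m (nextPrime t) its s1 (k + 1)) s' := fun k s' h =>
    h.wp_trial hp he h5' hm hi'
  refine Stm.wp_seq (AfterTrials n t (nu t) m (nextPrime t) its s1 0) ?_ ?_
  · simp only [Stm.wp, Ex.Ok, Ex.val, Ex.cost]
    refine ⟨by omega, fun r hr => by rw [St.set_reg, if_neg (by omega)], fun a _ => rfl, ?_, ?_, ?_⟩
    · funext j; simp [later]
    · simp [Success]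
    · simp
  · intro s2 h2
    refine Stm.wp_seq _ (step 0 s2 h2) fun s3 h3 => ?_
    refine Stm.wp_seq _ (step 1 s3 h3) fun s4 h4 => ?_
    refine Stm.wp_seq _ (step 2 s4 h4) fun s5 h5 => ?_
    refine Stm.wp_mono _ (fun s6 h6 => ?_) (step 3 s5 h5)
    refine ⟨by rw [h6.ans, c1], ?_⟩
    have := h6.tm
    omega

/-- The items of an instance, and their number. -/
def items (mem : ℕ → ℕ) (n t : ℕ) : Pairing := pairing (mult mem n) t

/-- The answer that the program gives. -/
def Yes (mem : ℕ → ℕ) (n t : ℕ) (ω : ℕ → Bool) : Prop :=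
  t * t ≤ n ∧ t ∈ sums (items mem n t).its (items mem n t).m ∨
  n < t * t ∧ Success (items mem n t).its t (nu t) (items mem n t).m (nextPrime t) ω 4

/-- A bound for the running time. -/
def time (mem : ℕ → ℕ) (n t : ℕ) : ℕ :=
  200 + n * 30 + t * 100 +
    if t * t ≤ n then 2 * t * (50 + 50 * (t + 1))
    else setupTime t + 4 * trialTime (items mem n t).its t (nu t) (items mem n t).m

theorem sum_mult_le (mem : ℕ → ℕ) (n t : ℕ) : ∑ u ∈ Finset.Ioc 0 t, mult mem n u ≤ n := by
  have h := Finset.card_eq_sum_card_fiberwise (f := mem)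
    (s := (Finset.range n).filter fun i => mem i ∈ Finset.Ioc 0 t) (t := Finset.Ioc 0 t)
    (fun i hi => (Finset.mem_filter.1 hi).2)
  calc ∑ u ∈ Finset.Ioc 0 t, mult mem n u = _ := by
        rw [h]
        refine Finset.sum_congr rfl fun u hu => ?_
        rw [mult, Finset.filter_filter]
        congr 1
        ext i
        simp only [Finset.mem_filter]
        refine and_congr_right fun _ => ⟨fun h => ⟨by rwa [h], h⟩, fun h => h.2⟩
    _ ≤ n := (Finset.card_filter_le _ _).trans (Finset.card_range n).le

-- The program compares `t * t` with `n + 1`: small targets go to the dynamic program, whose cost is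
-- then linear in `n`, the others to the randomized phase.
open Classical in
theorem wp_prog {w n t : ℕ} {s : St} (h0 : s.reg 0 = n) (h1 : s.reg 1 = t) (h2 : s.reg 2 = 0)
    (hmem : ∀ a, n ≤ a → s.mem a = 0) (hn : 0 < n)
    (hM : 2 * n + 176 * (t + 1) < 2 ^ w) (hw : 2 * (2 ^ (64 * nu t)) ^ 3 < 2 ^ w)
    (htt : t * t < 2 ^ w) :
    prog.wp w (fun s' => s'.reg 0 = (if Yes s.mem n t s.coins then 1 else 0) ∧
      s'.tm ≤ s.tm + time s.mem n t) s := by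
  refine Stm.wp_seq _ (wp_addrs h0 h1 h2 (by omega)) ?_
  rintro s1 ⟨hb1, -, m1, c1, t1⟩
  refine Stm.wp_seq _ (wp_count hb1 (by omega) (fun v _ => by rw [m1]; exact hmem _ (by omega))) ?_
  rintro s2 ⟨f2, t2, k2⟩
  have hb2 := hb1.congr (fun r hr => f2.reg r (by omega)) (f2.reg 20 (by norm_num))
    (f2.reg 21 (by norm_num))
  rw [m1] at k2
  refine Stm.wp_seq _ (wp_pair hb2 (by omega) (by omega) k2 (sum_mult_le s.mem n t)) ?_
  rintro s3 ⟨r3, e5, m3, c3, t3, i3⟩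
  rw [← items] at e5 i3
  have hml : (items s.mem n t).m ≤ 2 * t := pairing_m_le _ _
  have hits := pairing_its (mult s.mem n) t
  rw [← items] at hits
  rw [Yes, time]
  generalize items s.mem n t = P at *
  have e0 : s3.reg 0 = n := by rw [r3 0 (by norm_num) (by norm_num), hb2.r0]
  have e1 : s3.reg 1 = t := by rw [r3 1 (by norm_num) (by norm_num), hb2.r1]
  simp only [Stm.wp, Ex.Ok, Ex.val, Ex.cost, St.set_reg, reduceIte, Nat.reduceEqDiff, e0, e1,
    true_and, and_assoc]
  set s4 := ((s3.set 23 (t * t) (1 + 1 + 1 + 1)).set 24 (n + 1) (1 + 1 + 1 + 1)).tick (1 + 1 + 1) with hs4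
  have hr4 : ∀ r < 22, s4.reg r = s3.reg r := fun r hr => by
    simp only [hs4, St.tick_reg, St.set_reg]
    rw [if_neg (by omega), if_neg (by omega)]
  have hb4 : Base n t s4 := by
    refine ⟨?_, ?_, ?_, ?_, ?_, ?_, ?_, ?_, ?_, ?_, ?_, ?_, ?_, ?_, ?_⟩
    all_goals rw [hr4 _ (by norm_num), r3 _ (by norm_num) (by norm_num)]
    · exact hb2.r0
    · exact hb2.r1
    · exact hb2.r2
    · exact hb2.r4
    · exact hb2.r6
    · exact hb2.r7
    · exact hb2.r8
    · exact hb2.r9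
    · exact hb2.r10
    · exact hb2.r12
    · exact hb2.r11
    · exact hb2.r13
    · exact hb2.r14
    · exact hb2.r20
    · exact hb2.r21
  have h5 : s4.reg 5 = P.m := by rw [hr4 5 (by norm_num), e5]
  have hm4 : s4.mem = s3.mem := rfl
  have hi4 : ∀ i < P.m, s4.mem (n + 16 * (t + 1) + i) = P.its i ∧ 1 ≤ P.its i ∧ P.its i ≤ t :=
    fun i hi => ⟨by rw [hm4]; exact i3 i hi, (hits i hi).1, (hits i hi).2.1⟩
  have hz4 : ∀ x < 2 * t + 2, s4.mem (n + 32 * (t + 1) + x) = 0 := fun x hx => by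
    rw [hm4, m3 _ (by omega), f2.mem _ (by omega), m1, hmem _ (by omega)]
  have ht4 : s4.tm = s3.tm + 11 := rfl
  have hc4 : s4.coins = s.coins := by
    rw [show s4.coins = s3.coins from rfl, c3, f2.coins, c1]
  refine ⟨htt, by omega, by omega, fun h => ?_, fun h => ?_⟩
  · refine Stm.wp_mono _ ?_ (wp_dp hb4 (by omega) h5 hml hi4 hz4)
    rintro s5 ⟨d1, d2, d3⟩
    refine ⟨?_, ?_⟩
    · split_ifs with h'
      · exact d2.2 (h'.elim (fun h => h.2) fun h => absurd h.1 (by omega))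
      · have : s5.reg 22 ≠ 1 := fun h => h' (Or.inl ⟨by omega, d2.1 h⟩)
        omega
    · have : P.m * (50 + 50 * (t + 1)) ≤ 2 * t * (50 + 50 * (t + 1)) := Nat.mul_le_mul_right _ hml
      simp only [St.set_tm]
      rw [if_pos (by omega)]
      omega
  -- `0 < n < t * t` excludes `t ≤ 1`, so the randomized phase never meets degenerate parameters.
  · have ht2 : 2 ≤ t := by
      by_contra hlt
      have : t * t ≤ 1 := by
        calc t * t ≤ 1 * 1 := Nat.mul_le_mul (by omega) (by omega)
          _ = 1 := rfl
      omega
    refine Stm.wp_mono _ ?_ (wp_randomized ht2 hb4 (by omega) hw h5 hml hi4 hz4)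
    rintro s5 ⟨d1, d2⟩
    rw [hc4] at d1
    refine ⟨?_, ?_⟩
    · rw [d1]
      by_cases hS : Success P.its t (nu t) P.m (nextPrime t) s.coins 4
      · rw [if_pos hS, if_pos (Or.inr ⟨by omega, hS⟩)]
      · rw [if_neg hS, if_neg (fun h' => h'.elim (fun h => absurd h.1 (by omega)) fun h => hS h.2)]
    simp only [St.set_tm]
    rw [if_neg (by omega)]
    omega

end WordRAM

/-! ### Running time -/

namespace WordRAM

/-- Dyadic grouping: the `2 ^ k` terms with `2 ^ k ≤ d < 2 ^ (k + 1)` contribute at most `N`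
together. -/
theorem sum_div_le (N k : ℕ) : ∑ d ∈ Finset.Ico 1 (2 ^ k), N / d ≤ k * N := by
  induction k with
  | zero => simp
  | succ k ih =>
    have h1 : 1 ≤ 2 ^ k := Nat.one_le_two_pow
    rw [← Finset.sum_Ico_consecutive _ h1 (Nat.pow_le_pow_right (by norm_num) (show k ≤ k + 1 by omega))]
    have h2 : ∑ d ∈ Finset.Ico (2 ^ k) (2 ^ (k + 1)), N / d ≤ N := by
      calc ∑ d ∈ Finset.Ico (2 ^ k) (2 ^ (k + 1)), N / d
          ≤ ∑ d ∈ Finset.Ico (2 ^ k) (2 ^ (k + 1)), N / 2 ^ k :=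
            Finset.sum_le_sum fun d hd => Nat.div_le_div_left (Finset.mem_Ico.1 hd).1 (by positivity)
        _ = 2 ^ k * (N / 2 ^ k) := by
            rw [Finset.sum_const, Nat.card_Ico, smul_eq_mul, pow_succ, mul_two, Nat.add_sub_cancel]
        _ ≤ N := Nat.mul_div_le _ _
    rw [add_mul, one_mul]
    omega

/-- Bounding `2 ^ lb y` by the sum of all powers `2 ^ e` that divide `y` and exchanging the sums,
each `e` contributes `2 ^ e * (t / 2 ^ e) ≤ t`. -/
theorem sum_two_pow_lb_le {t ν : ℕ} (ht : t < 2 ^ ν) :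
    ∑ y ∈ Finset.Ico 1 (t + 1), 2 ^ lb y ≤ ν * t := by
  have hset : Finset.Ico 1 (t + 1) = Finset.Ioc 0 t := by ext; simp; omega
  have h1 : ∀ y ∈ Finset.Ioc 0 t, 2 ^ lb y ≤ ∑ e ∈ Finset.range ν, if 2 ^ e ∣ y then 2 ^ e else 0 := by
    intro y hy
    have hy' := Finset.mem_Ioc.1 hy
    have hle := two_pow_lb_le (show y ≠ 0 by omega)
    have hlt : lb y < ν := (Nat.pow_lt_pow_iff_right (by norm_num : 1 < 2)).1 (by omega)
    have h2 := Finset.single_le_sum (f := fun e => if 2 ^ e ∣ y then 2 ^ e else 0)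
      (fun _ _ => Nat.zero_le _) (Finset.mem_range.2 hlt)
    rwa [if_pos ((two_pow_dvd_iff (by omega) _).2 le_rfl)] at h2
  rw [hset]
  refine (Finset.sum_le_sum h1).trans ?_
  rw [Finset.sum_comm]
  calc ∑ e ∈ Finset.range ν, ∑ y ∈ Finset.Ioc 0 t, (if 2 ^ e ∣ y then 2 ^ e else 0)
      ≤ ∑ e ∈ Finset.range ν, t := by
        refine Finset.sum_le_sum fun e _ => ?_
        rw [← Finset.sum_filter, Finset.sum_const, Nat.Ioc_filter_dvd_card_eq_div, smul_eq_mul]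
        exact Nat.div_mul_le_self _ _
    _ = ν * t := by rw [Finset.sum_const, Finset.card_range, smul_eq_mul]

theorem setupTime_le {t : ℕ} (ht : 2 ≤ t) : setupTime t ≤ 20000 * (t * nu t ^ 2) := by
  have hν : 1 ≤ nu t := by rw [nu]; omega
  have htν : t < 2 ^ nu t := Nat.lt_pow_succ_log_self (by norm_num) t
  have h1 : ∑ d ∈ Finset.Ico 2 (2 * t + 2), (2 * t + 2) / d ≤ (nu t + 1) * (2 * t + 2) := by
    refine le_trans (Finset.sum_le_sum_of_subset ?_) (sum_div_le (2 * t + 2) (nu t + 1))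
    refine Finset.Ico_subset_Ico (by omega) ?_
    rw [pow_succ]; omega
  rw [setupTime, Finset.sum_add_distrib, Finset.sum_const, Nat.card_Ico, smul_eq_mul, ← Finset.mul_sum]
  generalize nu t = ν at *
  have a1 : ν ≤ ν ^ 2 := Nat.le_self_pow (by norm_num) ν
  have a2 : t * ν ≤ t * ν ^ 2 := Nat.mul_le_mul_left _ a1
  have a3 : t ≤ t * ν := Nat.le_mul_of_pos_right _ hν
  have a4 : 2 * ν ^ 2 ≤ t * ν ^ 2 := Nat.mul_le_mul_right _ ht
  have e1 : ν * (4100 * (ν + 1)) = 4100 * ν ^ 2 + 4100 * ν := by ring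
  have e2 : (ν + 1) * (2 * t + 2) = 2 * (t * ν) + 2 * ν + 2 * t + 2 := by ring
  omega

theorem trialTime_le {its : ℕ → ℕ} {t m : ℕ} (ht : 2 ≤ t) (hm : m ≤ 2 * t)
    (hi : ∀ i < m, i + 1 ≤ 2 * its i) : trialTime its t (nu t) m ≤ 20000 * (t * nu t ^ 2) := by
  have hν : 1 ≤ nu t := by rw [nu]; omega
  have htν : t < 2 ^ nu t := Nat.lt_pow_succ_log_self (by norm_num) t
  have h1 : ∑ i ∈ Finset.range m, t / its i ≤ (nu t + 1) * (2 * t) := by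
    calc ∑ i ∈ Finset.range m, t / its i ≤ ∑ i ∈ Finset.range m, (2 * t) / (1 + i) := by
          refine Finset.sum_le_sum fun i h => ?_
          have h2 := hi i (Finset.mem_range.1 h)
          -- `t / its i = 2 * t / (2 * its i)`, and the denominator is at least `i + 1`, so the sum
          -- becomes harmonic.
          rw [← Nat.mul_div_mul_left t (its i) (show 0 < 2 by norm_num)]
          exact Nat.div_le_div_left (by omega) (by omega)
      _ = ∑ d ∈ Finset.Ico 1 (m + 1), (2 * t) / d := by
          rw [Finset.sum_Ico_eq_sum_range, Nat.add_sub_cancel]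
      _ ≤ ∑ d ∈ Finset.Ico 1 (2 ^ (nu t + 1)), (2 * t) / d := by
          refine Finset.sum_le_sum_of_subset (Finset.Ico_subset_Ico le_rfl ?_)
          rw [pow_succ]; omega
      _ ≤ _ := sum_div_le _ _
  have h2 : ∑ y ∈ Finset.Ico 1 (t + 1), 2100 * ((lb y + 2) * 2 ^ lb y) ≤
      2100 * ((nu t + 1) * (nu t * t)) := by
    rw [← Finset.mul_sum]
    refine Nat.mul_le_mul_left _ ?_
    calc ∑ y ∈ Finset.Ico 1 (t + 1), (lb y + 2) * 2 ^ lb y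
        ≤ ∑ y ∈ Finset.Ico 1 (t + 1), (nu t + 1) * 2 ^ lb y := by
          refine Finset.sum_le_sum fun y hy => Nat.mul_le_mul_right _ ?_
          have hy' := Finset.mem_Ico.1 hy
          have hle := two_pow_lb_le (show y ≠ 0 by omega)
          have hlt : lb y < nu t := (Nat.pow_lt_pow_iff_right (by norm_num : 1 < 2)).1 (by omega)
          omega
      _ ≤ _ := by
          rw [← Finset.mul_sum]
          exact Nat.mul_le_mul_left _ (sum_two_pow_lb_le htν)
  rw [trialTime, Finset.sum_add_distrib, Finset.sum_const, Finset.card_range, smul_eq_mul,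
    ← Finset.mul_sum]
  have h3 : m * (30 * nu t + 30) ≤ 2 * t * (30 * nu t + 30) := Nat.mul_le_mul_right _ hm
  generalize nu t = ν at *
  have a1 : ν ≤ ν ^ 2 := Nat.le_self_pow (by norm_num) ν
  have a2 : t * ν ≤ t * ν ^ 2 := Nat.mul_le_mul_left _ a1
  have a3 : t ≤ t * ν := Nat.le_mul_of_pos_right _ hν
  have e1 : 2 * t * (30 * ν + 30) = 60 * (t * ν) + 60 * t := by ring
  have e2 : (ν + 1) * (2 * t) = 2 * (t * ν) + 2 * t := by ring
  have e3 : (ν + 1) * (ν * t) = t * ν ^ 2 + t * ν := by ring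
  omega

theorem items_spec (mem : ℕ → ℕ) (n t : ℕ) : (items mem n t).m ≤ 2 * t ∧
    ∀ i < (items mem n t).m, 1 ≤ (items mem n t).its i ∧ (items mem n t).its i ≤ t ∧
      i + 1 ≤ 2 * (items mem n t).its i :=
  ⟨pairing_m_le _ _, fun i hi => pairing_its _ _ i hi⟩

theorem two_le_of_lt_mul_self {n t : ℕ} (hn : 0 < n) (h : n < t * t) : 2 ≤ t := by
  by_contra hlt
  have : t * t ≤ 1 := by
    calc t * t ≤ 1 * 1 := Nat.mul_le_mul (by omega) (by omega)
      _ = 1 := rfl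
  omega

theorem time_le (mem : ℕ → ℕ) {n t : ℕ} (hn : 0 < n) :
    (time mem n t : ℝ) ≤ 1000000 * (n + t * Real.log t ^ 2) := by
  have hlog : 0 ≤ (t : ℝ) * Real.log t ^ 2 := by positivity
  by_cases h : t * t ≤ n
  · have h1 : time mem n t ≤ 1000 * n := by
      rw [time, if_pos h]
      have h2 : t ≤ t * t := Nat.le_mul_self t
      have e : 2 * t * (50 + 50 * (t + 1)) = 200 * t + 100 * (t * t) := by ring
      omega
    have h2 : (time mem n t : ℝ) ≤ 1000 * n := by exact_mod_cast h1
    have h3 : (0 : ℝ) ≤ n := Nat.cast_nonneg n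
    linarith
  · have ht := two_le_of_lt_mul_self hn (not_le.1 h)
    obtain ⟨i1, i2⟩ := items_spec mem n t
    have h1 : time mem n t ≤ 230 * n + 100100 * (t * nu t ^ 2) := by
      rw [time, if_neg h]
      have h2 := setupTime_le ht
      have h3 := trialTime_le ht i1 fun i hi => (i2 i hi).2.2
      have hν : 1 ≤ nu t ^ 2 := Nat.one_le_pow _ _ (by rw [nu]; omega)
      have h4 : t ≤ t * nu t ^ 2 := Nat.le_mul_of_pos_right _ hν
      omega
    have h2 : (time mem n t : ℝ) ≤ 230 * n + 100100 * (t * nu t ^ 2) := by exact_mod_cast h1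
    have h3 : (0 : ℝ) ≤ n := Nat.cast_nonneg n
    have ht' : (2 : ℝ) ≤ t := by exact_mod_cast ht
    have hl2 : (0.69 : ℝ) < Real.log 2 := by have := Real.log_two_gt_d9; linarith
    have hlt : Real.log 2 ≤ Real.log t := Real.log_le_log (by norm_num) ht'
    -- Both `⌊log₂ t⌋` and `1` are at most `log t / log 2` for `t ≥ 2`, and `2 / log 2 < 3`.
    have h4 : (nu t : ℝ) ≤ 3 * Real.log t := by
      have h5 : (Nat.log 2 t : ℝ) * Real.log 2 ≤ Real.log t := by
        rw [← Real.log_pow]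
        refine Real.log_le_log (by positivity) ?_
        exact_mod_cast Nat.pow_log_le_self 2 (by omega)
      have h6 : (nu t : ℝ) = Nat.log 2 t + 1 := by rw [nu]; push_cast; ring
      have h7 : (0 : ℝ) ≤ Nat.log 2 t := Nat.cast_nonneg _
      nlinarith
    have h5 : (nu t : ℝ) ^ 2 ≤ 9 * Real.log t ^ 2 := by
      calc (nu t : ℝ) ^ 2 ≤ (3 * Real.log t) ^ 2 := pow_le_pow_left₀ (Nat.cast_nonneg _) h4 2
        _ = 9 * Real.log t ^ 2 := by ring
    have h6 : (t : ℝ) * nu t ^ 2 ≤ t * (9 * Real.log t ^ 2) := by gcongr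
    linarith

/-- Words of the required length hold all intermediate results. -/
theorem word_length {n t w : ℕ} (hn : 0 < n) (hw : 256 * (Nat.log 2 (n + t) + 1) ≤ w) :
    2 * n + 176 * (t + 1) < 2 ^ w ∧ 2 * (2 ^ (64 * nu t)) ^ 3 < 2 ^ w ∧ t * t < 2 ^ w := by
  have h1 : n + t < 2 ^ (Nat.log 2 (n + t) + 1) := Nat.lt_pow_succ_log_self (by norm_num) _
  have h2 : Nat.log 2 t ≤ Nat.log 2 (n + t) := Nat.log_mono_right (by omega)
  set L := Nat.log 2 (n + t)
  refine ⟨?_, ?_, ?_⟩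
  · have h3 : 2 ^ (L + 1) * 2 ^ 9 ≤ 2 ^ w := by
      rw [← pow_add]; exact Nat.pow_le_pow_right (by norm_num) (by omega)
    omega
  -- The cube of the unit takes `192 * nu t` bits, and one more for the sign shift; this is the
  -- requirement behind the factor `256`.
  · rw [← pow_mul, ← pow_succ']
    refine Nat.pow_lt_pow_right (by norm_num) ?_
    rw [nu]; omega
  · calc t * t < 2 ^ (L + 1) * 2 ^ (L + 1) := Nat.mul_lt_mul'' (by omega) (by omega)
      _ ≤ 2 ^ w := by rw [← pow_add]; exact Nat.pow_le_pow_right (by norm_num) (by omega)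

end WordRAM

/-! ### Error probability -/

namespace WordRAM

section Polynomial
variable {R : Type*} [CommRing R]

/-- The weighted number of the sets of items with sum `t`. -/
noncomputable def weightedCount (its : ℕ → ℕ) (t m : ℕ) (r : Fin m → R) : R :=
  PowerSeries.coeff t (sumSeries its m fun i => if h : i < m then r ⟨i, h⟩ else 0)

theorem outcome_eq_weightedCount (its : ℕ → ℕ) (t ν m p : ℕ) (ω : ℕ → Bool) :
    outcome its t ν m p ω = weightedCount its t m fun i => (weight (ν - 1) ω i : ZMod p) := by
  rw [outcome, weightedCount, coeff_sumSeries, coeff_sumSeries]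
  refine Finset.sum_congr rfl fun I hI => Finset.prod_congr rfl fun i hi => ?_
  rw [dif_pos (Finset.mem_range.1 (Finset.mem_powerset.1 (Finset.mem_filter.1 hI).1 hi))]

theorem eval_weightedCount (its : ℕ → ℕ) (t m : ℕ) (r : Fin m → R) :
    MvPolynomial.eval r (weightedCount its t m MvPolynomial.X) = weightedCount its t m r := by
  rw [weightedCount, weightedCount, coeff_sumSeries, coeff_sumSeries, map_sum]
  refine Finset.sum_congr rfl fun I _ => ?_
  rw [map_prod]
  refine Finset.prod_congr rfl fun i _ => ?_
  split_ifs <;> simp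

/-- Evaluate at the indicator of a solution `I`: only subsets of `I` survive, and a proper subset
has a smaller sum because the items are positive, so the value is `1`. -/
theorem weightedCount_X_ne_zero [Nontrivial R] {its : ℕ → ℕ} {t m : ℕ} (h1 : ∀ i < m, 1 ≤ its i)
    (h : t ∈ sums its m) :
    weightedCount its t m (MvPolynomial.X : Fin m → MvPolynomial (Fin m) R) ≠ 0 := by
  obtain ⟨I, hI, hIt⟩ := mem_sums_iff.1 h
  intro h0
  have h2 := eval_weightedCount its t m fun i : Fin m => if (i : ℕ) ∈ I then (1 : R) else 0
  rw [h0, map_zero, weightedCount, coeff_sumSeries, Finset.sum_eq_single I,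
    Finset.prod_eq_one] at h2
  · exact zero_ne_one h2
  · intro i hi
    rw [dif_pos (Finset.mem_range.1 (Finset.mem_powerset.1 hI hi))]
    exact if_pos hi
  · intro J hJ hne
    obtain ⟨hJ1, hJ2⟩ := Finset.mem_filter.1 hJ
    have h3 : ¬ J ⊆ I := by
      intro hs
      obtain ⟨i, hi, hiJ⟩ := Finset.exists_of_ssubset (hs.ssubset_of_ne hne)
      have h4 := Finset.sum_lt_sum_of_subset hs hi hiJ
        (h1 i (Finset.mem_range.1 (Finset.mem_powerset.1 hI hi))) fun _ _ _ => Nat.zero_le _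
      omega
    obtain ⟨i, hi, hiI⟩ := Finset.not_subset.1 h3
    refine Finset.prod_eq_zero hi ?_
    rw [dif_pos (Finset.mem_range.1 (Finset.mem_powerset.1 hJ1 hi))]
    exact if_neg hiI
  · intro h3
    exact absurd (Finset.mem_filter.2 ⟨hI, hIt⟩) h3

theorem card_sq_le_sum_succ (I : Finset ℕ) : I.card * I.card ≤ 2 * ∑ i ∈ I, (i + 1) := by
  induction I using Finset.induction_on_max with
  | empty => simp
  | insert a s ha ih =>
    have hn : a ∉ s := fun h => lt_irrefl _ (ha a h)
    have hc : s.card ≤ a := by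
      simpa using Finset.card_le_card (fun x hx => Finset.mem_range.2 (ha x hx) : s ⊆ Finset.range a)
    rw [Finset.card_insert_of_notMem hn, Finset.sum_insert hn]
    have : (s.card + 1) * (s.card + 1) = s.card * s.card + 2 * s.card + 1 := by ring
    omega

/-- A solution `I` satisfies `|I|² ≤ 2 * ∑ (i + 1) ≤ 4 * ∑ its i = 4 * t`, since its indices are
distinct. Without the pairing the degree could be as large as `t`, and a trial would be worthless.
-/
theorem totalDegree_weightedCount_X_le [Nontrivial R] {its : ℕ → ℕ} {t m : ℕ}
    (h1 : ∀ i < m, i + 1 ≤ 2 * its i) :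
    (weightedCount its t m (MvPolynomial.X : Fin m → MvPolynomial (Fin m) R)).totalDegree ≤
      Nat.sqrt (4 * t) := by
  rw [weightedCount, coeff_sumSeries]
  refine MvPolynomial.totalDegree_finsetSum_le fun I hI => ?_
  obtain ⟨hI1, hI2⟩ := Finset.mem_filter.1 hI
  refine (MvPolynomial.totalDegree_finsetProd _ _).trans ?_
  calc _ ≤ ∑ i ∈ I, 1 := by
        refine Finset.sum_le_sum fun i _ => ?_
        split_ifs <;> simp
    _ = I.card := by simp
    _ ≤ _ := by
      rw [Nat.le_sqrt]
      refine (card_sq_le_sum_succ I).trans ?_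
      have : ∑ i ∈ I, (i + 1) ≤ ∑ i ∈ I, 2 * its i := Finset.sum_le_sum fun i hi =>
        h1 i (Finset.mem_range.1 (Finset.mem_powerset.1 hI1 hi))
      rw [← Finset.mul_sum, hI2] at this
      omega

end Polynomial

/-- The error is one-sided: the coefficient is a sum over the solutions, and an empty sum is zero
whatever the weights. -/
theorem Success.mem_sums {its : ℕ → ℕ} {t ν m p k : ℕ} {ω : ℕ → Bool}
    (h : Success its t ν m p ω k) : t ∈ sums its m := by
  obtain ⟨j, -, hj⟩ := h
  rw [outcome, coeff_sumSeries] at hj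
  obtain ⟨I, hI, -⟩ := Finset.exists_ne_zero_of_sum_ne_zero hj
  obtain ⟨hI1, hI2⟩ := Finset.mem_filter.1 hI
  exact mem_sums_iff.2 ⟨I, hI1, hI2⟩

theorem bits_congr {ω ω' : ℕ → Bool} {k : ℕ} (h : ∀ i < k, ω i = ω' i) : bits ω k = bits ω' k := by
  induction k with
  | zero => rfl
  | succ k ih => rw [bits, bits, ih fun i hi => h i (by omega), h k (by omega)]

theorem bits_inj {ω ω' : ℕ → Bool} {k : ℕ} (h : bits ω k = bits ω' k) : ∀ i < k, ω i = ω' i := by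
  induction k with
  | zero => simp
  | succ k ih =>
    rw [bits, bits] at h
    have h1 := Bool.toNat_le (ω k)
    have h2 := Bool.toNat_le (ω' k)
    intro i hi
    rcases Nat.lt_succ_iff_lt_or_eq.1 hi with h3 | rfl
    · exact ih (by omega) i h3
    · have h3 : (ω i).toNat = (ω' i).toNat := by omega
      cases h4 : ω i <;> cases h5 : ω' i <;> simp_all

/-- The number that is written by a string of bits. -/
def bitsFin {κ : ℕ} (b : Fin κ → Bool) : ℕ := bits (fun k => if h : k < κ then b ⟨k, h⟩ else false) κ

theorem bits_eq_bitsFin (ω : ℕ → Bool) (κ : ℕ) : bits ω κ = bitsFin fun k : Fin κ => ω k :=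
  bits_congr fun i hi => by rw [dif_pos hi]

theorem bitsFin_injective {κ : ℕ} : Function.Injective (bitsFin : (Fin κ → Bool) → ℕ) := by
  intro b b' h
  ext i
  have := bits_inj h i i.2
  rw [dif_pos i.2, dif_pos i.2] at this
  rw [this]

theorem natCast_bitsFin_injective {κ p : ℕ} (hp : 2 ^ κ ≤ p) :
    Function.Injective fun b : Fin κ → Bool => (bitsFin b : ZMod p) := by
  intro b b' h
  refine bitsFin_injective ?_
  have h1 : bitsFin b < p := (bits_lt _ _).trans_le hp
  have h2 : bitsFin b' < p := (bits_lt _ _).trans_le hp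
  have h3 := (ZMod.natCast_eq_natCast_iff' _ _ _).1 h
  rwa [Nat.mod_eq_of_lt h1, Nat.mod_eq_of_lt h2] at h3

open Classical in
/-- The coin tosses for which a trial fails. -/
noncomputable def failures (its : ℕ → ℕ) (t κ m p : ℕ) : Finset (Fin m → Fin κ → Bool) :=
  Finset.univ.filter fun y => weightedCount its t m (fun i => (bitsFin (y i) : ZMod p)) = 0

/-- Schwartz–Zippel on the grid of `κ`-bit weights. Because `2 ^ κ ≤ p`, different bit strings give
different residues, so counting bit patterns is counting grid points. -/
theorem card_failures_le {its : ℕ → ℕ} {t κ m p : ℕ} (hp : p.Prime) (hκ : 2 ^ κ ≤ p)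
    (h1 : ∀ i < m, 1 ≤ its i ∧ i + 1 ≤ 2 * its i) (h : t ∈ sums its m) :
    (failures its t κ m p).card * 2 ^ κ ≤ Nat.sqrt (4 * t) * 2 ^ (κ * m) := by
  classical
  have := Fact.mk hp
  set S : Finset (ZMod p) := Finset.univ.image fun b : Fin κ → Bool => (bitsFin b : ZMod p)
  have hS : S.card = 2 ^ κ := by
    rw [Finset.card_image_of_injective _ (natCast_bitsFin_injective hκ)]
    simp
  have hne := weightedCount_X_ne_zero (R := ZMod p) (fun i hi => (h1 i hi).1) h
  have hd := totalDegree_weightedCount_X_le (R := ZMod p) (t := t) (fun i hi => (h1 i hi).2)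
  have hz := MvPolynomial.schwartz_zippel_totalDegree hne S
  set B := (Fintype.piFinset fun _ : Fin m => S).filter fun f =>
    MvPolynomial.eval f (weightedCount its t m MvPolynomial.X) = 0
  have hB : (failures its t κ m p).card ≤ B.card := by
    refine Finset.card_le_card_of_injOn (fun y i => (bitsFin (y i) : ZMod p)) ?_ ?_
    · intro y hy
      refine Finset.mem_filter.2 ⟨Fintype.mem_piFinset.2 fun i =>
        Finset.mem_image_of_mem _ (Finset.mem_univ _), ?_⟩
      rw [eval_weightedCount]
      exact (Finset.mem_filter.1 hy).2
    · intro y _ y' _ hyy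
      funext i
      exact natCast_bitsFin_injective hκ (congrFun hyy i)
  rw [hS, div_le_div_iff₀ (by positivity) (by positivity)] at hz
  have hz' : B.card * 2 ^ κ ≤
      (weightedCount its t m (MvPolynomial.X : Fin m → MvPolynomial (Fin m) (ZMod p))).totalDegree *
        (2 ^ κ) ^ m := by
    exact_mod_cast hz
  rw [pow_mul]
  exact (Nat.mul_le_mul_right _ hB).trans (hz'.trans (Nat.mul_le_mul_right _ hd))

-- The event is a finite-dimensional box in the product measure, with a factor one half for each
-- position; injectivity of `e` means that no position is prescribed twice.
open MeasureTheory in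
theorem fairCoins_pattern {F : Type*} [Fintype F] (e : F → ℕ) (he : Function.Injective e)
    (y : F → Bool) : fairCoins {ω | ∀ f, ω (e f) = y f} = (2 : ENNReal)⁻¹ ^ Fintype.card F := by
  classical
  have h1 : {ω : ℕ → Bool | ∀ f, ω (e f) = y f} = Set.pi (Finset.univ.image e)
      fun i => {b | ∀ f, e f = i → b = y f} := by
    ext ω
    simp only [Set.mem_ofPred_eq, Set.mem_pi, Finset.coe_image, Finset.coe_univ, Set.image_univ,
      Set.mem_range, forall_exists_index, forall_apply_eq_imp_iff]
    constructor
    · intro h f g hg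
      rw [← hg, h]
    · exact fun h f => h f f rfl
  rw [h1, fairCoins, Measure.infinitePi_pi _ fun i _ => MeasurableSet.of_discrete,
    Finset.prod_image fun _ _ _ _ h => he h]
  have h2 : ∀ f, {b | ∀ g, e g = e f → b = y g} = {y f} := by
    intro f
    ext b
    simp only [Set.mem_ofPred_eq, Set.mem_singleton_iff]
    constructor
    · exact fun h => h f rfl
    · rintro rfl g hg
      rw [he hg]
  simp only [h2]
  rw [Finset.prod_congr rfl (g := fun _ => (2 : ENNReal)⁻¹), Finset.prod_const, Finset.card_univ]
  intro f _
  rw [PMF.toMeasure_apply_singleton _ _ (measurableSet_singleton _), PMF.uniformOfFintype_apply]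
  simp

/-- The position of a coin toss. -/
def position (m κ : ℕ) (f : Fin 4 × Fin m × Fin κ) : ℕ := f.1 * (m * κ) + (f.2.1 * κ + f.2.2)

theorem position_injective (m κ : ℕ) : Function.Injective (position m κ) := by
  have h1 : ∀ f, position m κ f = finProdFinEquiv (f.1, finProdFinEquiv (f.2.1, f.2.2)) := by
    rintro ⟨a, b, c⟩
    simp only [position, finProdFinEquiv_apply_val]
    ring
  intro f g h
  rw [h1, h1] at h
  have h2 := finProdFinEquiv.injective (Fin.ext h)
  have h3 := finProdFinEquiv.injective (Prod.ext_iff.1 h2).2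
  exact Prod.ext (Prod.ext_iff.1 h2).1 h3

/-- Four failing trials read off a quadruple of failing coin patterns at disjoint positions, so a
union bound over these quadruples suffices. Only monotonicity and subadditivity are used;
measurability of the event is not needed. -/
theorem fairCoins_not_success_le {its : ℕ → ℕ} {t ν m p : ℕ} :
    fairCoins {ω | ¬ Success its t ν m p ω 4} ≤
      (failures its t (ν - 1) m p).card ^ 4 * (2 : ENNReal)⁻¹ ^ (4 * (m * (ν - 1))) := by
  classical
  set κ := ν - 1 with hκ
  set B := Fintype.piFinset fun _ : Fin 4 => failures its t κ m p
  have h1 : {ω | ¬ Success its t ν m p ω 4} ⊆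
      ⋃ y ∈ B, {ω | ∀ f, ω (position m κ f) = y f.1 f.2.1 f.2.2} := by
    intro ω hω
    simp only [Set.mem_iUnion, Set.mem_ofPred_eq]
    refine ⟨fun j i k => ω (position m κ (j, i, k)), Fintype.mem_piFinset.2 fun j => ?_, fun _ => rfl⟩
    refine Finset.mem_filter.2 ⟨Finset.mem_univ _, ?_⟩
    by_contra h
    refine hω ⟨j, j.2, ?_⟩
    rw [outcome_eq_weightedCount]
    convert h using 5 with i
    rw [weight, bits_eq_bitsFin]
    rfl
  refine (MeasureTheory.measure_mono h1).trans ((MeasureTheory.measure_biUnion_finset_le _ _).trans ?_)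
  rw [Finset.sum_congr rfl fun y _ => fairCoins_pattern _ (position_injective m κ) fun f =>
    y f.1 f.2.1 f.2.2, Finset.sum_const, nsmul_eq_mul, Fintype.card_piFinset]
  simp

/-- With `D² ≤ 4 * t` and `2 ^ κ ≥ t / 2`, one trial fails with probability at most `D / 2 ^ κ`, and
the fourth power is at most `256 / t²`. From `n < t²` and `t ≤ t²` follows `n + t ≤ 2 * t²`; four is
the number of trials that makes this work. -/
theorem fairCoins_four_trials_le {its : ℕ → ℕ} {n t m : ℕ} (hn : n < t * t) (ht : 2 ≤ t)
    (h1 : ∀ i < m, 1 ≤ its i ∧ i + 1 ≤ 2 * its i) (h : t ∈ sums its m) :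
    fairCoins {ω | ¬ Success its t (nu t) m (nextPrime t) ω 4} ≤
      ENNReal.ofReal (1000000 * ((n : ℝ) + t)⁻¹) := by
  refine fairCoins_not_success_le.trans ?_
  have hκ : nu t - 1 = Nat.log 2 t := by rw [nu, Nat.add_sub_cancel]
  rw [hκ]
  have hlo : 2 ^ Nat.log 2 t ≤ t := Nat.pow_log_le_self 2 (by omega)
  have hhi : t < 2 ^ (Nat.log 2 t + 1) := Nat.lt_pow_succ_log_self (by norm_num) t
  have hc := card_failures_le (κ := Nat.log 2 t) (nextPrime_prime t)
    (hlo.trans (lt_nextPrime t).le) h1 h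
  generalize Nat.log 2 t = κ at *
  generalize (failures its t κ m (nextPrime t)).card = b at *
  have hD := Nat.sqrt_le (4 * t)
  generalize Nat.sqrt (4 * t) = D at *
  have e1 : (b : ENNReal) ^ 4 * (2 : ENNReal)⁻¹ ^ (4 * (m * κ)) =
      ENNReal.ofReal ((b / 2 ^ (κ * m)) ^ 4) := by
    rw [ENNReal.ofReal_pow (by positivity), ENNReal.ofReal_div_of_pos (by positivity),
      ENNReal.ofReal_natCast, ENNReal.ofReal_pow (by norm_num), ENNReal.ofReal_ofNat,
      pow_mul' _ 4, ← mul_pow, ← ENNReal.inv_pow, mul_comm m, ← div_eq_mul_inv]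
  rw [e1]
  refine ENNReal.ofReal_le_ofReal ?_
  have hK : (0 : ℝ) < 2 ^ κ := by positivity
  have hc' : (b : ℝ) / 2 ^ (κ * m) ≤ D / 2 ^ κ := by
    rw [div_le_div_iff₀ (by positivity) hK]
    exact_mod_cast hc
  have hD' : (D : ℝ) * D ≤ 4 * t := by exact_mod_cast hD
  have ht' : (2 : ℝ) ≤ t := by exact_mod_cast ht
  have hn' : (n : ℝ) ≤ t * t := by exact_mod_cast hn.le
  have hK2 : (t : ℝ) ≤ 2 ^ κ * 2 := by rw [pow_succ] at hhi; exact_mod_cast hhi.le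
  calc ((b : ℝ) / 2 ^ (κ * m)) ^ 4 ≤ (D / 2 ^ κ) ^ 4 := by gcongr
    _ = ((D : ℝ) * D) ^ 2 / ((2 : ℝ) ^ κ) ^ 4 := by rw [div_pow]; ring
    _ ≤ (4 * (t : ℝ)) ^ 2 / ((t : ℝ) / 2) ^ 4 := by
      gcongr
      linarith
    _ = 256 * ((t : ℝ) * t)⁻¹ := by field_simp; norm_num
    _ ≤ 256 * (((n : ℝ) + t) / 2)⁻¹ := by
      gcongr
      nlinarith
    _ = 512 * ((n : ℝ) + t)⁻¹ := by rw [inv_div]; ring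
    _ ≤ _ := by gcongr; norm_num

/-! ### The program on the given input, and the conclusion -/

theorem mult_input {n : ℕ} (s : Fin n → ℕ) (t : ℕ) (ω : ℕ → Bool) (u : ℕ) :
    mult (input s t ω).mem n u = (Finset.univ.filter fun i => s i = u).card := by
  rw [mult]
  refine Eq.symm (Finset.card_bij (fun (i : Fin n) _ => (i : ℕ)) ?_ ?_ ?_)
  · intro i hi
    refine Finset.mem_filter.2 ⟨Finset.mem_range.2 i.2, ?_⟩
    simpa [input] using hi
  · exact fun _ _ _ _ h => Fin.ext h
  · intro i hi
    obtain ⟨h1, h2⟩ := Finset.mem_filter.1 hi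
    refine ⟨⟨i, Finset.mem_range.1 h1⟩, ?_, rfl⟩
    simpa [input, Finset.mem_range.1 h1] using h2

open Pointwise in
theorem mem_sums_items_iff {n : ℕ} {s : Fin n → ℕ} (hs : ∀ i, 0 < s i) (t : ℕ) (ω : ℕ → Bool) :
    t ∈ sums (items (input s t ω).mem n t).its (items (input s t ω).mem n t).m ↔
      SubsetSum s t := by
  rw [items, mem_sums_pairing_iff, subsetSum_iff hs]
  simp only [mult_input]

theorem Yes.subsetSum {n t : ℕ} {s : Fin n → ℕ} (hs : ∀ i, 0 < s i) {ω ω' : ℕ → Bool}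
    (h : Yes (input s t ω).mem n t ω') : SubsetSum s t :=
  (mem_sums_items_iff hs t ω).1 (h.elim (fun h => h.2) fun h => h.2.mem_sums)

-- The abstract clock starts at `0`, so its final value is the number of machine steps, and the
-- postcondition of `wp_prog` becomes a statement about the compiled code.
open Classical in
theorem exists_answers {n t w : ℕ} {s : Fin n → ℕ} (hn : 0 < n)
    (hw : 256 * (Nat.log 2 (n + t) + 1) ≤ w) (ω : ℕ → Bool) :
    ∃ T, Answers w prog.code s t ω (decide (Yes (input s t ω).mem n t ω)) T ∧
      T ≤ time (input s t ω).mem n t := by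
  obtain ⟨w1, w2, w3⟩ := word_length hn hw
  have h := wp_prog (w := w) (n := n) (t := t) (s := ⟨(input s t ω).reg, (input s t ω).mem, ω, 0⟩)
    rfl rfl rfl (fun a ha => dif_neg (by omega)) hn w1 w2 w3
  obtain ⟨σ', s', T, h1, h2, h3, h4, h5⟩ := prog.exec_code prog_wf
    (σ := input s t ω) ⟨fun _ _ => rfl, rfl, rfl⟩ h
  refine ⟨T, ⟨σ', h1, ?_⟩, by simpa [h3] using h5⟩
  rw [h2.1 0 (by norm_num), h4]
  by_cases hy : Yes (input s t ω).mem n t ω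
  · rw [if_pos hy, decide_eq_true hy]; rfl
  · rw [if_neg hy, decide_eq_false hy]; rfl

/-- Determinism identifies any run that answers "no" with the run already analysed. -/
theorem not_yes_of_answers {n t w T : ℕ} {s : Fin n → ℕ} (hn : 0 < n)
    (hw : 256 * (Nat.log 2 (n + t) + 1) ≤ w) {ω : ℕ → Bool}
    (h : Answers w prog.code s t ω false T) : ¬ Yes (input s t ω).mem n t ω := by
  classical
  intro hy
  obtain ⟨T', ⟨σ', h1, h2⟩, -⟩ := exists_answers (s := s) hn hw ω
  obtain ⟨σ, h3, h4⟩ := h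
  obtain ⟨rfl, -⟩ := h1.deterministic h3
  rw [decide_eq_true hy, h4] at h2
  exact absurd h2 (by simp)

theorem fairCoins_answers_false_le {n t w : ℕ} {s : Fin n → ℕ} (hn : 0 < n) (hs : ∀ i, 0 < s i)
    (hw : 256 * (Nat.log 2 (n + t) + 1) ≤ w) (h : SubsetSum s t) :
    fairCoins {ω | ∃ T, Answers w prog.code s t ω false T} ≤
      ENNReal.ofReal (1000000 * ((n : ℝ) + t)⁻¹) := by
  have hm := (mem_sums_items_iff hs t fun _ => false).2 h
  rcases le_or_gt (t * t) n with ht | ht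
  -- In the range of the dynamic program the answer is always right, so the event is empty.
  · refine (MeasureTheory.measure_mono (t := ∅) ?_).trans (by simp)
    rintro ω ⟨T, hT⟩
    exact not_yes_of_answers hn hw hT (Or.inl ⟨ht, (mem_sums_items_iff hs t ω).2 h⟩)
  · refine le_trans (MeasureTheory.measure_mono ?_) (fairCoins_four_trials_le ht
      (two_le_of_lt_mul_self hn ht) (fun i hi =>
        ⟨((items_spec _ _ _).2 i hi).1, ((items_spec _ _ _).2 i hi).2.2⟩) hm)
    rintro ω ⟨T, hT⟩ hS
    exact not_yes_of_answers hn hw hT (Or.inr ⟨ht, hS⟩)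

end WordRAM

theorem mainTheorem1 :
    ∃ (p : WordRAM.Program) (K : ℕ) (C : ℝ), 0 < K ∧ 0 < C ∧
      ∀ (n t w : ℕ) (s : Fin n → ℕ), 0 < n → (∀ i, 0 < s i) →
        K * (Nat.log 2 (n + t) + 1) ≤ w → (∀ i, s i < 2 ^ w) →
        (∀ ω : ℕ → Bool, ∃ (b : Bool) (T : ℕ), WordRAM.Answers w p s t ω b T ∧
          (T : ℝ) ≤ C * (n + t * Real.log t ^ 2)) ∧
        (SubsetSum s t →
          WordRAM.fairCoins {ω | ∃ T, WordRAM.Answers w p s t ω false T} ≤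
            ENNReal.ofReal (C * ((n : ℝ) + t)⁻¹)) ∧
        (¬ SubsetSum s t →
          ∀ ω : ℕ → Bool, ∃ T, WordRAM.Answers w p s t ω false T) := by
  refine ⟨WordRAM.prog.code, 256, 1000000, by norm_num, by norm_num, fun n t w s hn hs hw _ =>
    ⟨fun ω => ?_, WordRAM.fairCoins_answers_false_le hn hs hw, fun h ω => ?_⟩⟩
  · obtain ⟨T, h1, h2⟩ := WordRAM.exists_answers (s := s) hn hw ω
    exact ⟨_, T, h1, (Nat.cast_le.2 h2).trans (WordRAM.time_le _ hn)⟩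
  · obtain ⟨T, h1, -⟩ := WordRAM.exists_answers (s := s) hn hw ω
    rw [@decide_eq_false _ (Classical.propDecidable _) fun hy => h (WordRAM.Yes.subsetSum hs hy)] at h1
    exact ⟨T, h1⟩
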